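/- Let $M$ be a smooth (Hausdorff, $\sigma$-compact) oriented surface with a smooth torsion-free affine connection $\nabla$ (a representative of a projective structure) and a metaplectic structure. Let $\mathcal E(w)$ be the bundle of densities of weight $w$, with $\mathcal E(-3)$ the volume forms; let $\omega_{ab}\in\mathcal E_{[ab]}(3)$ be the canonical symplectic form, $\omega^{ab}$ its inverse, and let $\mathcal S$ be the bundle of symplectic spinors, induced from the smooth vectors of the Segal--Shale--Weil representation of $Mp(2,\mathbb R)$, with gamma matrices $\gamma_a\gamma_b-\gamma_b\gamma_a=2\omega_{ab}$, $\gamma_a\in\mathcal E_a\otimes\operatorname{End}(\mathcal S)(\tfrac32)$, and $\mathcal S(w)=\mathcal S\otimes\mathcal E(w)$. Let $$\slashed D_s=\omega^{rs}\gamma_r\nabla_s:\ \mathcal S(-\tfrac34)\to\mathcal S(-\tfrac94)$$ be the symplectic Dirac operator. Differential operators between the bundles $\mathcal S(w)$ are understood to have coefficients in the bundle of (complex) symplectic Clifford algebras, with a bound on the number of gamma factors. Such an operator $P$ of order at most $k$ can be written $$P=\sum_{j\ge 0}\sigma_j^{a_1\ldots a_kb_1\ldots b_j}\gamma_{b_1}\cdots\gamma_{b_j}\nabla_{a_1}\cdots\nabla_{a_k}+\text{lower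 order terms}$$ with unique tensors $\sigma_j$ (finitely many of them nonzero) symmetric in $a_1\ldots a_k$ and in $b_1\ldots b_j$; the family $(\sigma_j)_j$ is its principal symbol of order $k$. The principal symbol is *in Cartan form* if every $\sigma_j$ is symmetric in all the indices $a_1\ldots a_kb_1\ldots b_j$, and it lies in $S^kTM\otimes 1$ if $\sigma_j=0$ for all $j\ge1$. Two operators $P,P'$ on $\mathcal S(-\tfrac34)$ are *congruent modulo $\slashed D_s$* if $P-P'=T\slashed D_s$ for a differential operator $T$. Let $k\ge 0$ and let $\mathcal O:\mathcal S(-\tfrac34)\to\mathcal S(-\tfrac34)$ be a differential operator of order at most $k$. 1. $\mathcal O$ is congruent modulo $\slashed D_s$ to an operator $\mathcal R$ of order at most $k$ whose principal symbol of order $k$ is in Cartan form. 2. Let $\mathcal R$ be any operator as in 1, with principal symbol $(\sigma_j)_j$, and suppose that $\sigma_j\neq0$ at a point $p\in M$ for some $j\ge1$ (in particular this covers the components with $j=2i\ge2$ gamma factors). Then, modulo $\slashed D_s$, the composition $\slashed D_s\mathcal O$ has order exactly $k+1$ with nonvanishing symbol: $\slashed D_s\mathcal O$ has order at most $k+1$,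 no operator congruent to it modulo $\slashed D_s$ has order at most $k$, and every operator of order at most $k+1$ congruent to it modulo $\slashed D_s$ has a principal symbol of order $k+1$ that is nonzero at $p$. 3. Suppose that $\mathcal O$ is a symmetry of $\slashed D_s$, i.e. $\slashed D_s\mathcal O=\mathcal O'\slashed D_s$ for some differential operator $\mathcal O'$ on $\mathcal S(-\tfrac94)$. Then $\mathcal O$ is congruent modulo $\slashed D_s$ to an operator of order at most $k$ whose principal symbol of order $k$ lies in $S^kTM\otimes1$; moreover, whenever $\mathcal R$ is as in 1, its principal symbol of order $k$ lies in $S^kTM\otimes1$. -/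

import Mathlib

open scoped Manifold ContDiff SchwartzMap FourierTransform

noncomputable section

namespace SymplecticSpinor

/-! ### The symplectic Clifford algebra acting on the spinor fibre -/

/-- The coordinate plane. -/
abbrev Plane : Type := EuclideanSpace ℝ (Fin 2)

/-- The fibre of the spinor bundle: the smooth vectors of the Segal-Shale-Weil representation,
realised as Schwartz functions on a Lagrangian line of the symplectic plane. The even and the odd
functions are the two half-spinor modules. -/
abbrev Spinor : Type := 𝓢(ℝ, ℂ)

/-- The standard symplectic form `ω_{ab}` on the plane, `ω_{12} = 1`. -/
def omega : Matrix (Fin 2) (Fin 2) ℝ := !![0, 1; -1, 0]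

/-- The inverse form `ω^{ab}`, normalised by `ω^{ja} ω_{jb} = δ^a_b`. -/
def omegaInv : Matrix (Fin 2) (Fin 2) ℝ := !![0, 1; -1, 0]

/-- The symplectic gamma matrices `γ_a`, with `γ_a γ_b - γ_b γ_a = 2 ω_{ab}`. The scalar factors
make the exponentials of real quadratic expressions in `γ` unitary. -/
def gamma (a : Fin 2) : Spinor →L[ℂ] Spinor :=
  if a = 0 then (1 + Complex.I) • SchwartzMap.derivCLM ℂ ℂ
  else (1 - Complex.I) • SchwartzMap.smulLeftCLM ℂ (fun s : ℝ => (s : ℂ))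

/-- `γ^a = ω^{ab} γ_b`. -/
def gammaUp (a : Fin 2) : Spinor →L[ℂ] Spinor :=
  ∑ b, ((omegaInv a b : ℝ) : ℂ) • gamma b

/-- Clifford multiplication `γ(v) = v^a γ_a` by a vector. -/
def cliff (v : Fin 2 → ℝ) : Spinor →L[ℂ] Spinor :=
  ∑ a, ((v a : ℝ) : ℂ) • gamma a

/-- The product `γ_{b_1} ⋯ γ_{b_j}`. -/
def gammaProd {j : ℕ} (b : Fin j → Fin 2) : Spinor →L[ℂ] Spinor :=
  (List.ofFn fun l => gamma (b l)).prod

/-- The action `- ¼ F^c_b γ_c γ^b` of a (trace-free) matrix `F = (F^c_b)` on spinors; this is the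
action of `𝔰𝔩(2, ℝ)` for which `[F ·, γ(v)] = γ(F v)`. -/
def spinAct (F : Matrix (Fin 2) (Fin 2) ℝ) : Spinor →L[ℂ] Spinor :=
  (-(1 / 4 : ℂ)) • ∑ c, ∑ b, ((F c b : ℝ) : ℂ) • (gamma c * gammaUp b)

/-- The metaplectic group `Mp(2, ℝ)` in the Segal-Shale-Weil representation: it is generated by the
two one-parameter groups lifting the lower and the upper unipotent matrices, i.e. by the
multiplications by `exp (i r s²)` and by their conjugates under the Fourier transform. -/
def metaplecticGroup : Subgroup (Spinor ≃L[ℂ] Spinor) :=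
  Subgroup.closure {U | ∃ r : ℝ,
    (∀ (f : Spinor) (s : ℝ), U f s = Complex.exp (Complex.I * r * s ^ 2) * f s) ∨
    (∀ (f : Spinor) (s : ℝ), 𝓕 (U f) s = Complex.exp (Complex.I * r * s ^ 2) * 𝓕 f s)}

/-! ### Calculus of spinor-valued functions on the plane -/

/-- The `a`-th standard basis vector of the plane. -/
def stdVec (a : Fin 2) : Plane := EuclideanSpace.single a 1

/-- The partial derivative `∂_a f`, taken in the topology of the Schwartz space. -/
def pd (a : Fin 2) (f : Plane → Spinor) (x : Plane) : Spinor :=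
  deriv (fun t : ℝ => f (x + t • stdVec a)) 0

/-- The iterated partial derivative `∂_{a_1} ⋯ ∂_{a_m} f`. -/
def pdIter : (m : ℕ) → (Fin m → Fin 2) → (Plane → Spinor) → Plane → Spinor
  | 0, _, f => f
  | m + 1, a, f => pd (a 0) (pdIter m (Fin.tail a) f)

/-- Smoothness on an open set `V` of a function with values in the Fréchet space of spinors: all
iterated partial derivatives exist and are continuous on `V`. -/
def SmoothOn (f : Plane → Spinor) (V : Set Plane) : Prop :=
  ∀ (m : ℕ) (a : Fin m → Fin 2), ContinuousOn (pdIter m a f) V ∧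
    ∀ x ∈ V, ∀ b : Fin 2, DifferentiableAt ℝ (fun t : ℝ => pdIter m a f (x + t • stdVec b)) 0

/-! ### Metaplectic structures on surfaces and weighted symplectic spinors -/

/-- The coordinates in the chart `e` of the intersection of the domains of `e` and `e'`. -/
def overlap {M : Type*} [TopologicalSpace M] (e e' : OpenPartialHomeomorph M Plane) : Set Plane :=
  (e.symm.trans e').source

/-- The Jacobian matrix at `x` of the coordinate change from `e` to `e'`. -/
def jacobian {M : Type*} [TopologicalSpace M] (e e' : OpenPartialHomeomorph M Plane) (x : Plane) :
    Matrix (Fin 2) (Fin 2) ℝ :=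
  Matrix.of fun c b => (fderiv ℝ (fun y => e' (e.symm y)) x (stdVec b)) c

/-- The Jacobian matrix rescaled to determinant one: the coordinate change of the bundle of tangent
vectors of weight `-3/2`, which carries the canonical symplectic form. -/
def unimodularJacobian {M : Type*} [TopologicalSpace M] (e e' : OpenPartialHomeomorph M Plane)
    (x : Plane) : Matrix (Fin 2) (Fin 2) ℝ :=
  ((jacobian e e' x).det ^ (-(1 / 2) : ℝ)) • jacobian e e' x

/-- The partial derivative `∂_a` of the rescaled Jacobian matrix. -/
def unimodularJacobianDeriv {M : Type*} [TopologicalSpace M]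
    (e e' : OpenPartialHomeomorph M Plane) (a : Fin 2) (x : Plane) :
    Matrix (Fin 2) (Fin 2) ℝ :=
  Matrix.of fun c b => fderiv ℝ (fun y => unimodularJacobian e e' y c b) x (stdVec a)

/-- A metaplectic structure on a smooth surface `M`: an oriented smooth atlas together with a
cocycle of lifts to `Mp(2, ℝ)` of the coordinate changes, rescaled to `SL(2, ℝ)`. -/
structure MetaplecticStructure (ι M : Type*) [TopologicalSpace M] [ChartedSpace Plane M] where
  chart : ι → OpenPartialHomeomorph M Plane
  chart_mem : ∀ i, chart i ∈ IsManifold.maximalAtlas 𝓘(ℝ, Plane) ∞ M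
  cover : ∀ p : M, ∃ i, p ∈ (chart i).source
  oriented : ∀ i j, ∀ x ∈ overlap (chart i) (chart j), 0 < (jacobian (chart i) (chart j) x).det
  /-- The lift of the coordinate change from chart `i` to chart `j`. -/
  lift : ι → ι → Plane → (Spinor ≃L[ℂ] Spinor)
  lift_mem : ∀ i j, ∀ x ∈ overlap (chart i) (chart j), lift i j x ∈ metaplecticGroup
  /-- `lift i j x` covers the rescaled Jacobian matrix `g`, i.e. `U γ(v) U⁻¹ = γ(g v)`. -/
  lift_cliff : ∀ i j, ∀ x ∈ overlap (chart i) (chart j), ∀ (v : Fin 2 → ℝ) (f : Spinor),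
    lift i j x (cliff v f) =
      cliff ((unimodularJacobian (chart i) (chart j) x).mulVec v) (lift i j x f)
  /-- The lift is a smooth map to the covering group: it acts on smooth functions, and its
  logarithmic derivative is that of `g`, acting on spinors through `𝔰𝔩(2, ℝ)`. -/
  lift_smooth : ∀ i j, ∀ V ⊆ overlap (chart i) (chart j), IsOpen V →
    ∀ f : Plane → Spinor, SmoothOn f V →
      SmoothOn (fun x => lift i j x (f x)) V ∧
      ∀ x ∈ V, ∀ a : Fin 2, pd a (fun y => lift i j y (f y)) x =
        spinAct (unimodularJacobianDeriv (chart i) (chart j) a x *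
          (unimodularJacobian (chart i) (chart j) x)⁻¹) (lift i j x (f x)) +
        lift i j x (pd a f x)
  cocycle : ∀ i j k, ∀ x ∈ overlap (chart i) (chart j), x ∈ overlap (chart i) (chart k) →
    ∀ f : Spinor, lift j k (chart j ((chart i).symm x)) (lift i j x f) = lift i k x f

section Bundle

variable {ι M : Type*} [TopologicalSpace M] [ChartedSpace Plane M]

/-- A smooth section of the bundle `𝒮(w)` of symplectic spinors of weight `w`, given by its
expressions `φ i` in the charts (only their values on the targets of the charts matter). The
density bundle `ℰ(w)` is normalised so that `ℰ(-3)` is the bundle of volume forms. -/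
structure IsSection (A : MetaplecticStructure ι M) (w : ℝ) (φ : ι → Plane → Spinor) : Prop where
  smooth : ∀ i, SmoothOn (φ i) (A.chart i).target
  compat : ∀ i j, ∀ x ∈ overlap (A.chart i) (A.chart j),
    φ j (A.chart j ((A.chart i).symm x)) =
      (((jacobian (A.chart i) (A.chart j) x).det ^ (w / 3) : ℝ) : ℂ) • A.lift i j x (φ i x)

/-- Equality of two sections, given by their expressions in the charts. -/
def SameSection (A : MetaplecticStructure ι M) (φ ψ : ι → Plane → Spinor) : Prop :=
  ∀ i, ∀ x ∈ (A.chart i).target, φ i x = ψ i x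

/-! ### Differential operators with Clifford algebra coefficients -/

/-- A differential operator `𝒮(w) → 𝒮(w')` of order at most `k` with coefficients in the bundle of
symplectic Clifford algebras. In the chart `i` it is
`∑ c^{a_1 … a_m b_1 … b_j}(x) γ_{b_1} ⋯ γ_{b_j} ∂_{a_1} ⋯ ∂_{a_m}`, summed over `m ≤ k` and
`j ≤ deg`, with `c` symmetric in the `a`'s and symmetric in the `b`'s. -/
structure DiffOp (A : MetaplecticStructure ι M) (w w' : ℝ) (k : ℕ) where
  deg : ℕ
  coeff : ι → (m j : ℕ) → Plane → (Fin m ⊕ Fin j → Fin 2) → ℂ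
  coeff_smooth : ∀ i m j c, ContDiffOn ℝ ∞ (fun x => coeff i m j x c) (A.chart i).target
  coeff_symm : ∀ i m j, ∀ x ∈ (A.chart i).target, ∀ (π : Equiv.Perm (Fin m))
    (ρ : Equiv.Perm (Fin j)) (c : Fin m ⊕ Fin j → Fin 2),
    coeff i m j x (c ∘ Equiv.sumCongr π ρ) = coeff i m j x c
  /-- The local expressions fit together to a map of sections. -/
  map_section : ∀ φ, IsSection A w φ → IsSection A w' fun i x =>
    ∑ m ∈ Finset.range (k + 1), ∑ j ∈ Finset.range (deg + 1), ∑ c : Fin m ⊕ Fin j → Fin 2,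
      coeff i m j x c • gammaProd (c ∘ Sum.inr) (pdIter m (c ∘ Sum.inl) (φ i) x)

variable {A : MetaplecticStructure ι M} {w w' : ℝ} {k : ℕ}

/-- The action of a differential operator. -/
def DiffOp.apply (P : DiffOp A w w' k) (φ : ι → Plane → Spinor) : ι → Plane → Spinor :=
  fun i x =>
    ∑ m ∈ Finset.range (k + 1), ∑ j ∈ Finset.range (P.deg + 1), ∑ c : Fin m ⊕ Fin j → Fin 2,
      P.coeff i m j x c • gammaProd (c ∘ Sum.inr) (pdIter m (c ∘ Sum.inl) (φ i) x)

/-- The component with `j` gamma factors of the principal symbol (of order `k`), at the point with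
coordinates `x` in the chart `i`: a tensor with indices `a_1 … a_k` and `b_1 … b_j`, symmetric in
either group. -/
def DiffOp.symbol (P : DiffOp A w w' k) (i : ι) (x : Plane) (j : ℕ)
    (c : Fin k ⊕ Fin j → Fin 2) : ℂ :=
  if j ≤ P.deg then P.coeff i k j x c else 0

/-- All components of the principal symbol lie in the Cartan part, i.e. they are symmetric in all
the indices `a_1 … a_k b_1 … b_j`. -/
def DiffOp.HasCartanSymbol (P : DiffOp A w w' k) : Prop :=
  ∀ i, ∀ x ∈ (A.chart i).target, ∀ (j : ℕ) (π : Equiv.Perm (Fin k ⊕ Fin j))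
    (c : Fin k ⊕ Fin j → Fin 2), P.symbol i x j (c ∘ π) = P.symbol i x j c

/-- The principal symbol is a section of `S^k TM ⊗ 1`. -/
def DiffOp.HasScalarSymbol (P : DiffOp A w w' k) : Prop :=
  ∀ i, ∀ x ∈ (A.chart i).target, ∀ j : ℕ, 1 ≤ j → P.symbol i x j = 0

/-! ### The symplectic Dirac operator and its symmetries -/

/-- The coordinate vector field `∂_b` of a chart (meaningful on the domain of the chart). -/
def coordField (e : OpenPartialHomeomorph M Plane) (b : Fin 2) (p : M) :
    TangentSpace 𝓘(ℝ, Plane) p :=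
  mfderiv 𝓘(ℝ, Plane) 𝓘(ℝ, Plane) e.symm (e p) (stdVec b)

variable [IsManifold 𝓘(ℝ, Plane) ∞ M]

/-- An affine connection: a covariant derivative on the tangent bundle. -/
abbrev AffineConnection (M : Type*) [TopologicalSpace M] [ChartedSpace Plane M]
    [IsManifold 𝓘(ℝ, Plane) ∞ M] : Type _ :=
  CovariantDerivative 𝓘(ℝ, Plane) Plane (TangentSpace 𝓘(ℝ, Plane) : M → Type _)

/-- The Christoffel symbols in the chart `e` of an affine connection: `christoffel e ∇ a x` is the
matrix `(Γ_a{}^c{}_b)` with `∇_{∂_a} ∂_b = Γ_a{}^c{}_b ∂_c`. -/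
def christoffel (e : OpenPartialHomeomorph M Plane)
    (nabla : AffineConnection M)
    (a : Fin 2) (x : Plane) : Matrix (Fin 2) (Fin 2) ℝ :=
  Matrix.of fun c b =>
    (show Plane from mfderiv 𝓘(ℝ, Plane) 𝓘(ℝ, Plane) e (e.symm x)
      (nabla (coordField e b) (e.symm x) (coordField e a (e.symm x)))) c

/-- The expression in the chart `e` of the covariant derivative `∇_a φ` of a spinor of weight `w`:
the trace-free part of the Christoffel symbols acts on spinors, the trace on densities. -/
def spinNabla (e : OpenPartialHomeomorph M Plane)
    (nabla : AffineConnection M)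
    (w : ℝ) (a : Fin 2) (f : Plane → Spinor) (x : Plane) : Spinor :=
  pd a f x +
    spinAct (christoffel e nabla a x -
      ((christoffel e nabla a x).trace / 2) • (1 : Matrix (Fin 2) (Fin 2) ℝ)) (f x) +
    ((w / 3 * (christoffel e nabla a x).trace : ℝ) : ℂ) • f x

/-- The symplectic Dirac operator `D_s = ω^{rs} γ_r ∇_s : 𝒮(-3/4) → 𝒮(-9/4)`. -/
def symplecticDirac (A : MetaplecticStructure ι M)
    (nabla : AffineConnection M)
    (φ : ι → Plane → Spinor) : ι → Plane → Spinor :=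
  fun i x => ∑ r, ∑ s, ((omegaInv r s : ℝ) : ℂ) •
    gamma r (spinNabla (A.chart i) nabla (-3 / 4) s (φ i) x)

/-- `O` is a symmetry of `D_s`: there is a differential operator `O'` with `D_s O = O' D_s`. -/
def IsSymmetry
    (nabla : AffineConnection M)
    (O : DiffOp A (-3 / 4) (-3 / 4) k) : Prop :=
  ∃ (l : ℕ) (O' : DiffOp A (-9 / 4) (-9 / 4) l), ∀ φ, IsSection A (-3 / 4) φ →
    SameSection A (symplecticDirac A nabla (O.apply φ)) (O'.apply (symplecticDirac A nabla φ))

/-- `R = P - T D_s` as operators on `𝒮(-3/4)`, where `P` is given by its action on sections. -/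
def EqModDirac
    (nabla : AffineConnection M)
    {l : ℕ} (R : DiffOp A (-3 / 4) w k) (P : (ι → Plane → Spinor) → ι → Plane → Spinor)
    (T : DiffOp A (-9 / 4) w l) : Prop :=
  ∀ φ, IsSection A (-3 / 4) φ →
    SameSection A (R.apply φ) (P φ - T.apply (symplecticDirac A nabla φ))

end Bundle

end SymplecticSpinor

end

open SymplecticSpinor

noncomputable section

namespace SymplecticSpinor

section

open Filter Topology Set

/-! ### Partial derivatives of spinor-valued functions -/

/-! In a chart, an operator is encoded by its full Weyl symbol. This is a polynomial in covector
variables `ξ_0, ξ_1`, standing for partial derivatives, and Clifford variables `y_0, y_1`, whose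
monomials stand for Weyl ordered products of gamma matrices (`opAt`, `LocSymb`). The operator
determines the symbol (`eq_zero_of_opAt_eq_zero`). Left and right multiplication by `γ_a` become
`y_a ± ω_{ab} ∂/∂y_b`. Put `Q = y_0 ξ_1 - y_1 ξ_0` and `P = ξ_a ∂/∂y_a`. Composing an operator of
order `k` and top symbol `σ` with the Dirac operator `D` gives the symbol of order `k + 1` equal to
`Q σ + P σ` for `D L` and `Q σ - P σ` for `L D` (`diracL_eq`, `diracR_eq`, `firstOrder_diracLoc`).

Let `C = ∂_{ξ_0} ∂_{y_1} - ∂_{ξ_1} ∂_{y_0}` (`contr`). A symbol is in Cartan form exactly when `C σ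
= 0` (`contr_arrPoly_eq_zero_iff`). Moreover `C` commutes with `P`, and `C Q = Q C - 2 - E` with `E`
the Euler operator. This is an `sl_2` relation, and `C` is nilpotent on polynomials of bounded
degree in `ξ`.

Reduction. Subtracting `T D`, where `T` has top symbol a multiple of `C σ`, changes the component of
degree `j` in `y` by a multiple of `Q C σ_j`, as long as the components of higher degree are already
Cartan. By the `sl_2` relation a suitable multiple lowers the nilpotency order of `C` on `σ_j` by
one (`exists_correction`). Induction on this order, then on `j` downwards, gives `exists_cartan`. A
global `T` with the required symbol is made of double commutators with coordinate functions and
frame fields of single charts, glued by a partition of unity (`exists_contraction`).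

Obstruction. Let `R` be Cartan with symbol `σ`, and let `D R = T D + q` with `q` of order at most
`k`. Since `τ ↦ Q τ - P τ` is injective, `T` has order at most `k`, and its symbol `τ` of order `k`
satisfies `Q σ + P σ = Q τ - P τ`. For `d = σ - τ`, applying `C` yields `C Q d = P C d`. As `C Q` is
injective on bihomogeneous polynomials and `P` lowers the degree in `y`, descent on that degree
gives `d = 0`, hence `P σ = 0` (`polar_eq_zero_of_diracL_eq_diracR`). Capelli's identity then forces
`σ_j = 0` for `j ≥ 1`. The argument works at a single point and gives the second assertion by
contraposition and the third with `q = 0`. -/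

/-- `f'` is the partial derivative `∂_a f` at `x`. -/
def HasPd (a : Fin 2) (f : Plane → Spinor) (f' : Spinor) (x : Plane) : Prop :=
  Tendsto (fun t : ℝ => t⁻¹ • (f (x + t • stdVec a) - f x)) (𝓝[≠] 0) (𝓝 f')

/-- The Schwartz space is not normable, so the derivative is the one of topological vector spaces.
On a line it is the limit of difference quotients, and the calculus below uses it in this form. -/
theorem hasDerivAt_zero_iff_tendsto {E : Type*} [AddCommGroup E] [Module ℝ E] [TopologicalSpace E]
    [IsTopologicalAddGroup E] [ContinuousSMul ℝ E] {g : ℝ → E} {g' : E} :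
    HasDerivAt g g' 0 ↔ Tendsto (fun t : ℝ => t⁻¹ • (g t - g 0)) (𝓝[≠] 0) (𝓝 g') := by
  have key : HasDerivAt g g' 0 ↔
      Tendsto (fun t : ℝ => t⁻¹ • (g t - g 0 - t • g')) (𝓝 0) (𝓝 0) := by
    rw [hasDerivAt_iff_hasFDerivAt, hasFDerivAt_iff_isLittleOTVS,
      Asymptotics.isLittleOTVS_iff_tendsto_inv_smul]
    · simp
    · refine Eventually.of_forall fun t ht => ?_
      have : t = 0 := by simpa using ht
      simp [this]
  rw [key, ← tendsto_sub_nhds_zero_iff (x := g')]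
  -- At `t = 0` the expression is `0⁻¹ • _ = 0`, the limit itself, so puncturing the neighbourhood
  -- changes nothing.
  have e1 : Tendsto (fun t : ℝ => t⁻¹ • (g t - g 0 - t • g')) (𝓝 0) (𝓝 0) ↔
      Tendsto (fun t : ℝ => t⁻¹ • (g t - g 0 - t • g')) (𝓝[≠] 0) (𝓝 0) := by
    refine ⟨fun h => h.mono_left nhdsWithin_le_nhds, fun h => ?_⟩
    have := h.sup (tendsto_pure_nhds (fun t : ℝ => t⁻¹ • (g t - g 0 - t • g')) 0 |>.mono_right
      (by simp) : Tendsto (fun t : ℝ => t⁻¹ • (g t - g 0 - t • g')) (pure 0) (𝓝 0))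
    rwa [sup_comm, pure_sup_nhdsNE] at this
  rw [e1]
  refine tendsto_congr' ?_
  filter_upwards [self_mem_nhdsWithin] with t ht
  rw [smul_sub _ _ (t • g'), inv_smul_smul₀ ht]

theorem hasPd_iff {a : Fin 2} {f : Plane → Spinor} {f' : Spinor} {x : Plane} :
    HasPd a f f' x ↔ HasDerivAt (fun t : ℝ => f (x + t • stdVec a)) f' 0 := by
  rw [hasDerivAt_zero_iff_tendsto]; simp [HasPd]

theorem HasPd.pd_eq {a : Fin 2} {f : Plane → Spinor} {f' : Spinor} {x : Plane}
    (h : HasPd a f f' x) : pd a f x = f' := by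
  have h1 := hasPd_iff.1 h
  have h2 : DifferentiableAt ℝ (fun t : ℝ => f (x + t • stdVec a)) 0 :=
    (hasDerivAt_iff_hasFDerivAt.1 h1).differentiableAt
  have h3 := h2.hasFDerivAt.unique (hasDerivAt_iff_hasFDerivAt.1 h1)
  simp [pd, deriv, h3]

theorem hasPd_pd {a : Fin 2} {f : Plane → Spinor} {x : Plane}
    (h : DifferentiableAt ℝ (fun t : ℝ => f (x + t • stdVec a)) 0) : HasPd a f (pd a f x) x := by
  rw [hasPd_iff, pd, hasDerivAt_iff_hasFDerivAt]
  have e : ContinuousLinearMap.toSpanSingleton ℝ (deriv (fun t : ℝ => f (x + t • stdVec a)) 0) =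
      fderiv ℝ (fun t : ℝ => f (x + t • stdVec a)) 0 := by
    refine ContinuousLinearMap.ext fun t => ?_
    rw [ContinuousLinearMap.toSpanSingleton_apply, deriv, ← map_smul, smul_eq_mul, mul_one]
  rw [e]; exact h.hasFDerivAt

theorem HasPd.differentiableAt {a : Fin 2} {f : Plane → Spinor} {f' : Spinor} {x : Plane}
    (h : HasPd a f f' x) : DifferentiableAt ℝ (fun t : ℝ => f (x + t • stdVec a)) 0 :=
  (hasDerivAt_iff_hasFDerivAt.1 (hasPd_iff.1 h)).differentiableAt

theorem tendsto_add_smul_stdVec (x : Plane) (a : Fin 2) :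
    Tendsto (fun t : ℝ => x + t • stdVec a) (𝓝[≠] 0) (𝓝 x) := by
  have : Continuous fun t : ℝ => x + t • stdVec a := by fun_prop
  have h := this.tendsto 0
  simp only [zero_smul, add_zero] at h
  exact h.mono_left nhdsWithin_le_nhds

theorem HasPd.congr {a : Fin 2} {f g : Plane → Spinor} {f' : Spinor} {x : Plane}
    (h : HasPd a f f' x) (hfg : f =ᶠ[𝓝 x] g) : HasPd a g f' x := by
  refine Tendsto.congr' ?_ h
  filter_upwards [(tendsto_add_smul_stdVec x a).eventually hfg] with t ht
  rw [ht, hfg.eq_of_nhds]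

theorem pd_congr {a : Fin 2} {f g : Plane → Spinor} {x : Plane} (hfg : f =ᶠ[𝓝 x] g) :
    pd a f x = pd a g x := by
  by_cases h : DifferentiableAt ℝ (fun t : ℝ => f (x + t • stdVec a)) 0
  · exact ((hasPd_pd h).congr hfg).pd_eq.symm
  · have h' : ¬ DifferentiableAt ℝ (fun t : ℝ => g (x + t • stdVec a)) 0 := fun h' =>
      h ((hasPd_pd h').congr hfg.symm).differentiableAt
    simp [pd, deriv, fderiv_zero_of_not_differentiableAt h, fderiv_zero_of_not_differentiableAt h']

theorem HasPd.add {a : Fin 2} {f g : Plane → Spinor} {f' g' : Spinor} {x : Plane}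
    (hf : HasPd a f f' x) (hg : HasPd a g g' x) : HasPd a (fun y => f y + g y) (f' + g') x := by
  refine (Tendsto.add hf hg).congr fun t => ?_
  rw [← smul_add, add_sub_add_comm]

theorem HasPd.clm {a : Fin 2} {f : Plane → Spinor} {f' : Spinor} {x : Plane}
    (hf : HasPd a f f' x) (L : Spinor →L[ℂ] Spinor) : HasPd a (fun y => L (f y)) (L f') x := by
  refine ((L.continuous.tendsto f').comp hf).congr fun t => ?_
  simp

theorem HasPd.continuous_line {a : Fin 2} {f : Plane → Spinor} {f' : Spinor} {x : Plane}
    (hf : HasPd a f f' x) : Tendsto (fun t : ℝ => f (x + t • stdVec a)) (𝓝[≠] 0) (𝓝 (f x)) := by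
  have h1 : Tendsto (fun t : ℝ => t) (𝓝[≠] 0) (𝓝 0) := nhdsWithin_le_nhds
  have := (h1.smul hf).add_const (f x)
  simp only [zero_smul, zero_add] at this
  refine this.congr' ?_
  filter_upwards [self_mem_nhdsWithin] with t ht
  rw [smul_inv_smul₀ ht]; abel

/-- The product rule needs `f` to be continuous only along the line through `x`, which follows from
the existence of its partial derivative. -/
theorem HasPd.smul {a : Fin 2} {c : Plane → ℂ} {f : Plane → Spinor} {f' : Spinor} {x : Plane}
    (hc : DifferentiableAt ℝ c x) (hf : HasPd a f f' x) :
    HasPd a (fun y => c y • f y) (fderiv ℝ c x (stdVec a) • f x + c x • f') x := by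
  have h1 : HasDerivAt (fun t : ℝ => c (x + t • stdVec a)) (fderiv ℝ c x (stdVec a)) 0 := by
    have := hc.hasFDerivAt
    have h2 : HasDerivAt (fun t : ℝ => x + t • stdVec a) (stdVec a) 0 := by
      simpa using ((hasDerivAt_id (0 : ℝ)).smul_const (stdVec a)).const_add x
    exact HasFDerivAt.comp_hasDerivAt (0 : ℝ) (by simpa using this) h2
  have h2 := hasDerivAt_zero_iff_tendsto.1 h1
  simp only [zero_smul, add_zero] at h2
  refine ((h2.smul hf.continuous_line).add ((tendsto_const_nhds (x := c x)).smul hf)).congr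
    fun t => ?_
  have e : ∀ (z : ℂ) (v : Spinor), (t⁻¹ • z) • v = t⁻¹ • (z • v) := fun z v => smul_assoc _ _ _
  rw [e, smul_comm (c x) t⁻¹, ← smul_add]
  congr 1
  rw [sub_smul, smul_sub]; abel

/-! ### Smooth spinor-valued functions -/

/-- `pdIter` is recursive in the outermost derivative; inductions over the function need the
innermost one. -/
theorem pdIter_succ_right (m : ℕ) (a : Fin (m + 1) → Fin 2) (f : Plane → Spinor) :
    pdIter (m + 1) a f = pdIter m (Fin.init a) (pd (a (Fin.last m)) f) := by
  induction m with
  | zero => rfl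
  | succ m ih =>
    rw [pdIter, ih, pdIter]
    rfl

/-- All iterated partial derivatives of order at most `m` exist and are continuous on `V`. -/
def CkOn (V : Set Plane) : ℕ → (Plane → Spinor) → Prop
  | 0, f => ContinuousOn f V
  | m + 1, f => ContinuousOn f V ∧ (∀ x ∈ V, ∀ b, HasPd b f (pd b f x) x) ∧ ∀ b, CkOn V m (pd b f)

theorem CkOn.continuousOn {V : Set Plane} {m : ℕ} {f : Plane → Spinor} (h : CkOn V m f) :
    ContinuousOn f V := by
  cases m
  · exact h
  · exact h.1

theorem smoothOn_iff_pd {V : Set Plane} {f : Plane → Spinor} :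
    SmoothOn f V ↔ ContinuousOn f V ∧ (∀ x ∈ V, ∀ b, HasPd b f (pd b f x) x) ∧
      ∀ b, SmoothOn (pd b f) V := by
  constructor
  · intro h
    refine ⟨(h 0 Fin.elim0).1, fun x hx b => hasPd_pd ((h 0 Fin.elim0).2 x hx b), fun b m a => ?_⟩
    have := h (m + 1) (Fin.snoc a b)
    rw [pdIter_succ_right] at this
    simpa using this
  · rintro ⟨h1, h2, h3⟩ m a
    cases m with
    | zero => exact ⟨h1, fun x hx b => (h2 x hx b).differentiableAt⟩
    | succ m =>
      rw [pdIter_succ_right]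
      exact h3 _ m _

/-- The recursive classes `CkOn` suit inductions that treat the partial derivatives of sums,
products and compositions by the same statement one order lower. -/
theorem smoothOn_iff_ckOn {V : Set Plane} {f : Plane → Spinor} :
    SmoothOn f V ↔ ∀ m, CkOn V m f := by
  constructor
  · intro h m
    induction m generalizing f with
    | zero => exact (h 0 Fin.elim0).1
    | succ m ih =>
      have := smoothOn_iff_pd.1 h
      exact ⟨this.1, this.2.1, fun b => ih (this.2.2 b)⟩
  · intro h m
    induction m generalizing f with
    | zero => exact fun a => ⟨h 0, fun x hx b => ((h 1).2.1 x hx b).differentiableAt⟩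
    | succ m ih =>
      intro a
      rw [pdIter_succ_right]
      exact ih (fun l => (h (l + 1)).2.2 _) _

theorem SmoothOn.continuousOn {V : Set Plane} {f : Plane → Spinor} (h : SmoothOn f V) :
    ContinuousOn f V := (smoothOn_iff_pd.1 h).1

theorem SmoothOn.hasPd {V : Set Plane} {f : Plane → Spinor} (h : SmoothOn f V) {x : Plane}
    (hx : x ∈ V) (b : Fin 2) : HasPd b f (pd b f x) x := (smoothOn_iff_pd.1 h).2.1 x hx b

theorem SmoothOn.pd {V : Set Plane} {f : Plane → Spinor} (h : SmoothOn f V) (b : Fin 2) :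
    SmoothOn (pd b f) V := (smoothOn_iff_pd.1 h).2.2 b

theorem SmoothOn.mono {V V' : Set Plane} {f : Plane → Spinor} (h : SmoothOn f V) (hV : V' ⊆ V) :
    SmoothOn f V' := fun m a => ⟨(h m a).1.mono hV, fun x hx b => (h m a).2 x (hV hx) b⟩

theorem smoothOn_of_locally {V : Set Plane} {f : Plane → Spinor}
    (h : ∀ x ∈ V, ∃ W, IsOpen W ∧ x ∈ W ∧ SmoothOn f W) : SmoothOn f V := by
  refine fun m a => ⟨fun x hx => ?_, fun x hx b => ?_⟩
  · obtain ⟨W, hW, hxW, hf⟩ := h x hx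
    exact ((hf m a).1.continuousAt (hW.mem_nhds hxW)).continuousWithinAt
  · obtain ⟨W, hW, hxW, hf⟩ := h x hx
    exact (hf m a).2 x hxW b

theorem EqOn.eventuallyEq_nhds {V : Set Plane} (hV : IsOpen V) {E : Type*} {f g : Plane → E}
    (h : EqOn f g V) {x : Plane} (hx : x ∈ V) : f =ᶠ[𝓝 x] g :=
  Filter.mem_of_superset (hV.mem_nhds hx) h

theorem eqOn_pd {V : Set Plane} (hV : IsOpen V) {f g : Plane → Spinor} (h : EqOn f g V)
    (b : Fin 2) : EqOn (pd b f) (pd b g) V :=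
  fun _ hx => pd_congr (EqOn.eventuallyEq_nhds hV h hx)

theorem CkOn.congr {V : Set Plane} (hV : IsOpen V) {m : ℕ} {f g : Plane → Spinor}
    (hf : CkOn V m f) (h : EqOn f g V) : CkOn V m g := by
  induction m generalizing f g with
  | zero => exact ContinuousOn.congr hf h.symm
  | succ m ih =>
    refine ⟨hf.1.congr h.symm, fun x hx b => ?_, fun b => ih (hf.2.2 b) (eqOn_pd hV h b)⟩
    rw [← eqOn_pd hV h b hx]
    exact (hf.2.1 x hx b).congr (EqOn.eventuallyEq_nhds hV h hx)

theorem SmoothOn.congr {V : Set Plane} (hV : IsOpen V) {f g : Plane → Spinor}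
    (hf : SmoothOn f V) (h : EqOn f g V) : SmoothOn g V :=
  smoothOn_iff_ckOn.2 fun m => (smoothOn_iff_ckOn.1 hf m).congr hV h

/-- A function with prescribed partial derivatives that are of class `C^m`. -/
theorem CkOn.succ_of_hasPd {V : Set Plane} (hV : IsOpen V) {m : ℕ} {f : Plane → Spinor}
    {f' : Fin 2 → Plane → Spinor} (hc : ContinuousOn f V)
    (h : ∀ x ∈ V, ∀ b, HasPd b f (f' b x) x) (h' : ∀ b, CkOn V m (f' b)) : CkOn V (m + 1) f := by
  have e : ∀ b, EqOn (f' b) (SymplecticSpinor.pd b f) V := fun b x hx => (h x hx b).pd_eq.symm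
  refine ⟨hc, fun x hx b => ?_, fun b => (h' b).congr hV (e b)⟩
  rw [← e b hx]; exact h x hx b

theorem CkOn.add {V : Set Plane} (hV : IsOpen V) {m : ℕ} {f g : Plane → Spinor}
    (hf : CkOn V m f) (hg : CkOn V m g) : CkOn V m (fun x => f x + g x) := by
  induction m generalizing f g with
  | zero => exact ContinuousOn.add hf hg
  | succ m ih =>
    exact CkOn.succ_of_hasPd hV (hf.1.add hg.1)
      (fun x hx b => (hf.2.1 x hx b).add (hg.2.1 x hx b)) fun b => ih (hf.2.2 b) (hg.2.2 b)

theorem CkOn.pred {V : Set Plane} {m : ℕ} {f : Plane → Spinor} (hf : CkOn V (m + 1) f) :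
    CkOn V m f := by
  induction m generalizing f with
  | zero => exact hf.1
  | succ m ih => exact ⟨hf.1, hf.2.1, fun b => ih (hf.2.2 b)⟩

theorem contDiffOn_fderiv_apply {V : Set Plane} (hV : IsOpen V) {E : Type*} [NormedAddCommGroup E]
    [NormedSpace ℝ E] {c : Plane → E} (hc : ContDiffOn ℝ ∞ c V) (v : Plane) :
    ContDiffOn ℝ ∞ (fun x => fderiv ℝ c x v) V :=
  (hc.fderiv_of_isOpen hV (by simp)).clm_apply contDiffOn_const

theorem CkOn.smul {V : Set Plane} (hV : IsOpen V) {m : ℕ} {c : Plane → ℂ} {f : Plane → Spinor}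
    (hc : ContDiffOn ℝ ∞ c V) (hf : CkOn V m f) : CkOn V m (fun x => c x • f x) := by
  induction m generalizing f c with
  | zero => exact hc.continuousOn.smul hf
  | succ m ih =>
    refine CkOn.succ_of_hasPd hV (hc.continuousOn.smul hf.1)
      (fun x hx b => HasPd.smul ((hc.contDiffAt (hV.mem_nhds hx)).differentiableAt (by simp))
        (hf.2.1 x hx b)) fun b => ?_
    exact (ih (contDiffOn_fderiv_apply hV hc _) hf.pred).add hV (ih hc (hf.2.2 b))

theorem CkOn.clm {V : Set Plane} (hV : IsOpen V) {m : ℕ} {f : Plane → Spinor}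
    (hf : CkOn V m f) (L : Spinor →L[ℂ] Spinor) : CkOn V m (fun x => L (f x)) := by
  induction m generalizing f with
  | zero => exact L.continuous.comp_continuousOn hf
  | succ m ih =>
    exact CkOn.succ_of_hasPd hV (L.continuous.comp_continuousOn hf.1)
      (fun x hx b => (hf.2.1 x hx b).clm L) fun b => ih (hf.2.2 b)

theorem SmoothOn.add {V : Set Plane} (hV : IsOpen V) {f g : Plane → Spinor}
    (hf : SmoothOn f V) (hg : SmoothOn g V) : SmoothOn (fun x => f x + g x) V :=
  smoothOn_iff_ckOn.2 fun m => (smoothOn_iff_ckOn.1 hf m).add hV (smoothOn_iff_ckOn.1 hg m)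

theorem SmoothOn.smul {V : Set Plane} (hV : IsOpen V) {c : Plane → ℂ} {f : Plane → Spinor}
    (hc : ContDiffOn ℝ ∞ c V) (hf : SmoothOn f V) : SmoothOn (fun x => c x • f x) V :=
  smoothOn_iff_ckOn.2 fun m => (smoothOn_iff_ckOn.1 hf m).smul hV hc

theorem SmoothOn.clm {V : Set Plane} (hV : IsOpen V) {f : Plane → Spinor}
    (hf : SmoothOn f V) (L : Spinor →L[ℂ] Spinor) : SmoothOn (fun x => L (f x)) V :=
  smoothOn_iff_ckOn.2 fun m => (smoothOn_iff_ckOn.1 hf m).clm hV L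

theorem smoothOn_const (V : Set Plane) (v : Spinor) : SmoothOn (fun _ => v) V := by
  have key : ∀ m, ∀ v : Spinor, CkOn V m (fun _ => v) := by
    intro m
    induction m with
    | zero => exact fun v => continuousOn_const
    | succ m ih =>
      intro v
      have h : ∀ b x, HasPd b (fun _ : Plane => v) 0 x := fun b x => by
        simp [HasPd]
      refine ⟨continuousOn_const, fun x hx b => ?_, fun b => ?_⟩
      · rw [(h b x).pd_eq]; exact h b x
      · have : SymplecticSpinor.pd b (fun _ : Plane => v) = fun _ => 0 := funext fun x => (h b x).pd_eq
        rw [this]; exact ih 0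
  exact smoothOn_iff_ckOn.2 fun m => key m v

theorem SmoothOn.sum {V : Set Plane} (hV : IsOpen V) {κ : Type*} {s : Finset κ}
    {f : κ → Plane → Spinor} (hf : ∀ i ∈ s, SmoothOn (f i) V) :
    SmoothOn (fun x => ∑ i ∈ s, f i x) V := by
  classical
  induction s using Finset.induction_on with
  | empty => simpa using smoothOn_const V 0
  | insert i s hi ih =>
    simp only [Finset.sum_insert hi]
    exact (hf i (by simp)).add hV (ih fun j hj => hf j (by simp [hj]))

theorem pd_add {V : Set Plane} {f g : Plane → Spinor} (hf : SmoothOn f V) (hg : SmoothOn g V)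
    {x : Plane} (hx : x ∈ V) (a : Fin 2) :
    pd a (fun y => f y + g y) x = pd a f x + pd a g x :=
  ((hf.hasPd hx a).add (hg.hasPd hx a)).pd_eq

theorem pd_clm {V : Set Plane} {f : Plane → Spinor} (hf : SmoothOn f V)
    {x : Plane} (hx : x ∈ V) (a : Fin 2) (L : Spinor →L[ℂ] Spinor) :
    pd a (fun y => L (f y)) x = L (pd a f x) :=
  ((hf.hasPd hx a).clm L).pd_eq

theorem pd_smul {V : Set Plane} (hV : IsOpen V) {c : Plane → ℂ} {f : Plane → Spinor}
    (hc : ContDiffOn ℝ ∞ c V) (hf : SmoothOn f V) {x : Plane} (hx : x ∈ V) (a : Fin 2) :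
    pd a (fun y => c y • f y) x = fderiv ℝ c x (stdVec a) • f x + c x • pd a f x :=
  (HasPd.smul ((hc.contDiffAt (hV.mem_nhds hx)).differentiableAt (by simp)) (hf.hasPd hx a)).pd_eq

theorem pd_sum {V : Set Plane} (hV : IsOpen V) {κ : Type*} {s : Finset κ}
    {f : κ → Plane → Spinor} (hf : ∀ i ∈ s, SmoothOn (f i) V) {x : Plane} (hx : x ∈ V)
    (a : Fin 2) : pd a (fun y => ∑ i ∈ s, f i y) x = ∑ i ∈ s, pd a (f i) x := by
  classical
  induction s using Finset.induction_on with
  | empty =>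
    have : HasPd a (fun _ : Plane => (0 : Spinor)) 0 x := by simp [HasPd]
    simpa using this.pd_eq
  | insert i s hi ih =>
    simp only [Finset.sum_insert hi]
    rw [pd_add (hf i (by simp)) (SmoothOn.sum hV fun j hj => hf j (by simp [hj])) hx,
      ih fun j hj => hf j (by simp [hj])]

end

section

open Filter Topology Set

/-! ### First order expansion, chain rule and symmetry of second derivatives -/

/-- The functional `f ↦ |y|^k f^{(n)}(y)` on spinors. -/
def jetFun (k n : ℕ) (y : ℝ) : Spinor →L[ℝ] ℂ :=
  SchwartzMap.mkCLMtoNormedSpace (fun f : Spinor => (|y| ^ k : ℝ) • iteratedDeriv n f y)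
    (fun f g => by
      have : iteratedDeriv n (⇑(f + g)) y = iteratedDeriv n f y + iteratedDeriv n g y :=
        iteratedDeriv_add (f.smooth n).contDiffAt (g.smooth n).contDiffAt
      rw [this, smul_add])
    (fun a f => by
      have : iteratedDeriv n (⇑(a • f)) y = a • iteratedDeriv n f y :=
        iteratedDeriv_const_smul (f.smooth n).contDiffAt a
      rw [this, smul_comm]; simp)
    ⟨{(k, n)}, 1, zero_le_one, fun f => by
      have := SchwartzMap.le_seminorm' ℝ k n f y
      simpa [norm_smul, SchwartzMap.schwartzSeminormFamily_apply] using this⟩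

theorem norm_jetFun_le (k n : ℕ) (y : ℝ) (f : Spinor) :
    ‖jetFun k n y f‖ ≤ SchwartzMap.seminorm ℝ k n f := by
  have := SchwartzMap.le_seminorm' ℝ k n f y
  have e : jetFun k n y f = (|y| ^ k : ℝ) • iteratedDeriv n f y := rfl
  simpa [e, norm_smul] using this

/-- A Schwartz seminorm is the supremum over `y` of the functionals `jetFun k n y`. Estimates in the
Fréchet space thus reduce to estimates of complex valued functions that are uniform in `y`. -/
theorem seminorm_le_of_jetFun {k n : ℕ} {f : Spinor} {C : ℝ} (hC : 0 ≤ C)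
    (h : ∀ y, ‖jetFun k n y f‖ ≤ C) : SchwartzMap.seminorm ℝ k n f ≤ C := by
  refine SchwartzMap.seminorm_le_bound' ℝ k n f hC fun y => ?_
  have e : jetFun k n y f = (|y| ^ k : ℝ) • iteratedDeriv n f y := rfl
  simpa [e, norm_smul] using h y

theorem tendsto_spinor_iff {α : Type*} {l : Filter α} {u : α → Spinor} {v : Spinor} :
    Tendsto u l (𝓝 v) ↔
      ∀ k n : ℕ, ∀ ε > 0, ∀ᶠ t in l, SchwartzMap.seminorm ℝ k n (u t - v) < ε := by
  rw [(schwartz_withSeminorms ℝ ℝ ℂ).tendsto_nhds]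
  exact ⟨fun h k n => h (k, n), fun h i => h i.1 i.2⟩

theorem HasPd.hasDerivAt_jetFun {b : Fin 2} {F : Plane → Spinor} {F' : Spinor} {z : Plane} {t : ℝ}
    (h : HasPd b F F' (z + t • stdVec b)) (L : Spinor →L[ℝ] ℂ) :
    HasDerivAt (fun s : ℝ => L (F (z + s • stdVec b))) (L F') t := by
  rw [hasDerivAt_iff_tendsto_slope_zero]
  refine ((L.continuous.tendsto F').comp h).congr fun s => ?_
  simp only [Function.comp, map_smul, map_sub]
  rw [add_smul, add_assoc]

/-- The mean value inequality, applied to each functional `jetFun k n y` of the function minus its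
linear part. -/
theorem seminorm_sub_le_of_hasPd {b : Fin 2} {F : Plane → Spinor} {F' : Plane → Spinor} {z : Plane}
    {s ε : ℝ} {c : Spinor} {k n : ℕ}
    (h : ∀ t ∈ uIcc 0 s, HasPd b F (F' (z + t • stdVec b)) (z + t • stdVec b))
    (hb : ∀ t ∈ uIcc 0 s, SchwartzMap.seminorm ℝ k n (F' (z + t • stdVec b) - c) ≤ ε) :
    SchwartzMap.seminorm ℝ k n (F (z + s • stdVec b) - F z - s • c) ≤ ε * |s| := by
  have hε : 0 ≤ ε := (apply_nonneg _ _).trans (hb 0 (by simp))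
  refine seminorm_le_of_jetFun (by positivity) fun y => ?_
  have hd : ∀ t ∈ uIcc 0 s, HasDerivWithinAt
      (fun t : ℝ => jetFun k n y (F (z + t • stdVec b)) - t • jetFun k n y c)
      (jetFun k n y (F' (z + t • stdVec b) - c)) (uIcc 0 s) t := fun t ht => by
    have := ((h t ht).hasDerivAt_jetFun (jetFun k n y)).sub
      ((hasDerivAt_id t).smul_const (jetFun k n y c))
    rw [map_sub]
    simpa using! this.hasDerivWithinAt
  have := Convex.norm_image_sub_le_of_norm_hasDerivWithin_le (C := ε) hd
    (fun t ht => (norm_jetFun_le k n y _).trans (hb t ht)) (convex_uIcc 0 s)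
    left_mem_uIcc right_mem_uIcc
  simp only [zero_smul, add_zero, sub_zero, Real.norm_eq_abs] at this
  rw [map_sub, map_sub, map_smul]
  rwa [sub_right_comm]

theorem plane_eq_add (h : Plane) : h = h 0 • stdVec 0 + h 1 • stdVec 1 := by
  ext i; fin_cases i <;> simp [stdVec]

theorem norm_stdVec (a : Fin 2) : ‖stdVec a‖ = 1 := by simp [stdVec]

theorem abs_apply_le_norm (h : Plane) (a : Fin 2) : |h a| ≤ ‖h‖ := by
  simpa using PiLp.norm_apply_le h a

/-- First order Taylor expansion of a function with continuous partial derivatives. -/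
theorem eventually_seminorm_taylor_le {V : Set Plane} (hV : IsOpen V) {F : Plane → Spinor}
    (h1 : ∀ x ∈ V, ∀ b, HasPd b F (pd b F x) x) (h2 : ∀ b, ContinuousOn (pd b F) V) {x : Plane}
    (hx : x ∈ V) (k n : ℕ) {ε : ℝ} (hε : 0 < ε) :
    ∀ᶠ h : Plane in 𝓝 0, SchwartzMap.seminorm ℝ k n
      (F (x + h) - F x - (h 0 • pd 0 F x + h 1 • pd 1 F x)) ≤ ε * (|h 0| + |h 1|) := by
  have hc : ∀ᶠ z in 𝓝 x, z ∈ V ∧ ∀ b, SchwartzMap.seminorm ℝ k n (pd b F z - pd b F x) < ε := by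
    refine (hV.eventually_mem hx).and (eventually_all.2 fun b => ?_)
    exact tendsto_spinor_iff.1 ((h2 b).continuousAt (hV.mem_nhds hx)) k n ε hε
  -- The increment `h` is split into a leg along the first axis followed by a leg along the second.
  -- For `‖h‖ < r / 2` both legs stay in the ball of radius `r`.
  obtain ⟨r, hr, hball⟩ := Metric.eventually_nhds_iff_ball.1 hc
  filter_upwards [Metric.ball_mem_nhds (0 : Plane) (half_pos hr)] with h hh
  have hn : ‖h‖ < r / 2 := by simpa using hh
  have h0 := (abs_apply_le_norm h 0).trans_lt hn
  have h1' := (abs_apply_le_norm h 1).trans_lt hn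
  have habs : ∀ {s t : ℝ}, t ∈ uIcc 0 s → |t| ≤ |s| := fun {s t} ht => by
    rcases le_total 0 s with hs | hs
    · rw [uIcc_of_le hs] at ht; rw [abs_of_nonneg ht.1, abs_of_nonneg hs]; exact ht.2
    · rw [uIcc_of_ge hs] at ht; rw [abs_of_nonpos ht.2, abs_of_nonpos hs]; linarith [ht.1]
  have m0 : ∀ t ∈ uIcc 0 (h 0), x + t • stdVec 0 ∈ Metric.ball x r := fun t ht => by
    have := habs ht
    simp only [mem_ball_iff_norm, add_sub_cancel_left, norm_smul, norm_stdVec, Real.norm_eq_abs]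
    linarith
  have m1 : ∀ t ∈ uIcc 0 (h 1), (x + h 0 • stdVec 0) + t • stdVec 1 ∈ Metric.ball x r :=
    fun t ht => by
    have := habs ht
    rw [mem_ball_iff_norm, add_assoc, add_sub_cancel_left]
    refine (norm_add_le _ _).trans_lt ?_
    simp only [norm_smul, norm_stdVec, Real.norm_eq_abs]
    linarith
  have a0 := seminorm_sub_le_of_hasPd (F := F) (F' := pd 0 F) (c := pd 0 F x) (k := k) (n := n)
    (ε := ε) (fun t ht => h1 _ (hball _ (m0 t ht)).1 0) fun t ht => ((hball _ (m0 t ht)).2 0).le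
  have a1 := seminorm_sub_le_of_hasPd (F := F) (F' := pd 1 F) (c := pd 1 F x) (k := k) (n := n)
    (ε := ε) (fun t ht => h1 _ (hball _ (m1 t ht)).1 1) fun t ht => ((hball _ (m1 t ht)).2 1).le
  have e : F (x + h) - F x - (h 0 • pd 0 F x + h 1 • pd 1 F x) =
      (F (x + h 0 • stdVec 0) - F x - h 0 • pd 0 F x) +
      (F (x + h 0 • stdVec 0 + h 1 • stdVec 1) - F (x + h 0 • stdVec 0) - h 1 • pd 1 F x) := by
    rw [add_assoc x, ← plane_eq_add h]; abel
  rw [e, mul_add]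
  exact (map_add_le_add _ _ _).trans (add_le_add a0 a1)

/-- The chain rule along the curve `t ↦ τ (x + t e_a)`. -/
theorem hasPd_comp {V : Set Plane} (hV : IsOpen V) {F : Plane → Spinor}
    (h1 : ∀ x ∈ V, ∀ b, HasPd b F (pd b F x) x) (h2 : ∀ b, ContinuousOn (pd b F) V)
    {τ : Plane → Plane} {x : Plane} (hτ : DifferentiableAt ℝ τ x) (hx : τ x ∈ V) (a : Fin 2) :
    HasPd a (fun y => F (τ y)) (∑ b, (fderiv ℝ τ x (stdVec a)) b • pd b F (τ x)) x := by
  set d : Plane := fderiv ℝ τ x (stdVec a) with hd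
  have hder : HasDerivAt (fun t : ℝ => τ (x + t • stdVec a)) d 0 := by
    have h2 : HasDerivAt (fun t : ℝ => x + t • stdVec a) (stdVec a) 0 := by
      simpa using ((hasDerivAt_id (0 : ℝ)).smul_const (stdVec a)).const_add x
    exact HasFDerivAt.comp_hasDerivAt (0 : ℝ) (by simpa using hτ.hasFDerivAt) h2
  have hsl := hasDerivAt_zero_iff_tendsto.1 hder
  simp only [zero_smul, add_zero] at hsl
  set H : ℝ → Plane := fun t => τ (x + t • stdVec a) - τ x with hH
  have hH0 : Tendsto H (𝓝[≠] 0) (𝓝 0) := by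
    have := hder.continuousAt.tendsto.sub_const (τ x)
    simp only [zero_smul, add_zero, sub_self] at this
    exact this.mono_left nhdsWithin_le_nhds
  have hcomp : ∀ b : Fin 2, Tendsto (fun t : ℝ => t⁻¹ * H t b) (𝓝[≠] 0) (𝓝 (d b)) := fun b => by
    have hp : Continuous fun v : Plane => v b := by fun_prop
    exact (hp.tendsto d).comp hsl
  have hmain : Tendsto (fun t : ℝ => ∑ b, (t⁻¹ * H t b) • pd b F (τ x)) (𝓝[≠] 0)
      (𝓝 (∑ b, d b • pd b F (τ x))) :=
    tendsto_finsetSum _ fun b _ => (hcomp b).smul_const _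
  have hrem : Tendsto (fun t : ℝ => t⁻¹ • (F (τ x + H t) - F (τ x) -
      (H t 0 • pd 0 F (τ x) + H t 1 • pd 1 F (τ x)))) (𝓝[≠] 0) (𝓝 0) := by
    refine tendsto_spinor_iff.2 fun k n ε hε => ?_
    -- `K` eventually bounds the difference quotients of the two coordinates of `τ`, whose limits
    -- are `d 0` and `d 1`. After division by `t` the Taylor remainder is then at most `ε / (2 * K)
    -- * K`.
    set K : ℝ := |d 0| + |d 1| + 1
    have hK : 0 < K := by positivity
    have hb : ∀ᶠ t in 𝓝[≠] (0 : ℝ), |t⁻¹ * H t 0| + |t⁻¹ * H t 1| < K := by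
      have := ((hcomp 0).abs.add (hcomp 1).abs)
      exact this.eventually (gt_mem_nhds (by simp [K]))
    filter_upwards [hb, hH0.eventually (eventually_seminorm_taylor_le hV h1 h2 hx k n
      (ε := ε / (2 * K)) (by positivity))] with t ht hT
    rw [sub_zero, map_smul_eq_mul, Real.norm_eq_abs]
    calc |t⁻¹| * _ ≤ |t⁻¹| * (ε / (2 * K) * (|H t 0| + |H t 1|)) := by gcongr
      _ = ε / (2 * K) * (|t⁻¹ * H t 0| + |t⁻¹ * H t 1|) := by rw [abs_mul, abs_mul]; ring
      _ ≤ ε / (2 * K) * K := by gcongr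
      _ < ε := by field_simp; linarith
  have := hrem.add hmain
  rw [zero_add] at this
  refine this.congr fun t => ?_
  rw [Fin.sum_univ_two, mul_smul, mul_smul, ← smul_add, ← smul_add]
  congr 1
  simp only [hH, add_sub_cancel]
  abel

theorem CkOn.comp {V W : Set Plane} (hV : IsOpen V) (hW : IsOpen W) {m : ℕ} {F : Plane → Spinor}
    (hF : CkOn V m F) (h1 : CkOn V 1 F) {τ : Plane → Plane} (hτ : ContDiffOn ℝ ∞ τ W)
    (hm : MapsTo τ W V) : CkOn W m (fun y => F (τ y)) := by
  induction m generalizing F with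
  | zero => exact ContinuousOn.comp hF hτ.continuousOn hm
  | succ m ih =>
    refine CkOn.succ_of_hasPd hW (ContinuousOn.comp hF.1 hτ.continuousOn hm) (fun x hx a =>
      hasPd_comp hV hF.2.1 (fun b => h1.2.2 b)
        ((hτ.contDiffAt (hW.mem_nhds hx)).differentiableAt (by simp)) (hm hx) a) fun a => ?_
    simp only [Fin.sum_univ_two]
    -- When `m = 0` the partial derivatives of `F` are known only to be continuous, so the induction
    -- hypothesis, which also asks for `CkOn V 1`, cannot be applied to them.
    cases m with
    | zero =>
      have hc : ∀ b : Fin 2, ContinuousOn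
          (fun x => (fderiv ℝ τ x (stdVec a)) b • pd b F (τ x)) W := fun b => by
        have h3 := (contDiffOn_fderiv_apply hW hτ (stdVec a)).continuousOn
        have h4 : ContinuousOn (fun x => (fderiv ℝ τ x (stdVec a)) b) W :=
          (by fun_prop : Continuous fun v : Plane => v b).comp_continuousOn h3
        have h5 : ContinuousOn (fun x => pd b F (τ x)) W :=
          ContinuousOn.comp (h1.2.2 b) hτ.continuousOn hm
        exact h4.smul h5
      exact ContinuousOn.add (hc 0) (hc 1)
    | succ m =>
      have h1' : ∀ b, CkOn V 1 (pd b F) := fun b => by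
        have h := hF.2.2 b
        exact ⟨h.1, h.2.1, fun c => (h.2.2 c).continuousOn⟩
      have hc : ∀ b : Fin 2, CkOn W (m + 1)
          (fun x => (fderiv ℝ τ x (stdVec a)) b • pd b F (τ x)) := fun b => by
        have hs : ContDiffOn ℝ ∞ (fun x => (((fderiv ℝ τ x (stdVec a)) b : ℝ) : ℂ)) W := by
          have := contDiffOn_fderiv_apply hW hτ (stdVec a)
          have h3 : ContDiffOn ℝ ∞ (fun x => (fderiv ℝ τ x (stdVec a)) b) W :=
            contDiffOn_piLp_apply (p := 2) |>.comp this (fun _ _ => mem_univ _)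
          exact Complex.ofRealCLM.contDiff.comp_contDiffOn h3
        refine ((ih (hF.2.2 b) (h1' b)).smul hW hs).congr hW fun x _ => ?_
        exact Complex.coe_smul _ _
      exact (hc 0).add hW (hc 1)

theorem SmoothOn.comp {V W : Set Plane} (hV : IsOpen V) (hW : IsOpen W) {F : Plane → Spinor}
    (hF : SmoothOn F V) {τ : Plane → Plane} (hτ : ContDiffOn ℝ ∞ τ W)
    (hm : MapsTo τ W V) : SmoothOn (fun y => F (τ y)) W :=
  smoothOn_iff_ckOn.2 fun m =>
    (smoothOn_iff_ckOn.1 hF m).comp hV hW (smoothOn_iff_ckOn.1 hF 1) hτ hm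

theorem pd_comp {V W : Set Plane} (hV : IsOpen V) (hW : IsOpen W) {F : Plane → Spinor}
    (hF : SmoothOn F V) {τ : Plane → Plane} (hτ : ContDiffOn ℝ ∞ τ W)
    (hm : MapsTo τ W V) {x : Plane} (hx : x ∈ W) (a : Fin 2) :
    pd a (fun y => F (τ y)) x = ∑ b, (((fderiv ℝ τ x (stdVec a)) b : ℝ) : ℂ) • pd b F (τ x) := by
  rw [(hasPd_comp hV (fun x hx b => hF.hasPd hx b) (fun b => (hF.pd b).continuousOn)
    ((hτ.contDiffAt (hW.mem_nhds hx)).differentiableAt (by simp)) (hm hx) a).pd_eq]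
  exact Finset.sum_congr rfl fun b _ => (Complex.coe_smul _ _).symm

/-- Evaluation of a spinor at a point. -/
def evalFun (s : ℝ) : Spinor →L[ℝ] ℂ := jetFun 0 0 s

theorem evalFun_apply (s : ℝ) (f : Spinor) : evalFun s f = f s := by
  have e : evalFun s f = (|s| ^ 0 : ℝ) • iteratedDeriv 0 f s := rfl
  simp [e]

theorem hasFDerivAt_eval {V : Set Plane} (hV : IsOpen V) {F : Plane → Spinor}
    (hF : SmoothOn F V) {x : Plane} (hx : x ∈ V) (s : ℝ) :
    HasFDerivAt (fun y => F y s)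
      (∑ b, (EuclideanSpace.proj b : Plane →L[ℝ] ℝ).smulRight (pd b F x s)) x := by
  rw [hasFDerivAt_iff_isLittleO_nhds_zero, Asymptotics.isLittleO_iff]
  intro ε hε
  filter_upwards [eventually_seminorm_taylor_le hV (fun x hx b => hF.hasPd hx b)
    (fun b => (hF.pd b).continuousOn) hx 0 0 (ε := ε / 2) (half_pos hε)] with h hh
  have h1 := (norm_jetFun_le 0 0 s _).trans hh
  change ‖evalFun s _‖ ≤ _ at h1
  rw [evalFun_apply] at h1
  have e : F (x + h) s - F x s - (∑ b, (EuclideanSpace.proj b : Plane →L[ℝ] ℝ).smulRight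
      (pd b F x s)) h = (F (x + h) - F x - (h 0 • pd 0 F x + h 1 • pd 1 F x)) s := by
    simp [Fin.sum_univ_two]
  rw [e]
  refine h1.trans ?_
  have := abs_apply_le_norm h 0
  have := abs_apply_le_norm h 1
  nlinarith

/-- Partial derivatives of smooth functions commute. -/
theorem pd_comm {V : Set Plane} (hV : IsOpen V) {F : Plane → Spinor}
    (hF : SmoothOn F V) {x : Plane} (hx : x ∈ V) (a b : Fin 2) :
    pd a (pd b F) x = pd b (pd a F) x := by
  -- Evaluation at `s` turns the claim into the symmetry of the second derivative of a complex
  -- valued function on the plane.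
  ext s
  let f' : Plane → Plane →L[ℝ] ℂ := fun y =>
    ∑ c, (EuclideanSpace.proj c : Plane →L[ℝ] ℝ).smulRight (pd c F y s)
  let f'' : Plane →L[ℝ] Plane →L[ℝ] ℂ := ∑ c,
    (ContinuousLinearMap.smulRightL ℝ Plane ℂ (EuclideanSpace.proj c : Plane →L[ℝ] ℝ)) ∘L
      (∑ d, (EuclideanSpace.proj d : Plane →L[ℝ] ℝ).smulRight (pd d (pd c F) x s))
  have h1 : ∀ᶠ y in 𝓝 x, HasFDerivAt (fun y => F y s) (f' y) y :=
    Filter.mem_of_superset (hV.mem_nhds hx) fun y hy => hasFDerivAt_eval hV hF hy s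
  have h2 : HasFDerivAt f' f'' x := by
    refine HasFDerivAt.fun_sum fun c _ => ?_
    exact ((ContinuousLinearMap.smulRightL ℝ Plane ℂ
      (EuclideanSpace.proj c : Plane →L[ℝ] ℝ)).hasFDerivAt).comp x
        (hasFDerivAt_eval hV (hF.pd c) hx s)
  have := second_derivative_symmetric_of_eventually h1 h2 (stdVec a) (stdVec b)
  have e : ∀ a b : Fin 2, f'' (stdVec a) (stdVec b) = pd a (pd b F) x s := fun a b => by
    fin_cases a <;> fin_cases b <;> simp [f'', stdVec, Fin.sum_univ_two]
  rwa [e, e] at this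

end

section

open Filter Topology Set

/-! ### Weyl ordered products of gamma matrices -/

/-- The relation `[d/ds, s] = 1`, scaled by `(1 + i)(1 - i) = 2`. -/
theorem gamma_comm : gamma 0 * gamma 1 = gamma 1 * gamma 0 + 2 := by
  have ht : (fun s : ℝ => (s : ℂ)).HasTemperateGrowth :=
    Complex.ofRealCLM.hasTemperateGrowth
  refine ContinuousLinearMap.ext fun f => SchwartzMap.ext fun s => ?_
  have h1 : HasDerivAt (fun t : ℝ => (t : ℂ) * f t) (f s + s * deriv f s) s := by
    have h := (Complex.ofRealCLM.hasDerivAt (x := s)).mul (f.differentiableAt.hasDerivAt (x := s))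
    simpa using! h
  have hI : (1 + Complex.I) * (1 - Complex.I) = 2 := by
    ring_nf; rw [Complex.I_sq]; norm_num
  have h2 : (2 : Spinor →L[ℂ] Spinor) f = (2 : ℂ) • f := by
    rw [two_smul, ← one_add_one_eq_two]; rfl
  have g0 : ∀ (h : Spinor) (t : ℝ), gamma 0 h t = (1 + Complex.I) * deriv h t := fun h t => by
    simp [gamma]
  have g1 : ∀ (h : Spinor) (t : ℝ), gamma 1 h t = (1 - Complex.I) * (t * h t) := fun h t => by
    simp [gamma, SchwartzMap.smulLeftCLM_apply_apply ht]
  have e' : ⇑(gamma 1 f) = fun t : ℝ => (1 - Complex.I) * (t * f t) := funext (g1 f)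
  change gamma 0 (gamma 1 f) s = gamma 1 (gamma 0 f) s + (2 : Spinor →L[ℂ] Spinor) f s
  rw [g0, g1, g0, e', (h1.const_mul (1 - Complex.I)).deriv, h2, smul_apply, smul_eq_mul]
  linear_combination (f s) * hI

/-! ### Sums of words in two letters with commutator `2` -/

section WordSums

variable {B : Type*} [Ring B]

open Polynomial in
/-- The generating polynomial `g₀ + X g₁`. -/
def genPoly (g₀ g₁ : B) : B[X] := C g₀ + X * C g₁

open Polynomial in
theorem genPoly_commutes {g₀ g₁ : B} (h : g₀ * g₁ = g₁ * g₀ + 2) :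
    genPoly g₀ g₁ * C g₁ = C g₁ * genPoly g₀ g₁ + 2 := by
  have h2 : (2 : B[X]) = C 2 := (map_ofNat C 2).symm
  rw [genPoly, add_mul, mul_add, ← C_mul, h, h2, C_add, C_mul, mul_assoc, ← mul_assoc (C g₁) X,
    ← X_mul_C, mul_assoc]
  abel

-- The commutator of the generating polynomial with `g₁` is the central element `2`, so commuting
-- with `g₁` acts on its powers as a derivation. For `N = 0` the truncated exponent `N - 1` is
-- harmless because its coefficient vanishes.
open Polynomial in
theorem genPoly_pow_commutes {g₀ g₁ : B} (h : g₀ * g₁ = g₁ * g₀ + 2) (N : ℕ) :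
    genPoly g₀ g₁ ^ N * C g₁ = C g₁ * genPoly g₀ g₁ ^ N + (2 * N : ℕ) • genPoly g₀ g₁ ^ (N - 1) := by
  induction N with
  | zero => simp
  | succ N ih =>
    have h0 := genPoly_commutes h
    generalize genPoly g₀ g₁ = G at *
    rw [pow_succ', mul_assoc, ih, mul_add, ← mul_assoc, h0, add_mul, mul_assoc, add_assoc]
    congr 1
    rw [mul_smul_comm]
    cases N with
    | zero => simp
    | succ N =>
      simp only [Nat.add_sub_cancel, ← pow_succ']
      rw [two_mul, ← two_nsmul, ← add_smul]; congr 1; ring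

-- With `G` the generating polynomial, the Leibniz rule gives `∑ G^i g₁ G^(N-i)`. Moving `g₁` to the
-- left past `G^i` costs `2 i G^(i-1)`, and these terms add up to `N (N + 1) G^(N-1)`.
open Polynomial in
theorem derivative_genPoly_pow {g₀ g₁ : B} (h : g₀ * g₁ = g₁ * g₀ + 2) (N : ℕ) :
    derivative (genPoly g₀ g₁ ^ (N + 1)) = (N + 1) • (C g₁ * genPoly g₀ g₁ ^ N) +
      (N * (N + 1)) • genPoly g₀ g₁ ^ (N - 1) := by
  have hd : derivative (genPoly g₀ g₁) = C g₁ := by simp [genPoly]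
  induction N with
  | zero => simp [hd]
  | succ N ih =>
    have h1 := genPoly_pow_commutes h (N + 1)
    rw [pow_succ, derivative_mul, ih, hd, h1]
    generalize genPoly g₀ g₁ = G at *
    have e : (N * (N + 1)) • (G ^ (N - 1) * G) = (N * (N + 1)) • G ^ N := by
      cases N with
      | zero => simp
      | succ N => simp [← pow_succ]
    rw [add_mul, smul_mul_assoc, smul_mul_assoc, e, mul_assoc, ← pow_succ, Nat.add_sub_cancel]
    simp only [add_smul, add_mul, mul_add, mul_smul, one_smul, mul_one, two_smul]
    abel

/-- The sum of all products of `N` factors, `r` of which are `g₁` and the others `g₀`. -/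
def wordSum (g₀ g₁ : B) (N r : ℕ) : B := (genPoly g₀ g₁ ^ N).coeff r

theorem wordSum_mul_right {g₀ g₁ : B} (h : g₀ * g₁ = g₁ * g₀ + 2) (N r : ℕ) :
    wordSum g₀ g₁ N r * g₁ = g₁ * wordSum g₀ g₁ N r + (2 * N : ℕ) • wordSum g₀ g₁ (N - 1) r := by
  have := congrArg (fun p => p.coeff r) (genPoly_pow_commutes h N)
  simp only [Polynomial.coeff_mul_C, Polynomial.coeff_add, Polynomial.coeff_C_mul,
    Polynomial.coeff_smul] at this
  exact this

theorem succ_smul_wordSum {g₀ g₁ : B} (h : g₀ * g₁ = g₁ * g₀ + 2) (N r : ℕ) :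
    (r + 1) • wordSum g₀ g₁ (N + 1) (r + 1) = (N + 1) • (g₁ * wordSum g₀ g₁ N r) +
      (N * (N + 1)) • wordSum g₀ g₁ (N - 1) r := by
  have := congrArg (fun p => p.coeff r) (derivative_genPoly_pow h N)
  simp only [Polynomial.coeff_derivative, Polynomial.coeff_add, Polynomial.coeff_C_mul,
    Polynomial.coeff_smul] at this
  rw [wordSum, wordSum, wordSum, ← this, nsmul_eq_mul]
  push_cast
  rw [(Nat.cast_commute r _).add_left (Commute.one_left _)]

theorem wordSum_succ_succ (g₀ g₁ : B) (N r : ℕ) :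
    wordSum g₀ g₁ (N + 1) (r + 1) = g₀ * wordSum g₀ g₁ N (r + 1) + g₁ * wordSum g₀ g₁ N r := by
  rw [wordSum, pow_succ', genPoly, add_mul, Polynomial.coeff_add, Polynomial.coeff_C_mul, mul_assoc,
    Polynomial.coeff_X_mul, Polynomial.coeff_C_mul]
  rfl

theorem wordSum_succ_zero (g₀ g₁ : B) (N : ℕ) :
    wordSum g₀ g₁ (N + 1) 0 = g₀ * wordSum g₀ g₁ N 0 := by
  rw [wordSum, pow_succ', genPoly, add_mul, Polynomial.coeff_add, Polynomial.coeff_C_mul, mul_assoc,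
    Polynomial.coeff_X_mul_zero, add_zero]
  rfl

theorem wordSum_succ_succ' (g₀ g₁ : B) (N r : ℕ) :
    wordSum g₀ g₁ (N + 1) (r + 1) = wordSum g₀ g₁ N (r + 1) * g₀ + wordSum g₀ g₁ N r * g₁ := by
  rw [wordSum, pow_succ, genPoly, mul_add, Polynomial.coeff_add, Polynomial.coeff_mul_C,
    ← mul_assoc, Polynomial.coeff_mul_C, Polynomial.coeff_mul_X]
  rfl

theorem wordSum_succ_zero' (g₀ g₁ : B) (N : ℕ) :
    wordSum g₀ g₁ (N + 1) 0 = wordSum g₀ g₁ N 0 * g₀ := by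
  rw [wordSum, pow_succ, genPoly, mul_add, Polynomial.coeff_add, Polynomial.coeff_mul_C,
    ← mul_assoc, Polynomial.coeff_mul_C, Polynomial.coeff_mul_X_zero, zero_mul, add_zero]
  rfl

theorem wordSum_of_lt (g₀ g₁ : B) {N r : ℕ} (h : N < r) : wordSum g₀ g₁ N r = 0 := by
  induction N generalizing r with
  | zero =>
    obtain ⟨r, rfl⟩ := Nat.exists_eq_succ_of_ne_zero h.ne'
    simp [wordSum, Polynomial.coeff_one]
  | succ N ih =>
    obtain ⟨r, rfl⟩ := Nat.exists_eq_succ_of_ne_zero (Nat.ne_zero_of_lt h)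
    rw [wordSum_succ_succ, ih (by omega), ih (by omega)]; simp

end WordSums

/-- The Weyl ordered product of `m` factors `γ_0` and `n` factors `γ_1`. -/
def weyl (m n : ℕ) : Spinor →L[ℂ] Spinor :=
  ((m + n).choose n : ℂ)⁻¹ • wordSum (gamma 0) (gamma 1) (m + n) n

theorem choose_smul_weyl (m n : ℕ) :
    ((m + n).choose n : ℂ) • weyl m n = wordSum (gamma 0) (gamma 1) (m + n) n := by
  rw [weyl, smul_inv_smul₀]
  exact_mod_cast (Nat.choose_pos (Nat.le_add_left n m)).ne'

theorem weyl_zero : weyl 0 0 = 1 := by simp [weyl, wordSum]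

/-- For `m = 0` both sides vanish: either the scalar is zero, or a word of length `n - 1` would have
to contain `n` letters `γ_1`. For `m > 0` this is an identity of binomial coefficients. -/
theorem smul_wordSum_pred (m n : ℕ) : ((m + n : ℕ) : ℂ) • wordSum (gamma 0) (gamma 1) (m + n - 1) n =
      ((m + n).choose n * m : ℂ) • weyl (m - 1) n := by
  cases m with
  | zero =>
    rcases n with _ | n
    · simp
    · rw [wordSum_of_lt _ _ (by omega)]; simp
  | succ m =>
    have e3 := choose_smul_weyl m n
    rw [show m + 1 + n - 1 = m + n by omega, ← e3, smul_smul, Nat.add_sub_cancel]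
    congr 1
    have := Nat.choose_mul_succ_eq (m + n) n
    rw [show m + n + 1 - n = m + 1 by omega, show m + n + 1 = m + 1 + n by omega] at this
    push_cast
    have h' : (((m + n).choose n * (m + 1 + n) : ℕ) : ℂ) = ((m + 1 + n).choose n * (m + 1) : ℕ) := by
      rw [this]
    push_cast at h'
    linear_combination h'

/-- This and the next three relations say that multiplying a Weyl ordered product by a gamma matrix
is commutative multiplication plus or minus differentiation in the conjugate variable. On symbols
they become the operators `gl` and `gr`. Here the relation comes from differentiating the generating
polynomial. -/
theorem gamma_one_mul_weyl (m n : ℕ) :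
    gamma 1 * weyl m n = weyl m (n + 1) - (m : ℂ) • weyl (m - 1) n := by
  have h := succ_smul_wordSum gamma_comm (m + n) n
  have hc : ((m + n).choose n : ℂ) ≠ 0 := by
    exact_mod_cast (Nat.choose_pos (Nat.le_add_left n m)).ne'
  have h1 : ((m + n : ℕ) + 1 : ℂ) ≠ 0 := by exact_mod_cast (m + n).succ_ne_zero
  have e1 := choose_smul_weyl m n
  have e2 := choose_smul_weyl m (n + 1)
  rw [← add_assoc] at e2
  rw [← e1, ← e2] at h
  have c1 : ((m + n + 1).choose (n + 1) : ℂ) * (n + 1) = (m + n + 1) * (m + n).choose n := by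
    exact_mod_cast (Nat.add_one_mul_choose_eq (m + n) n).symm
  have c3 := smul_wordSum_pred m n
  rw [Nat.cast_add] at c3
  have h' : ((m + n + 1 : ℂ) * (m + n).choose n) • (gamma 1 * weyl m n) =
      ((m + n + 1 : ℂ) * (m + n).choose n) • (weyl m (n + 1) - (m : ℂ) • weyl (m - 1) n) := by
    rw [smul_sub, ← c1]
    rw [mul_smul_comm] at h
    simp only [← Nat.cast_smul_eq_nsmul ℂ, smul_smul] at h
    push_cast at h
    rw [mul_comm (_ : ℂ) ((n : ℂ) + 1), h, mul_comm ((n : ℂ) + 1), c1, mul_comm ((m : ℂ) + n),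
      mul_smul _ ((m : ℂ) + n), c3]
    simp only [smul_smul]
    rw [mul_assoc (_ : ℂ) _ (m : ℂ)]
    abel
  refine smul_right_injective _ (r := ((m + n + 1 : ℂ) * (m + n).choose n)) ?_ h'
  refine mul_ne_zero ?_ hc
  exact_mod_cast h1

theorem weyl_mul_gamma_one (m n : ℕ) :
    weyl m n * gamma 1 = weyl m (n + 1) + (m : ℂ) • weyl (m - 1) n := by
  have h := wordSum_mul_right gamma_comm (m + n) n
  have hc : ((m + n).choose n : ℂ) ≠ 0 := by
    exact_mod_cast (Nat.choose_pos (Nat.le_add_left n m)).ne'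
  have e : weyl m n * gamma 1 = gamma 1 * weyl m n + (2 * m : ℂ) • weyl (m - 1) n := by
    refine smul_right_injective _ hc ?_
    simp only
    rw [← smul_mul_assoc, smul_add, ← mul_smul_comm, choose_smul_weyl, h,
      ← Nat.cast_smul_eq_nsmul ℂ]
    congr 1
    push_cast
    rw [mul_smul, ← Nat.cast_add, smul_wordSum_pred, smul_smul, smul_smul]
    congr 1; ring
  rw [e, gamma_one_mul_weyl, mul_smul, two_smul]; abel

/-- Splitting words by their first letter expresses the product with `γ_0` through the product with
`γ_1`, which is already known. -/
theorem gamma_zero_mul_weyl (m n : ℕ) :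
    gamma 0 * weyl m n = weyl (m + 1) n + (n : ℂ) • weyl m (n - 1) := by
  cases n with
  | zero =>
    have := wordSum_succ_zero (gamma 0) (gamma 1) m
    simp [weyl, ← this]
  | succ n =>
    have h := wordSum_succ_succ (gamma 0) (gamma 1) (m + n + 1) n
    have e0 := choose_smul_weyl m (n + 1)
    have e1 := choose_smul_weyl (m + 1) (n + 1)
    have e2 := choose_smul_weyl (m + 1) n
    have hg := gamma_one_mul_weyl (m + 1) n
    rw [show m + 1 + (n + 1) = m + n + 1 + 1 by ring] at e1
    rw [show m + 1 + n = m + n + 1 by ring] at e2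
    rw [← add_assoc] at e0
    rw [← e0, ← e1, ← e2, mul_smul_comm, mul_smul_comm, hg] at h
    have hc : ((m + n + 1).choose (n + 1) : ℂ) ≠ 0 := by
      exact_mod_cast (Nat.choose_pos (by omega)).ne'
    have c1 : ((m + n + 1 + 1).choose (n + 1) : ℂ) =
        (m + n + 1).choose n + (m + n + 1).choose (n + 1) := by
      exact_mod_cast Nat.choose_succ_succ (m + n + 1) n
    have c2 : ((m + n + 1).choose (n + 1) : ℂ) * (n + 1) = (m + n + 1).choose n * (m + 1) := by
      have := Nat.choose_succ_right_eq (m + n + 1) n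
      rw [show m + n + 1 - n = m + 1 by omega] at this
      exact_mod_cast this
    refine smul_right_injective _ hc ?_
    simp only [Nat.add_sub_cancel] at h ⊢
    rw [smul_add, smul_smul]
    push_cast at h ⊢
    rw [c2]
    rw [c1, add_smul, smul_sub, smul_smul] at h
    have h' := eq_sub_of_add_eq h.symm
    rw [h']; abel

theorem weyl_mul_gamma_zero (m n : ℕ) :
    weyl m n * gamma 0 = weyl (m + 1) n - (n : ℂ) • weyl m (n - 1) := by
  cases n with
  | zero =>
    have := wordSum_succ_zero' (gamma 0) (gamma 1) m
    simp [weyl, ← this]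
  | succ n =>
    have h := wordSum_succ_succ' (gamma 0) (gamma 1) (m + n + 1) n
    have e0 := choose_smul_weyl m (n + 1)
    have e1 := choose_smul_weyl (m + 1) (n + 1)
    have e2 := choose_smul_weyl (m + 1) n
    have hg := weyl_mul_gamma_one (m + 1) n
    rw [show m + 1 + (n + 1) = m + n + 1 + 1 by ring] at e1
    rw [show m + 1 + n = m + n + 1 by ring] at e2
    rw [← add_assoc] at e0
    rw [← e0, ← e1, ← e2, smul_mul_assoc, smul_mul_assoc, hg] at h
    have hc : ((m + n + 1).choose (n + 1) : ℂ) ≠ 0 := by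
      exact_mod_cast (Nat.choose_pos (by omega)).ne'
    have c1 : ((m + n + 1 + 1).choose (n + 1) : ℂ) =
        (m + n + 1).choose n + (m + n + 1).choose (n + 1) := by
      exact_mod_cast Nat.choose_succ_succ (m + n + 1) n
    have c2 : ((m + n + 1).choose (n + 1) : ℂ) * (n + 1) = (m + n + 1).choose n * (m + 1) := by
      have := Nat.choose_succ_right_eq (m + n + 1) n
      rw [show m + n + 1 - n = m + 1 by omega] at this
      exact_mod_cast this
    refine smul_right_injective _ hc ?_
    simp only [Nat.add_sub_cancel] at h ⊢
    rw [smul_sub, smul_smul]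
    push_cast at h ⊢
    rw [c2]
    rw [c1, add_smul, smul_add, smul_smul] at h
    have h' := eq_sub_of_add_eq h.symm
    rw [h']; abel

end

section

open Filter Topology Set

/-! ### Words in two letters -/

/-- The number of letters `1` of a word in the letters `0`, `1`. -/
def ones {κ : Type*} [Fintype κ] (b : κ → Fin 2) : ℕ := ∑ l, (b l : ℕ)

theorem ones_cons {N : ℕ} (a : Fin 2) (b : Fin N → Fin 2) :
    ones (Fin.cons a b : Fin (N + 1) → Fin 2) = a + ones b := by
  simp [ones, Fin.sum_univ_succ]

theorem ones_le_card {κ : Type*} [Fintype κ] (b : κ → Fin 2) : ones b ≤ Fintype.card κ := by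
  have : ones b ≤ ∑ _l : κ, 1 := Finset.sum_le_sum fun l _ => by omega
  simpa using this

theorem ones_le {N : ℕ} (b : Fin N → Fin 2) : ones b ≤ N := by
  simpa using ones_le_card b

theorem ones_comp_perm {κ : Type*} [Fintype κ] (b : κ → Fin 2) (π : Equiv.Perm κ) :
    ones (b ∘ π) = ones b :=
  Equiv.sum_comp π fun l => (b l : ℕ)

theorem ones_sum {m j : ℕ} (c : Fin m ⊕ Fin j → Fin 2) :
    ones c = ones (c ∘ Sum.inl) + ones (c ∘ Sum.inr) := by
  simp [ones, Fintype.sum_sum_type]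

theorem exists_ones_eq {N r : ℕ} (h : r ≤ N) : ∃ b : Fin N → Fin 2, ones b = r := by
  refine ⟨fun l => if (l : ℕ) < r then 1 else 0, ?_⟩
  have : ∀ l : Fin N, ((if (l : ℕ) < r then (1 : Fin 2) else 0 : Fin 2) : ℕ) =
      if (l : ℕ) < r then 1 else 0 := fun l => by split_ifs <;> rfl
  simp only [ones, this]
  rw [Fin.sum_univ_eq_sum_range (fun l => if l < r then 1 else 0) N, Finset.sum_boole]
  have : (Finset.range N).filter (· < r) = Finset.range r := by
    ext l; simp only [Finset.mem_filter, Finset.mem_range]; omega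
  simp [this]

/-- Two words with the same number of letters `1` differ by a permutation. -/
theorem exists_perm_of_ones_eq {κ : Type*} [Fintype κ] {b b' : κ → Fin 2} (h : ones b = ones b') :
    ∃ π : Equiv.Perm κ, b' ∘ π = b := by
  classical
  have key : ∀ b : κ → Fin 2, Fintype.card {l // b l = 1} = ones b := fun b => by
    rw [Fintype.card_subtype, Finset.card_filter, ones]
    refine Finset.sum_congr rfl fun l _ => ?_
    generalize b l = t
    fin_cases t <;> rfl
  have hc1 : Fintype.card {l // b l = 1} = Fintype.card {l // b' l = 1} := by rw [key, key, h]
  have hc0 : Fintype.card {l // b l = 0} = Fintype.card {l // b' l = 0} := by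
    have e : ∀ b : κ → Fin 2, Fintype.card {l // b l = 0} =
        Fintype.card κ - Fintype.card {l // b l = 1} := fun b => by
      rw [← Fintype.card_subtype_compl]
      refine Fintype.card_congr (Equiv.subtypeEquivRight fun l => ?_)
      generalize b l = t
      fin_cases t <;> simp
    rw [e, e, hc1]
  have e : ∀ t : Fin 2, Nonempty ({l // b l = t} ≃ {l // b' l = t}) := fun t => by
    fin_cases t
    · exact ⟨Fintype.equivOfCardEq hc0⟩
    · exact ⟨Fintype.equivOfCardEq hc1⟩
  exact ⟨Equiv.ofFiberEquiv fun t => (e t).some, funext fun l => Equiv.ofFiberEquiv_map _ l⟩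

/-- Links the generating polynomial with the products indexed by words that occur in `DiffOp`. -/
theorem wordSum_eq_sum {B : Type*} [Ring B] (g : Fin 2 → B) (N r : ℕ) :
    wordSum (g 0) (g 1) N r =
      ∑ b : Fin N → Fin 2, if ones b = r then (List.ofFn fun l => g (b l)).prod else 0 := by
  induction N generalizing r with
  | zero => simp [wordSum, ones, Polynomial.coeff_one, eq_comm]
  | succ N ih =>
    rw [← (Fin.consEquiv fun _ => Fin 2).sum_comp, Fintype.sum_prod_type, Fin.sum_univ_two]
    have hc : ∀ (a : Fin 2) (b : Fin N → Fin 2),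
        ones ((Fin.consEquiv fun _ => Fin 2) (a, b)) = a + ones b := ones_cons
    simp only [hc, Fin.consEquiv_apply, List.ofFn_succ, Fin.cons_zero, Fin.cons_succ,
      List.prod_cons]
    cases r with
    | zero =>
      rw [wordSum_succ_zero, ih, Finset.mul_sum]
      simp [mul_ite]
    | succ r =>
      rw [wordSum_succ_succ, ih, ih, Finset.mul_sum, Finset.mul_sum]
      congr 1
      · refine Finset.sum_congr rfl fun b _ => ?_
        simp [mul_ite]
      · refine Finset.sum_congr rfl fun b _ => ?_
        have : ((1 : Fin 2) : ℕ) + ones b = r + 1 ↔ ones b = r := by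
          rw [Fin.val_one]; omega
        simp only [this, mul_ite, mul_zero]

theorem card_ones_eq (N r : ℕ) :
    ∑ b : Fin N → Fin 2, (if ones b = r then 1 else 0 : ℂ) = N.choose r := by
  have h := wordSum_eq_sum (fun _ => (1 : ℂ)) N r
  simp only [List.ofFn_const, List.prod_replicate, one_pow] at h
  rw [← h, wordSum, genPoly]
  simp only [map_one, mul_one]
  exact Polynomial.coeff_one_add_X_pow ℂ N r

/-- A symmetric coefficient depends only on the number of letters `1`, so all products with the same
letters may be replaced by their average, which is the Weyl ordered product. -/
theorem sum_ones_smul_gammaProd {N : ℕ} (A : ℕ → ℂ) :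
    ∑ b : Fin N → Fin 2, A (ones b) • gammaProd b =
      ∑ b : Fin N → Fin 2, A (ones b) • weyl (N - ones b) (ones b) := by
  have key : ∀ G : (Fin N → Fin 2) → (Spinor →L[ℂ] Spinor),
      ∑ b : Fin N → Fin 2, A (ones b) • G b =
        ∑ r ∈ Finset.range (N + 1), A r • ∑ b : Fin N → Fin 2, if ones b = r then G b else 0 := by
    intro G
    simp only [Finset.smul_sum]
    rw [Finset.sum_comm]
    refine Finset.sum_congr rfl fun b _ => ?_
    rw [Finset.sum_eq_single_of_mem (ones b) (by have := ones_le b; simp; omega)]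
    · simp
    · intro r _ hr; simp [Ne.symm hr]
  rw [key, key]
  refine Finset.sum_congr rfl fun r hr => ?_
  congr 1
  have hr' : r ≤ N := by simpa [Nat.lt_succ_iff] using hr
  have h1 := wordSum_eq_sum gamma N r
  change wordSum _ _ _ _ = ∑ b : Fin N → Fin 2, if ones b = r then gammaProd b else 0 at h1
  have h2 := choose_smul_weyl (N - r) r
  rw [Nat.sub_add_cancel hr'] at h2
  rw [← h1, ← h2, ← card_ones_eq, Finset.sum_smul]
  refine Finset.sum_congr rfl fun b _ => ?_
  split_ifs with hb
  · rw [one_smul, hb]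
  · simp

/-! ### Iterated partial derivatives -/

/-- `∂_0^m ∂_1^n f`. -/
def pdm (m n : ℕ) (f : Plane → Spinor) : Plane → Spinor := (pd 0)^[m] ((pd 1)^[n] f)

theorem smoothOn_pdm {V : Set Plane} {f : Plane → Spinor} (hf : SmoothOn f V) (m n : ℕ) :
    SmoothOn (pdm m n f) V := by
  have key : ∀ (a : Fin 2) (n : ℕ) {f : Plane → Spinor}, SmoothOn f V →
      SmoothOn ((pd a)^[n] f) V := by
    intro a n
    induction n with
    | zero => exact fun hf => hf
    | succ n ih => exact fun hf => ih (hf.pd a)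
  exact key 0 m (key 1 n hf)

theorem eqOn_pdm {V : Set Plane} (hV : IsOpen V) {f g : Plane → Spinor} (h : EqOn f g V)
    (m n : ℕ) : EqOn (pdm m n f) (pdm m n g) V := by
  have key : ∀ (a : Fin 2) (n : ℕ) {f g : Plane → Spinor}, EqOn f g V →
      EqOn ((pd a)^[n] f) ((pd a)^[n] g) V := by
    intro a n
    induction n with
    | zero => exact fun hf => hf
    | succ n ih => exact fun hf => ih (eqOn_pd hV hf a)
  exact key 0 m (key 1 n h)

theorem pd_zero_pdm (m n : ℕ) (f : Plane → Spinor) : pd 0 (pdm m n f) = pdm (m + 1) n f :=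
  (Function.iterate_succ_apply' _ _ _).symm

theorem pdm_pd_one (m n : ℕ) (f : Plane → Spinor) : pdm m n (pd 1 f) = pdm m (n + 1) f := rfl

theorem pdm_succ (m n : ℕ) (f : Plane → Spinor) : pdm (m + 1) n f = pd 0 (pdm m n f) :=
  (pd_zero_pdm m n f).symm

theorem pd_one_pdm {V : Set Plane} (hV : IsOpen V) {f : Plane → Spinor} (hf : SmoothOn f V)
    (m n : ℕ) : EqOn (pd 1 (pdm m n f)) (pdm m (n + 1) f) V := by
  induction m with
  | zero =>
    have : pd 1 (pdm 0 n f) = pdm 0 (n + 1) f := (Function.iterate_succ_apply' (pd 1) n f).symm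
    rw [this]; exact fun _ _ => rfl
  | succ m ih =>
    intro x hx
    rw [pdm_succ, pdm_succ, pd_comm hV (smoothOn_pdm hf m n) hx]
    exact eqOn_pd hV ih 0 hx

/-- In `pdm` the derivative `∂_0` is outermost, so an inner `∂_0` has to be commuted past every
`∂_1`. -/
theorem pdm_pd_zero {V : Set Plane} (hV : IsOpen V) {f : Plane → Spinor} (hf : SmoothOn f V)
    (m n : ℕ) : EqOn (pdm m n (pd 0 f)) (pdm (m + 1) n f) V := by
  induction n generalizing f with
  | zero => exact fun _ _ => rfl
  | succ n ih =>
    intro x hx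
    rw [← pdm_pd_one, ← pdm_pd_one, ← ih (hf.pd 1) hx]
    exact eqOn_pdm hV (fun y hy => pd_comm hV hf hy 1 0) m n hx

theorem pdIter_eq_pdm {V : Set Plane} (hV : IsOpen V) {f : Plane → Spinor} (hf : SmoothOn f V)
    (m : ℕ) (a : Fin m → Fin 2) : EqOn (pdIter m a f) (pdm (m - ones a) (ones a) f) V := by
  induction m with
  | zero => intro x _; simp [pdIter, ones, pdm]
  | succ m ih =>
    intro x hx
    have h1 : ones a = a 0 + ones (Fin.tail a) := by
      rw [← ones_cons, Fin.cons_self_tail]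
    have h2 := ones_le (Fin.tail a)
    rw [pdIter, eqOn_pd hV (ih (Fin.tail a)) (a 0) hx, h1]
    obtain h0 | h0 : a 0 = 0 ∨ a 0 = 1 := by omega
    · rw [h0, pd_zero_pdm]
      have e1 : m - ones (Fin.tail a) + 1 = m + 1 - (((0 : Fin 2) : ℕ) + ones (Fin.tail a)) := by
        rw [Fin.val_zero]; omega
      rw [e1, Fin.val_zero, zero_add]
    · rw [h0, pd_one_pdm hV hf _ _ hx]
      have e1 : m - ones (Fin.tail a) = m + 1 - (((1 : Fin 2) : ℕ) + ones (Fin.tail a)) := by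
        rw [Fin.val_one]; omega
      rw [e1, Fin.val_one, add_comm 1]

theorem pdm_add {V : Set Plane} (hV : IsOpen V) {f g : Plane → Spinor} (hf : SmoothOn f V)
    (hg : SmoothOn g V) (m n : ℕ) :
    EqOn (pdm m n fun y => f y + g y) (fun y => pdm m n f y + pdm m n g y) V := by
  have key : ∀ (a : Fin 2) (n : ℕ) {f g : Plane → Spinor}, SmoothOn f V → SmoothOn g V →
      EqOn ((pd a)^[n] fun y => f y + g y) (fun y => (pd a)^[n] f y + (pd a)^[n] g y) V := by
    intro a n
    induction n with
    | zero => exact fun _ _ _ _ => rfl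
    | succ n ih =>
      intro f g hf hg x hx
      have e : EqOn (pd a fun y => f y + g y) (fun y => pd a f y + pd a g y) V :=
        fun y hy => pd_add hf hg hy a
      have h2 : EqOn ((pd a)^[n] (pd a fun y => f y + g y))
          ((pd a)^[n] fun y => pd a f y + pd a g y) V := by
        clear ih
        induction n with
        | zero => exact e
        | succ n ih =>
          rw [Function.iterate_succ_apply', Function.iterate_succ_apply']
          exact eqOn_pd hV ih a
      exact (h2 hx).trans (ih (hf.pd a) (hg.pd a) hx)
  intro x hx
  have h1 := eqOn_pdm hV (key 1 n hf hg) m 0 hx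
  exact h1.trans (key 0 m (smoothOn_pdm hf 0 n) (smoothOn_pdm hg 0 n) hx)

theorem pdm_clm {V : Set Plane} (hV : IsOpen V) {f : Plane → Spinor} (hf : SmoothOn f V)
    (L : Spinor →L[ℂ] Spinor) (m n : ℕ) :
    EqOn (pdm m n fun y => L (f y)) (fun y => L (pdm m n f y)) V := by
  induction m with
  | zero =>
    induction n with
    | zero => exact fun _ _ => rfl
    | succ n ih =>
      intro x hx
      rw [← pd_one_pdm hV (hf.clm hV L) _ _ hx, eqOn_pd hV ih 1 hx]
      simp only
      rw [pd_clm (smoothOn_pdm hf _ _) hx, pd_one_pdm hV hf _ _ hx]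
  | succ m ih =>
    intro x hx
    rw [pdm_succ, eqOn_pd hV ih 0 hx, pd_clm (smoothOn_pdm hf _ _) hx, ← pdm_succ]

end

section

open Filter Topology Set MvPolynomial

/-! ### Symbols as polynomials -/

/-- Polynomials in the covector variables `ξ_a` (index `inl a`) and the Clifford variables `y_a`
(index `inr a`). -/
abbrev Poly : Type := MvPolynomial (Fin 2 ⊕ Fin 2) ℂ

/-- The weight counting the degree in `ξ`. -/
def xiW : Fin 2 ⊕ Fin 2 → ℕ := Sum.elim (fun _ => 1) (fun _ => 0)

/-- The weight counting the degree in `y`. -/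
def yW : Fin 2 ⊕ Fin 2 → ℕ := Sum.elim (fun _ => 0) (fun _ => 1)

@[simp] theorem xiW_inl (a : Fin 2) : xiW (Sum.inl a) = 1 := rfl
@[simp] theorem xiW_inr (a : Fin 2) : xiW (Sum.inr a) = 0 := rfl
@[simp] theorem yW_inl (a : Fin 2) : yW (Sum.inl a) = 0 := rfl
@[simp] theorem yW_inr (a : Fin 2) : yW (Sum.inr a) = 1 := rfl

theorem weight_xiW (s : Fin 2 ⊕ Fin 2 →₀ ℕ) :
    Finsupp.weight xiW s = s (Sum.inl 0) + s (Sum.inl 1) := by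
  rw [Finsupp.weight_apply, Finsupp.sum_fintype _ _ (by simp)]
  simp [Fintype.sum_sum_type, Fin.sum_univ_two]

theorem weight_yW (s : Fin 2 ⊕ Fin 2 →₀ ℕ) :
    Finsupp.weight yW s = s (Sum.inr 0) + s (Sum.inr 1) := by
  rw [Finsupp.weight_apply, Finsupp.sum_fintype _ _ (by simp)]
  simp [Fintype.sum_sum_type, Fin.sum_univ_two]

theorem weight_add_single (w : Fin 2 ⊕ Fin 2 → ℕ) (s : Fin 2 ⊕ Fin 2 →₀ ℕ) (i : Fin 2 ⊕ Fin 2) :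
    Finsupp.weight w (s + Finsupp.single i 1) = Finsupp.weight w s + w i := by
  rw [map_add, Finsupp.weight_single]; simp

theorem exists_eq_add_single {s : Fin 2 ⊕ Fin 2 →₀ ℕ} {i : Fin 2 ⊕ Fin 2} (h : i ∈ s.support) :
    ∃ t, s = t + Finsupp.single i 1 := by
  refine ⟨s - Finsupp.single i 1, (tsub_add_cancel_of_le ?_).symm⟩
  rw [Finsupp.single_le_iff]
  exact Nat.one_le_iff_ne_zero.2 (Finsupp.mem_support_iff.1 h)

/-- The component of weight `k` of a polynomial. -/
abbrev part (w : Fin 2 ⊕ Fin 2 → ℕ) (k : ℕ) : Poly →ₗ[ℂ] Poly := weightedHomogeneousComponent w k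

theorem part_X_mul (w : Fin 2 ⊕ Fin 2 → ℕ) (k : ℕ) (i : Fin 2 ⊕ Fin 2) (p : Poly) :
    part w (k + w i) (X i * p) = X i * part w k p := by
  classical
  ext s
  rw [coeff_weightedHomogeneousComponent, coeff_X_mul', coeff_X_mul']
  by_cases hs : i ∈ s.support
  · obtain ⟨t, rfl⟩ := exists_eq_add_single hs
    rw [if_pos hs, if_pos hs, add_tsub_cancel_right, coeff_weightedHomogeneousComponent,
      weight_add_single]
    simp
  · simp [hs]

theorem part_zero_X_mul {w : Fin 2 ⊕ Fin 2 → ℕ} {k : ℕ} {i : Fin 2 ⊕ Fin 2} (h : k < w i)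
    (p : Poly) : part w k (X i * p) = 0 := by
  classical
  ext s
  rw [coeff_weightedHomogeneousComponent, coeff_X_mul']
  by_cases hs : i ∈ s.support
  · obtain ⟨t, rfl⟩ := exists_eq_add_single hs
    rw [weight_add_single, if_neg (by omega)]; simp
  · simp [hs]

theorem part_pderiv (w : Fin 2 ⊕ Fin 2 → ℕ) (k : ℕ) (i : Fin 2 ⊕ Fin 2) (p : Poly) :
    part w k (pderiv i p) = pderiv i (part w (k + w i) p) := by
  classical
  ext s
  rw [coeff_weightedHomogeneousComponent, coeff_pderiv, coeff_pderiv,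
    coeff_weightedHomogeneousComponent, weight_add_single]
  simp

/-- All monomials of `p` have weight at most `k`. -/
def WLe (w : Fin 2 ⊕ Fin 2 → ℕ) (k : ℕ) (p : Poly) : Prop :=
  ∀ s, coeff s p ≠ 0 → Finsupp.weight w s ≤ k

section WLe

variable {w : Fin 2 ⊕ Fin 2 → ℕ} {k l : ℕ} {p q : Poly}

theorem WLe.mono (h : WLe w k p) (hkl : k ≤ l) : WLe w l p := fun s hs => (h s hs).trans hkl

theorem wLe_zero : WLe w k 0 := fun s hs => absurd (coeff_zero s) hs

theorem WLe.add (hp : WLe w k p) (hq : WLe w k q) : WLe w k (p + q) := fun s hs => by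
  by_contra hk
  have h1 : coeff s p = 0 := by by_contra h; exact hk (hp s h)
  have h2 : coeff s q = 0 := by by_contra h; exact hk (hq s h)
  simp [h1, h2] at hs

theorem WLe.smul (hp : WLe w k p) (c : ℂ) : WLe w k (c • p) := fun s hs =>
  hp s fun h => hs (by simp [h])

theorem WLe.sub (hp : WLe w k p) (hq : WLe w k q) : WLe w k (p - q) := by
  rw [sub_eq_add_neg, ← neg_one_smul ℂ q]; exact hp.add (hq.smul _)

theorem WLe.sum {κ : Type*} {t : Finset κ} {p : κ → Poly} (h : ∀ i ∈ t, WLe w k (p i)) :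
    WLe w k (∑ i ∈ t, p i) := by
  classical
  induction t using Finset.induction_on with
  | empty => simpa using wLe_zero
  | insert i t hi ih =>
    rw [Finset.sum_insert hi]
    exact (h i (by simp)).add (ih fun j hj => h j (by simp [hj]))

theorem WLe.X_mul (hp : WLe w k p) (i : Fin 2 ⊕ Fin 2) : WLe w (k + w i) (X i * p) := by
  classical
  intro s hs
  rw [coeff_X_mul'] at hs
  by_cases hi : i ∈ s.support
  · obtain ⟨t, rfl⟩ := exists_eq_add_single hi
    rw [if_pos hi, add_tsub_cancel_right] at hs
    rw [weight_add_single]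
    exact Nat.add_le_add_right (hp t hs) _
  · simp [hi] at hs

theorem WLe.pderiv (hp : WLe w k p) (i : Fin 2 ⊕ Fin 2) : WLe w k (pderiv i p) := fun s hs => by
  rw [coeff_pderiv] at hs
  have := hp _ (left_ne_zero_of_mul hs)
  rw [weight_add_single] at this
  omega

theorem WLe.part_eq_zero (hp : WLe w k p) (hkl : k < l) : part w l p = 0 := by
  classical
  ext s
  rw [coeff_weightedHomogeneousComponent]
  split_ifs with h
  · by_contra hs
    have := hp s (by simpa using hs)
    omega
  · simp

theorem WLe.of_part_eq_zero (hp : WLe w (k + 1) p) (h : part w (k + 1) p = 0) : WLe w k p := by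
  classical
  intro s hs
  have := hp s hs
  rcases this.lt_or_eq with h1 | h1
  · omega
  · have h2 := congrArg (coeff s) h
    rw [coeff_weightedHomogeneousComponent, if_pos h1] at h2
    exact absurd (by simpa using h2) hs

theorem wLe_part : WLe w k (part w k p) := fun s hs => by
  classical
  rw [coeff_weightedHomogeneousComponent] at hs
  by_contra h
  rw [if_neg (by omega)] at hs
  exact hs rfl

theorem wLe_monomial {s : Fin 2 ⊕ Fin 2 →₀ ℕ} {c : ℂ} (h : Finsupp.weight w s ≤ k) :
    WLe w k (monomial s c) := fun t ht => by
  classical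
  rw [coeff_monomial] at ht
  split_ifs at ht with h'
  · rw [← h']; exact h
  · exact absurd rfl ht

end WLe

/-- A set of polynomials stable under all derivatives and without non-zero constants is trivial. -/
theorem eq_zero_of_pderiv_stable {K : Poly → Prop} (hK : ∀ p i, K p → K (pderiv i p))
    (hC : ∀ c, K (C c) → c = 0) {p : Poly} (hp : K p) : p = 0 := by
  classical
  -- Induction on the total degree. The derivatives have lower degree and so vanish; in
  -- characteristic zero this leaves only the constant term, which is zero by `hC`.
  have key : ∀ n, ∀ p : Poly, K p → WLe (fun _ => 1) n p → p = 0 := by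
    have hconst : ∀ p : Poly, K p → (∀ s, s ≠ 0 → coeff s p = 0) → p = 0 := by
      intro p hp h
      have e : p = C (coeff 0 p) := by
        ext s
        rw [coeff_C]
        split_ifs with h0
        · rw [h0]
        · exact h s (Ne.symm h0)
      rw [e] at hp ⊢
      rw [hC _ hp, C_0]
    intro n
    induction n with
    | zero =>
      intro p hp hw
      refine hconst p hp fun s hs => ?_
      by_contra h
      obtain ⟨i, hi⟩ := Finsupp.support_nonempty_iff.2 hs
      obtain ⟨t, rfl⟩ := exists_eq_add_single hi
      have := hw _ h
      rw [weight_add_single] at this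
      omega
    | succ n ih =>
      intro p hp hw
      refine hconst p hp fun s hs => ?_
      obtain ⟨i, hi⟩ := Finsupp.support_nonempty_iff.2 hs
      obtain ⟨t, rfl⟩ := exists_eq_add_single hi
      have h0 : pderiv i p = 0 := by
        refine ih _ (hK p i hp) fun s hs => ?_
        rw [coeff_pderiv] at hs
        have := hw _ (left_ne_zero_of_mul hs)
        rw [weight_add_single] at this
        omega
      have h1 := coeff_pderiv (i := i) p t
      rw [h0, coeff_zero, eq_comm, mul_eq_zero] at h1
      rcases h1 with h1 | h1
      · exact h1
      · exact absurd h1 (by exact_mod_cast Nat.succ_ne_zero (t i))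
  refine key (p.support.sup fun s => Finsupp.weight (fun _ => 1) s) p hp fun s hs => ?_
  exact Finset.le_sup (f := fun s => Finsupp.weight (fun _ => 1) s) (mem_support_iff.2 hs)

/-! ### The operator with a given symbol -/

/-- The value at `x` of the differential operator with constant coefficients and Weyl symbol `p`. -/
def opAt (f : Plane → Spinor) (x : Plane) : Poly →ₗ[ℂ] Spinor :=
  (basisMonomials (Fin 2 ⊕ Fin 2) ℂ).constr ℂ fun s =>
    weyl (s (Sum.inr 0)) (s (Sum.inr 1)) (pdm (s (Sum.inl 0)) (s (Sum.inl 1)) f x)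

theorem opAt_monomial (f : Plane → Spinor) (x : Plane) (s : Fin 2 ⊕ Fin 2 →₀ ℕ) (c : ℂ) :
    opAt f x (monomial s c) =
      c • weyl (s (Sum.inr 0)) (s (Sum.inr 1)) (pdm (s (Sum.inl 0)) (s (Sum.inl 1)) f x) := by
  have e : monomial s c = c • (basisMonomials (Fin 2 ⊕ Fin 2) ℂ) s := by
    rw [coe_basisMonomials, smul_monomial, smul_eq_mul, mul_one]
  rw [e, map_smul, opAt, Module.Basis.constr_basis]

theorem opAt_C (f : Plane → Spinor) (x : Plane) (c : ℂ) : opAt f x (C c) = c • f x := by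
  rw [← monomial_zero', opAt_monomial]; simp [weyl_zero, pdm]

/-- Left multiplication by `γ_a` on symbols. -/
def gl (a : Fin 2) : Poly →ₗ[ℂ] Poly :=
  LinearMap.mulLeft ℂ (X (Sum.inr a)) +
    ∑ b, ((omega a b : ℝ) : ℂ) • (pderiv (R := ℂ) (Sum.inr b : Fin 2 ⊕ Fin 2)).toLinearMap

/-- Right multiplication by `γ_a` on symbols. -/
def gr (a : Fin 2) : Poly →ₗ[ℂ] Poly :=
  LinearMap.mulLeft ℂ (X (Sum.inr a)) -
    ∑ b, ((omega a b : ℝ) : ℂ) • (pderiv (R := ℂ) (Sum.inr b : Fin 2 ⊕ Fin 2)).toLinearMap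

theorem gl_apply (a : Fin 2) (p : Poly) : gl a p = X (Sum.inr a) * p +
    ∑ b, ((omega a b : ℝ) : ℂ) • pderiv (Sum.inr b) p := by
  simp [gl]

theorem gr_apply (a : Fin 2) (p : Poly) : gr a p = X (Sum.inr a) * p -
    ∑ b, ((omega a b : ℝ) : ℂ) • pderiv (Sum.inr b) p := by
  simp [gr]

theorem gl_zero (p : Poly) : gl 0 p = X (Sum.inr 0) * p + pderiv (Sum.inr 1) p := by
  simp [gl_apply, omega, Fin.sum_univ_two]

theorem gl_one (p : Poly) : gl 1 p = X (Sum.inr 1) * p - pderiv (Sum.inr 0) p := by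
  simp [gl_apply, omega, Fin.sum_univ_two, sub_eq_add_neg]

theorem gr_zero (p : Poly) : gr 0 p = X (Sum.inr 0) * p - pderiv (Sum.inr 1) p := by
  simp [gr_apply, omega, Fin.sum_univ_two]

theorem gr_one (p : Poly) : gr 1 p = X (Sum.inr 1) * p + pderiv (Sum.inr 0) p := by
  simp [gr_apply, omega, Fin.sum_univ_two, sub_eq_add_neg]

theorem part_xiW_gl (k : ℕ) (a : Fin 2) (p : Poly) :
    part xiW k (gl a p) = gl a (part xiW k p) := by
  have h := part_X_mul xiW k (Sum.inr a) p
  have h' := fun b : Fin 2 => part_pderiv xiW k (Sum.inr b) p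
  simp only [xiW_inr, add_zero] at h h'
  simp only [gl_apply, map_add, map_sum, map_smul, h, h']

theorem part_xiW_gr (k : ℕ) (a : Fin 2) (p : Poly) :
    part xiW k (gr a p) = gr a (part xiW k p) := by
  have h := part_X_mul xiW k (Sum.inr a) p
  have h' := fun b : Fin 2 => part_pderiv xiW k (Sum.inr b) p
  simp only [xiW_inr, add_zero] at h h'
  simp only [gr_apply, map_sub, map_sum, map_smul, h, h']

theorem WLe.gl {w : Fin 2 ⊕ Fin 2 → ℕ} {k : ℕ} {p : Poly} (hp : WLe w k p) (a : Fin 2) :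
    WLe w (k + w (Sum.inr a)) (gl a p) := by
  rw [gl_apply]
  exact (hp.X_mul _).add (WLe.sum fun b _ => ((hp.pderiv _).mono (Nat.le_add_right _ _)).smul _)

theorem WLe.gr {w : Fin 2 ⊕ Fin 2 → ℕ} {k : ℕ} {p : Poly} (hp : WLe w k p) (a : Fin 2) :
    WLe w (k + w (Sum.inr a)) (gr a p) := by
  rw [gr_apply]
  exact (hp.X_mul _).sub (WLe.sum fun b _ => ((hp.pderiv _).mono (Nat.le_add_right _ _)).smul _)

theorem X_mul_monomial (i : Fin 2 ⊕ Fin 2) (s : Fin 2 ⊕ Fin 2 →₀ ℕ) (c : ℂ) :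
    X i * monomial s c = monomial (s + Finsupp.single i 1) c := by
  rw [X, monomial_mul, one_mul, add_comm]

/-- On monomials these are the relations for left multiplication of Weyl products; the sign of the
derivative term comes from `ω`. -/
theorem gamma_opAt (f : Plane → Spinor) (x : Plane) (a : Fin 2) (p : Poly) :
    gamma a (opAt f x p) = opAt f x (gl a p) := by
  induction p using MvPolynomial.induction_on' with
  | add p q hp hq => rw [map_add, map_add, map_add, map_add, hp, hq]
  | monomial s c =>
    obtain rfl | rfl : a = 0 ∨ a = 1 := by omega
    · rw [gl_zero, pderiv_monomial, X_mul_monomial, map_add, opAt_monomial, opAt_monomial,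
        opAt_monomial, map_smul, ← ContinuousLinearMap.comp_apply, ← ContinuousLinearMap.mul_def,
        gamma_zero_mul_weyl, add_apply, smul_add, smul_apply, smul_smul]
      simp
    · rw [gl_one, pderiv_monomial, X_mul_monomial, map_sub, opAt_monomial, opAt_monomial,
        opAt_monomial, map_smul, ← ContinuousLinearMap.comp_apply, ← ContinuousLinearMap.mul_def,
        gamma_one_mul_weyl, sub_apply, smul_sub, smul_apply, smul_smul]
      simp

section SmoothArgument

variable {V : Set Plane} {f g : Plane → Spinor} {x : Plane}

theorem opAt_congr_of_eqOn (hV : IsOpen V) (h : EqOn f g V) (hx : x ∈ V) (p : Poly) :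
    opAt f x p = opAt g x p := by
  induction p using MvPolynomial.induction_on' with
  | add p q hp hq => rw [map_add, map_add, hp, hq]
  | monomial s c => rw [opAt_monomial, opAt_monomial, eqOn_pdm hV h _ _ hx]

theorem opAt_add (hV : IsOpen V) (hf : SmoothOn f V) (hg : SmoothOn g V) (hx : x ∈ V) (p : Poly) :
    opAt (fun y => f y + g y) x p = opAt f x p + opAt g x p := by
  induction p using MvPolynomial.induction_on' with
  | add p q hp hq => rw [map_add, map_add, map_add, hp, hq]; abel
  | monomial s c =>
    rw [opAt_monomial, opAt_monomial, opAt_monomial, pdm_add hV hf hg _ _ hx, map_add, smul_add]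

theorem opAt_const_smul (hV : IsOpen V) (hf : SmoothOn f V) (hx : x ∈ V) (c : ℂ) (p : Poly) :
    opAt (fun y => c • f y) x p = c • opAt f x p := by
  induction p using MvPolynomial.induction_on' with
  | add p q hp hq => rw [map_add, map_add, hp, hq, smul_add]
  | monomial s d =>
    have := pdm_clm hV hf (c • (1 : Spinor →L[ℂ] Spinor)) (s (Sum.inl 0)) (s (Sum.inl 1)) hx
    simp only [smul_apply, one_apply_eq_self] at this
    rw [opAt_monomial, opAt_monomial, this, map_smul, smul_comm]

/-- A constant gamma matrix passes through the partial derivatives and then multiplies the Weyl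
product from the right. -/
theorem opAt_gamma (hV : IsOpen V) (hf : SmoothOn f V) (hx : x ∈ V) (a : Fin 2) (p : Poly) :
    opAt (fun y => gamma a (f y)) x p = opAt f x (gr a p) := by
  induction p using MvPolynomial.induction_on' with
  | add p q hp hq => rw [map_add, map_add, map_add, hp, hq]
  | monomial s c =>
    obtain rfl | rfl : a = 0 ∨ a = 1 := by omega
    · rw [gr_zero, pderiv_monomial, X_mul_monomial, map_sub, opAt_monomial, opAt_monomial,
        opAt_monomial, pdm_clm hV hf _ _ _ hx, ← ContinuousLinearMap.comp_apply,
        ← ContinuousLinearMap.mul_def, weyl_mul_gamma_zero, sub_apply, smul_sub, smul_apply,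
        smul_smul]
      simp
    · rw [gr_one, pderiv_monomial, X_mul_monomial, map_add, opAt_monomial, opAt_monomial,
        opAt_monomial, pdm_clm hV hf _ _ _ hx, ← ContinuousLinearMap.comp_apply,
        ← ContinuousLinearMap.mul_def, weyl_mul_gamma_one, add_apply, smul_add, smul_apply,
        smul_smul]
      simp

theorem opAt_pd (hV : IsOpen V) (hf : SmoothOn f V) (hx : x ∈ V) (a : Fin 2) (p : Poly) :
    opAt (pd a f) x p = opAt f x (X (Sum.inl a) * p) := by
  induction p using MvPolynomial.induction_on' with
  | add p q hp hq => rw [map_add, mul_add, map_add, hp, hq]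
  | monomial s c =>
    obtain rfl | rfl : a = 0 ∨ a = 1 := by omega
    · rw [X_mul_monomial, opAt_monomial, opAt_monomial, pdm_pd_zero hV hf _ _ hx]
      simp
    · rw [X_mul_monomial, opAt_monomial, opAt_monomial, pdm_pd_one]
      simp

theorem smoothOn_opAt (hV : IsOpen V) (hf : SmoothOn f V) (p : Poly) :
    SmoothOn (fun y => opAt f y p) V := by
  induction p using MvPolynomial.induction_on' with
  | add p q hp hq =>
    simp only [map_add]
    exact hp.add hV hq
  | monomial s c =>
    simp only [opAt_monomial]
    exact ((smoothOn_pdm hf _ _).clm hV _).smul hV contDiffOn_const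

theorem pd_opAt (hV : IsOpen V) (hf : SmoothOn f V) (hx : x ∈ V) (a : Fin 2) (p : Poly) :
    pd a (fun y => opAt f y p) x = opAt f x (X (Sum.inl a) * p) := by
  induction p using MvPolynomial.induction_on' with
  | add p q hp hq =>
    simp only [map_add, mul_add]
    rw [pd_add (smoothOn_opAt hV hf p) (smoothOn_opAt hV hf q) hx, hp, hq]
  | monomial s c =>
    simp only [opAt_monomial, X_mul_monomial]
    have h1 := pd_clm (smoothOn_pdm hf (s (Sum.inl 0)) (s (Sum.inl 1))) hx a
      (c • weyl (s (Sum.inr 0)) (s (Sum.inr 1)))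
    simp only [smul_apply] at h1
    rw [h1]
    obtain rfl | rfl : a = 0 ∨ a = 1 := by omega
    · rw [pd_zero_pdm]; simp
    · rw [pd_one_pdm hV hf _ _ hx]; simp

end SmoothArgument

end

section

open Filter Topology Set MvPolynomial

/-! ### Faithfulness of the symbol calculus -/

theorem exists_spinor_ne_zero : ∃ v : Spinor, v ≠ 0 := by
  let b : ContDiffBump (0 : ℝ) := ⟨1, 2, by norm_num, by norm_num⟩
  have hs : HasCompactSupport fun t : ℝ => ((b t : ℝ) : ℂ) :=
    b.hasCompactSupport.comp_left (g := fun r : ℝ => (r : ℂ)) Complex.ofReal_zero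
  have hd : ContDiff ℝ ∞ fun t : ℝ => ((b t : ℝ) : ℂ) :=
    Complex.ofRealCLM.contDiff.comp b.contDiff
  refine ⟨hs.toSchwartzMap hd, fun h => ?_⟩
  have h0 := DFunLike.congr_fun h (0 : ℝ)
  have h1 : b 0 = 1 := b.one_of_mem_closedBall (by simp [b])
  simp [h1] at h0

theorem contDiff_coord (a : Fin 2) : ContDiff ℝ ∞ fun y : Plane => y a :=
  (EuclideanSpace.proj a : Plane →L[ℝ] ℝ).contDiff

theorem fderiv_coord (a b : Fin 2) (c : ℝ) (y : Plane) :
    fderiv ℝ (fun y : Plane => (((y a - c : ℝ)) : ℂ)) y (stdVec b) = if a = b then 1 else 0 := by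
  have h : HasFDerivAt (fun y : Plane => (((y a - c : ℝ)) : ℂ))
      (Complex.ofRealCLM ∘L (EuclideanSpace.proj a : Plane →L[ℝ] ℝ)) y :=
    Complex.ofRealCLM.hasFDerivAt.comp y
      (((EuclideanSpace.proj a : Plane →L[ℝ] ℝ).hasFDerivAt).sub_const c)
  rw [h.fderiv]
  by_cases hab : a = b
  · subst hab; simp [stdVec]
  · simp [stdVec, hab]

theorem exists_eq_add_single_inl {s : Fin 2 ⊕ Fin 2 →₀ ℕ} {n : ℕ}
    (h : Finsupp.weight xiW s = n + 1) :
    ∃ t a, s = t + Finsupp.single (Sum.inl a) 1 ∧ Finsupp.weight xiW t = n := by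
  have : ∃ a : Fin 2, Sum.inl a ∈ s.support := by
    by_contra! h'
    have h0 := h' 0
    have h1 := h' 1
    rw [Finsupp.notMem_support_iff] at h0 h1
    rw [weight_xiW, h0, h1] at h
    omega
  obtain ⟨a, ha⟩ := this
  obtain ⟨t, rfl⟩ := exists_eq_add_single ha
  rw [weight_add_single] at h
  exact ⟨t, a, rfl, by simpa using h⟩

theorem pdm_eq_self_of_weight {s : Fin 2 ⊕ Fin 2 →₀ ℕ} (h : Finsupp.weight xiW s = 0)
    (f : Plane → Spinor) : pdm (s (Sum.inl 0)) (s (Sum.inl 1)) f = f := by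
  rw [weight_xiW] at h
  rw [show s (Sum.inl 0) = 0 by omega, show s (Sum.inl 1) = 0 by omega]; rfl

section

variable {V : Set Plane} {f : Plane → Spinor} {x : Plane}

theorem opAt_smul_X_mul (hV : IsOpen V) {c : Plane → ℂ} (hc : ContDiffOn ℝ ∞ c V)
    (hf : SmoothOn f V) (hx : x ∈ V) (a : Fin 2) (q : Poly) :
    opAt (fun y => c y • f y) x (X (Sum.inl a) * q) =
      opAt (fun y => fderiv ℝ c y (stdVec a) • f y) x q + opAt (fun y => c y • pd a f y) x q := by
  have h1 := hf.smul hV (contDiffOn_fderiv_apply hV hc (stdVec a))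
  rw [← opAt_pd hV (hf.smul hV hc) hx, ← opAt_add hV h1 ((hf.pd a).smul hV hc) hx]
  exact opAt_congr_of_eqOn hV (fun y hy => pd_smul hV hc hf hy a) hx q

/-- The commutator with a coordinate differentiates the symbol in `ξ_a`. There are no further terms,
because the second derivatives of an affine function vanish. -/
theorem opAt_coord_smul (hV : IsOpen V) (hf : SmoothOn f V) (hx : x ∈ V) (a : Fin 2) (c : ℝ)
    (q : Poly) : opAt (fun y => ((y a - c : ℝ) : ℂ) • f y) x q =
      ((x a - c : ℝ) : ℂ) • opAt f x q + opAt f x (pderiv (Sum.inl a) q) := by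
  have hc : ContDiffOn ℝ ∞ (fun y : Plane => ((y a - c : ℝ) : ℂ)) V :=
    (Complex.ofRealCLM.contDiff.comp ((contDiff_coord a).sub contDiff_const)).contDiffOn
  -- Induction on the order of the monomial: one derivative `∂_b` is split off and distributed by
  -- the product rule.
  have key : ∀ n, ∀ s : Fin 2 ⊕ Fin 2 →₀ ℕ, Finsupp.weight xiW s = n → ∀ (d : ℂ) (f : Plane → Spinor),
      SmoothOn f V → opAt (fun y => ((y a - c : ℝ) : ℂ) • f y) x (monomial s d) =
      ((x a - c : ℝ) : ℂ) • opAt f x (monomial s d) +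
        opAt f x (pderiv (Sum.inl a) (monomial s d)) := by
    intro n
    induction n with
    | zero =>
      intro s hs d f hf
      have h0 : pderiv (Sum.inl a) (monomial s d) = 0 := by
        have h1 := hs
        rw [weight_xiW] at h1
        have : s (Sum.inl a) = 0 := by
          obtain rfl | rfl : a = 0 ∨ a = 1 := by omega
          all_goals omega
        rw [pderiv_monomial, this]; simp
      rw [h0, map_zero, add_zero, opAt_monomial, opAt_monomial, pdm_eq_self_of_weight hs,
        pdm_eq_self_of_weight hs, map_smul, smul_comm]
    | succ n ih =>
      intro s hs d f hf
      obtain ⟨t, b, rfl, ht⟩ := exists_eq_add_single_inl hs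
      have e : opAt (fun y => fderiv ℝ (fun y : Plane => ((y a - c : ℝ) : ℂ)) y (stdVec b) • f y) x
          (monomial t d) = opAt f x ((if a = b then (1 : ℂ) else 0) • monomial t d) := by
        simp only [fderiv_coord]
        rw [opAt_const_smul hV hf hx, map_smul]
      rw [← X_mul_monomial, opAt_smul_X_mul hV hc hf hx, ih t ht d _ (hf.pd b), opAt_pd hV hf hx,
        opAt_pd hV hf hx, Derivation.leibniz, pderiv_X, e, smul_eq_mul, smul_eq_mul, map_add]
      have e2 : monomial t d * Pi.single (M := fun _ : Fin 2 ⊕ Fin 2 => Poly) (Sum.inl a) 1 (Sum.inl b) =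
          (if a = b then (1 : ℂ) else 0) • monomial t d := by
        by_cases hab : a = b
        · subst hab; simp
        · have : (Sum.inl b : Fin 2 ⊕ Fin 2) ≠ Sum.inl a := fun h => hab (Sum.inl_injective h).symm
          simp [hab]
      rw [e2]
      abel
  induction q using MvPolynomial.induction_on' with
  | add p q hp hq => rw [map_add, map_add, map_add, map_add, hp, hq, smul_add]; abel
  | monomial s d => exact key _ s rfl d f hf

/-- A symbol is determined by its operator. -/
theorem eq_zero_of_opAt_eq_zero (hV : IsOpen V) (hx : x ∈ V) {p : Poly}
    (h : ∀ f, SmoothOn f V → opAt f x p = 0) : p = 0 := by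
  -- Commutators with the functions `y a - x a`, which vanish at `x`, differentiate the symbol in
  -- `ξ`; commutators with gamma matrices differentiate it in `y`. So the symbols acting by zero are
  -- stable under all derivatives, and since a nonzero spinor exists no nonzero constant is among
  -- them.
  refine eq_zero_of_pderiv_stable (K := fun p => ∀ f, SmoothOn f V → opAt f x p = 0)
    (fun p i hp => ?_) (fun c hc => ?_) h
  · rcases i with a | b
    · intro f hf
      have hs : SmoothOn (fun y => ((y a - x a : ℝ) : ℂ) • f y) V := hf.smul hV
        (Complex.ofRealCLM.contDiff.comp ((contDiff_coord a).sub contDiff_const)).contDiffOn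
      have h1 := opAt_coord_smul hV hf hx a (x a) p
      rw [hp _ hs, hp _ hf, smul_zero, zero_add] at h1
      exact h1.symm
    · have hl : ∀ a, ∀ f, SmoothOn f V → opAt f x (gl a p - gr a p) = 0 := fun a f hf => by
        rw [map_sub, ← gamma_opAt, ← opAt_gamma hV hf hx, hp _ hf, hp _ (hf.clm hV _)]
        simp
      intro f hf
      obtain rfl | rfl : b = 0 ∨ b = 1 := by omega
      · have h1 := hl 1 f hf
        have e : gl 1 p - gr 1 p = (-2 : ℂ) • pderiv (Sum.inr 0) p := by
          rw [gl_one, gr_one, neg_smul, two_smul]; ring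
        rw [e, map_smul] at h1
        exact (smul_eq_zero.1 h1).resolve_left (by norm_num)
      · have h1 := hl 0 f hf
        have e : gl 0 p - gr 0 p = (2 : ℂ) • pderiv (Sum.inr 1) p := by
          rw [gl_zero, gr_zero, two_smul]; ring
        rw [e, map_smul] at h1
        exact (smul_eq_zero.1 h1).resolve_left (by norm_num)
  · obtain ⟨v, hv⟩ := exists_spinor_ne_zero
    have h1 := hc _ (smoothOn_const V v)
    rw [opAt_C] at h1
    exact (smul_eq_zero.1 h1).resolve_right hv

end

/-! ### Local differential operators -/

theorem finite_box (k N : ℕ) : {s : Fin 2 ⊕ Fin 2 →₀ ℕ |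
    Finsupp.weight xiW s ≤ k ∧ Finsupp.weight yW s ≤ N}.Finite := by
  refine (Set.finite_Icc (0 : Fin 2 ⊕ Fin 2 →₀ ℕ)
    (Finsupp.equivFunOnFinite.symm fun _ => k + N)).subset fun s hs => ⟨zero_le, ?_⟩
  obtain ⟨h1, h2⟩ := hs
  rw [weight_xiW] at h1
  rw [weight_yW] at h2
  intro i
  rcases i with i | i <;> obtain rfl | rfl : i = 0 ∨ i = 1 := by omega
  all_goals simp; omega

/-- The exponents of degree at most `k` in `ξ` and at most `N` in `y`. -/
def box (k N : ℕ) : Finset (Fin 2 ⊕ Fin 2 →₀ ℕ) := (finite_box k N).toFinset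

theorem mem_box {k N : ℕ} {s : Fin 2 ⊕ Fin 2 →₀ ℕ} :
    s ∈ box k N ↔ Finsupp.weight xiW s ≤ k ∧ Finsupp.weight yW s ≤ N := by
  simp [box]

theorem eq_sum_box {k N : ℕ} {p : Poly} (h1 : WLe xiW k p) (h2 : WLe yW N p) :
    p = ∑ s ∈ box k N, monomial s (coeff s p) := by
  classical
  ext t
  rw [coeff_sum]
  simp only [coeff_monomial]
  rw [Finset.sum_ite_eq']
  split_ifs with h
  · rfl
  · by_contra h0
    exact h (mem_box.2 ⟨h1 t h0, h2 t h0⟩)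

/-- On `V`, the operator `L` is the differential operator of order at most `k` with Weyl symbol `p`
of degree at most `N` in the gamma matrices. -/
structure LocSymb (V : Set Plane) (k N : ℕ) (L : (Plane → Spinor) → Plane → Spinor)
    (p : Plane → Poly) : Prop where
  smooth : ∀ s, ContDiffOn ℝ ∞ (fun x => coeff s (p x)) V
  xi : ∀ x ∈ V, WLe xiW k (p x)
  y : ∀ x ∈ V, WLe yW N (p x)
  act : ∀ U ⊆ V, IsOpen U → ∀ f, SmoothOn f U → ∀ x ∈ U, L f x = opAt f x (p x)

namespace LocSymb

variable {V : Set Plane} {k l N N' : ℕ} {L L' : (Plane → Spinor) → Plane → Spinor}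
  {p p' : Plane → Poly}

theorem congr (h : LocSymb V k N L p) (hL : ∀ U ⊆ V, IsOpen U → ∀ f, SmoothOn f U →
    ∀ x ∈ U, L' f x = L f x) : LocSymb V k N L' p :=
  ⟨h.smooth, h.xi, h.y, fun U hU hUo f hf x hx =>
    (hL U hU hUo f hf x hx).trans (h.act U hU hUo f hf x hx)⟩

theorem restrict (h : LocSymb V k N L p) {W : Set Plane} (hW : W ⊆ V) : LocSymb W k N L p :=
  ⟨fun s => (h.smooth s).mono hW, fun x hx => h.xi x (hW hx), fun x hx => h.y x (hW hx),
    fun U hU => h.act U (hU.trans hW)⟩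

theorem congr_symb (h : LocSymb V k N L p) (hp : ∀ x ∈ V, p' x = p x) : LocSymb V k N L p' :=
  ⟨fun s => (h.smooth s).congr fun x hx => by rw [hp x hx], fun x hx => hp x hx ▸ h.xi x hx,
    fun x hx => hp x hx ▸ h.y x hx, fun U hU hUo f hf x hx => by
      rw [hp x (hU hx)]; exact h.act U hU hUo f hf x hx⟩

theorem mono (h : LocSymb V k N L p) (hk : k ≤ l) (hN : N ≤ N') : LocSymb V l N' L p :=
  ⟨h.smooth, fun x hx => (h.xi x hx).mono hk, fun x hx => (h.y x hx).mono hN, h.act⟩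

theorem zero (V : Set Plane) (k N : ℕ) : LocSymb V k N (fun _ _ => 0) (fun _ => 0) :=
  ⟨fun s => by simpa using contDiffOn_const, fun _ _ => wLe_zero, fun _ _ => wLe_zero,
    fun U _ _ f _ x _ => by simp⟩

theorem const {q : Poly} (V : Set Plane) (h1 : WLe xiW k q) (h2 : WLe yW N q) :
    LocSymb V k N (fun f x => opAt f x q) (fun _ => q) :=
  ⟨fun _ => contDiffOn_const, fun _ _ => h1, fun _ _ => h2, fun _ _ _ _ _ _ _ => rfl⟩

theorem id (V : Set Plane) : LocSymb V 0 0 (fun f x => f x) (fun _ => C 1) :=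
  (const V (q := C 1) (by rw [← monomial_zero']; exact wLe_monomial (by simp))
    (by rw [← monomial_zero']; exact wLe_monomial (by simp))).congr
      fun U _ _ f _ x _ => by rw [opAt_C, one_smul]

theorem add (h : LocSymb V k N L p) (h' : LocSymb V k N L' p') :
    LocSymb V k N (fun f x => L f x + L' f x) (fun x => p x + p' x) :=
  ⟨fun s => by simpa using (h.smooth s).add (h'.smooth s),
    fun x hx => (h.xi x hx).add (h'.xi x hx), fun x hx => (h.y x hx).add (h'.y x hx),
    fun U hU hUo f hf x hx => by
      rw [map_add, h.act U hU hUo f hf x hx, h'.act U hU hUo f hf x hx]⟩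

theorem smul (h : LocSymb V k N L p) {c : Plane → ℂ} (hc : ContDiffOn ℝ ∞ c V) :
    LocSymb V k N (fun f x => c x • L f x) (fun x => c x • p x) :=
  ⟨fun s => by simpa using hc.mul (h.smooth s), fun x hx => (h.xi x hx).smul _,
    fun x hx => (h.y x hx).smul _, fun U hU hUo f hf x hx => by
      rw [map_smul, h.act U hU hUo f hf x hx]⟩

theorem sub (h : LocSymb V k N L p) (h' : LocSymb V k N L' p') :
    LocSymb V k N (fun f x => L f x - L' f x) (fun x => p x - p' x) :=
  ((h.add (h'.smul (c := fun _ => -1) contDiffOn_const)).congr fun U _ _ f _ x _ => by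
    rw [neg_one_smul, sub_eq_add_neg]).congr_symb fun x _ => by rw [neg_one_smul, sub_eq_add_neg]

theorem sum {κ : Type*} {t : Finset κ} {L : κ → (Plane → Spinor) → Plane → Spinor}
    {p : κ → Plane → Poly} (h : ∀ i ∈ t, LocSymb V k N (L i) (p i)) :
    LocSymb V k N (fun f x => ∑ i ∈ t, L i f x) (fun x => ∑ i ∈ t, p i x) := by
  classical
  induction t using Finset.induction_on with
  | empty => simpa using zero V k N
  | insert i t hi ih =>
    simp only [Finset.sum_insert hi]
    exact (h i (by simp)).add (ih fun j hj => h j (by simp [hj]))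

theorem smooth_X_mul (h : ∀ s, ContDiffOn ℝ ∞ (fun x => coeff s (p x)) V) (i : Fin 2 ⊕ Fin 2)
    (s : Fin 2 ⊕ Fin 2 →₀ ℕ) : ContDiffOn ℝ ∞ (fun x => coeff s (X i * p x)) V := by
  classical
  simp only [coeff_X_mul']
  split_ifs
  · exact h _
  · exact contDiffOn_const

theorem smooth_pderiv (h : ∀ s, ContDiffOn ℝ ∞ (fun x => coeff s (p x)) V) (i : Fin 2 ⊕ Fin 2)
    (s : Fin 2 ⊕ Fin 2 →₀ ℕ) : ContDiffOn ℝ ∞ (fun x => coeff s (pderiv i (p x))) V := by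
  simp only [coeff_pderiv]
  exact (h _).mul contDiffOn_const

theorem smooth_smul (h : ∀ s, ContDiffOn ℝ ∞ (fun x => coeff s (p x)) V) {c : Plane → ℂ}
    (hc : ContDiffOn ℝ ∞ c V) (s : Fin 2 ⊕ Fin 2 →₀ ℕ) :
    ContDiffOn ℝ ∞ (fun x => coeff s (c x • p x)) V := by
  simpa using hc.mul (h s)

theorem smooth_sum {κ : Type*} {t : Finset κ} {p : κ → Plane → Poly}
    (h : ∀ i ∈ t, ∀ s, ContDiffOn ℝ ∞ (fun x => coeff s (p i x)) V) (s : Fin 2 ⊕ Fin 2 →₀ ℕ) :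
    ContDiffOn ℝ ∞ (fun x => coeff s (∑ i ∈ t, p i x)) V := by
  simp only [coeff_sum]
  exact ContDiffOn.sum fun i hi => h i hi s

theorem smooth_gl (h : ∀ s, ContDiffOn ℝ ∞ (fun x => coeff s (p x)) V) (a : Fin 2)
    (s : Fin 2 ⊕ Fin 2 →₀ ℕ) : ContDiffOn ℝ ∞ (fun x => coeff s (gl a (p x))) V := by
  simp only [gl_apply, coeff_add]
  exact (smooth_X_mul h _ s).add (smooth_sum (fun b _ => smooth_smul (smooth_pderiv h _)
    contDiffOn_const) s)

theorem smooth_gr (h : ∀ s, ContDiffOn ℝ ∞ (fun x => coeff s (p x)) V) (a : Fin 2)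
    (s : Fin 2 ⊕ Fin 2 →₀ ℕ) : ContDiffOn ℝ ∞ (fun x => coeff s (gr a (p x))) V := by
  simp only [gr_apply, coeff_sub]
  exact (smooth_X_mul h _ s).sub (smooth_sum (fun b _ => smooth_smul (smooth_pderiv h _)
    contDiffOn_const) s)

theorem gammaLeft (h : LocSymb V k N L p) (a : Fin 2) :
    LocSymb V k (N + 1) (fun f x => gamma a (L f x)) (fun x => gl a (p x)) :=
  ⟨smooth_gl h.smooth a, fun x hx => (h.xi x hx).gl a, fun x hx => (h.y x hx).gl a,
    fun U hU hUo f hf x hx => by rw [h.act U hU hUo f hf x hx, gamma_opAt]⟩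

theorem gammaRight (h : LocSymb V k N L p) (a : Fin 2) :
    LocSymb V k (N + 1) (fun f => L fun y => gamma a (f y)) (fun x => gr a (p x)) :=
  ⟨smooth_gr h.smooth a, fun x hx => (h.xi x hx).gr a, fun x hx => (h.y x hx).gr a,
    fun U hU hUo f hf x hx => by
      rw [h.act U hU hUo _ (hf.clm hUo _) x hx, opAt_gamma hUo hf hx]⟩

theorem pdRight (h : LocSymb V k N L p) (a : Fin 2) :
    LocSymb V (k + 1) N (fun f => L (pd a f)) (fun x => X (Sum.inl a) * p x) :=
  ⟨smooth_X_mul h.smooth _, fun x hx => (h.xi x hx).X_mul _, fun x hx => (h.y x hx).X_mul _,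
    fun U hU hUo f hf x hx => by rw [h.act U hU hUo _ (hf.pd a) x hx, opAt_pd hUo hf hx]⟩

/-- The index set `box k N` does not depend on the point, so `L f` is a fixed finite sum with smooth
coefficients and can be differentiated term by term. -/
theorem act_eq_sum (h : LocSymb V k N L p) {U : Set Plane} (hU : U ⊆ V) (hUo : IsOpen U)
    {f : Plane → Spinor} (hf : SmoothOn f U) {x : Plane} (hx : x ∈ U) : L f x = ∑ s ∈ box k N, coeff s (p x) • opAt f x (monomial s 1) := by
  rw [h.act U hU hUo f hf x hx]
  conv_lhs => rw [eq_sum_box (h.xi x (hU hx)) (h.y x (hU hx))]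
  rw [map_sum]
  refine Finset.sum_congr rfl fun s _ => ?_
  rw [← map_smul, smul_monomial, smul_eq_mul, mul_one]

theorem smoothOn (h : LocSymb V k N L p) {U : Set Plane} (hU : U ⊆ V) (hUo : IsOpen U)
    {f : Plane → Spinor} (hf : SmoothOn f U) : SmoothOn (L f) U :=
  SmoothOn.congr hUo (SmoothOn.sum hUo fun s _ => (smoothOn_opAt hUo hf (monomial s 1)).smul hUo
    ((h.smooth s).mono hU)) fun _ hx => (h.act_eq_sum hU hUo hf hx).symm

theorem eqOn (h : LocSymb V k N L p) {U : Set Plane} (hU : U ⊆ V) (hUo : IsOpen U)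
    {f g : Plane → Spinor} (hf : SmoothOn f U) (hfg : EqOn f g U) : EqOn (L f) (L g) U :=
  fun x hx => by
    rw [h.act U hU hUo f hf x hx, h.act U hU hUo g (hf.congr hUo hfg) x hx]
    exact opAt_congr_of_eqOn hUo hfg hx _

/-- The derivative `∂_a` of the coefficients of a symbol. -/
def dx (k N : ℕ) (a : Fin 2) (p : Plane → Poly) (x : Plane) : Poly :=
  ∑ s ∈ box k N, monomial s (fderiv ℝ (fun y => coeff s (p y)) x (stdVec a))

/-- The derivative falls either on the argument, raising the order, or on the coefficients. The
second contribution `dx` has order at most `k` and does not affect the symbol of order `k + 1`. -/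
theorem pdLeft (hV : IsOpen V) (h : LocSymb V k N L p) (a : Fin 2) :
    LocSymb V (k + 1) N (fun f => pd a (L f))
      (fun x => X (Sum.inl a) * p x + dx k N a p x) := by
  classical
  refine ⟨fun s => ?_, fun x hx => ?_, fun x hx => ?_, fun U hU hUo f hf x hx => ?_⟩
  · simp only [coeff_add]
    refine (smooth_X_mul h.smooth _ s).add (smooth_sum (fun t _ s => ?_) s)
    simp only [coeff_monomial]
    split_ifs
    · exact contDiffOn_fderiv_apply hV (h.smooth t) _
    · exact contDiffOn_const
  · exact ((h.xi x hx).X_mul _).add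
      (WLe.sum fun s hs => wLe_monomial ((mem_box.1 hs).1.trans (Nat.le_succ k)))
  · exact ((h.y x hx).X_mul _).add (WLe.sum fun s hs => wLe_monomial (mem_box.1 hs).2)
  · have e : EqOn (L f) (fun y => ∑ s ∈ box k N, coeff s (p y) • opAt f y (monomial s 1)) U :=
      fun y hy => h.act_eq_sum hU hUo hf hy
    rw [eqOn_pd hUo e a hx, pd_sum hUo (fun s _ => (smoothOn_opAt hUo hf (monomial s 1)).smul hUo
      ((h.smooth s).mono hU)) hx]
    have e2 : ∀ s, pd a (fun y => coeff s (p y) • opAt f y (monomial s 1)) x =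
        opAt f x (monomial s (fderiv ℝ (fun y => coeff s (p y)) x (stdVec a))) +
        opAt f x (X (Sum.inl a) * monomial s (coeff s (p x))) := fun s => by
      have m1 : ∀ c : ℂ, (monomial s c : Poly) = c • monomial s 1 := fun c => by
        rw [smul_monomial, smul_eq_mul, mul_one]
      rw [pd_smul hUo ((h.smooth s).mono hU) (smoothOn_opAt hUo hf _) hx, pd_opAt hUo hf hx,
        m1 (fderiv ℝ _ x _), m1 (coeff s (p x)), mul_smul_comm, map_smul, map_smul]
    simp only [e2]
    rw [Finset.sum_add_distrib, ← map_sum, ← map_sum, ← Finset.mul_sum,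
      ← eq_sum_box (h.xi x (hU hx)) (h.y x (hU hx)), map_add, add_comm]
    rfl

theorem part_dx (x : Plane) (a : Fin 2) : part xiW (k + 1) (dx k N a p x) = 0 :=
  (WLe.sum fun _ hs => wLe_monomial (mem_box.1 hs).1 : WLe xiW k (dx k N a p x)).part_eq_zero
    (Nat.lt_succ_self k)

theorem coeff_X_mul_congr {i : Fin 2 ⊕ Fin 2} {q q' : Poly} {t : Fin 2 ⊕ Fin 2 →₀ ℕ}
    (h : ∀ t', t = t' + Finsupp.single i 1 → coeff t' q = coeff t' q') :
    coeff t (X i * q) = coeff t (X i * q') := by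
  classical
  rw [coeff_X_mul', coeff_X_mul']
  split_ifs with ht
  · obtain ⟨t', rfl⟩ := exists_eq_add_single ht
    rw [add_tsub_cancel_right]; exact h t' rfl
  · rfl

/-- Leibniz terms with at least two derivatives on `c` have order at most `n - 2`. The condition `n
≤ weight + 1` restricts the comparison to the orders `n` and `n - 1`, where only `c` and its first
derivatives enter. -/
theorem mulRight_monomial (hV : IsOpen V) (n : ℕ) (s : Fin 2 ⊕ Fin 2 →₀ ℕ)
    (hs : Finsupp.weight xiW s = n) {c : Plane → ℂ} (hc : ContDiffOn ℝ ∞ c V) :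
    ∃ p', LocSymb V n (Finsupp.weight yW s)
        (fun f x => opAt (fun y => c y • f y) x (monomial s 1)) p' ∧
      ∀ x ∈ V, ∀ t, n ≤ Finsupp.weight xiW t + 1 → coeff t (p' x) =
        coeff t (c x • monomial s 1 + ∑ b, fderiv ℝ c x (stdVec b) •
          pderiv (Sum.inl b) (monomial s (1 : ℂ))) := by
  classical
  induction n generalizing s c with
  | zero =>
    refine ⟨fun x => c x • monomial s 1, ((const V (q := monomial s 1)
      (wLe_monomial hs.le) (wLe_monomial le_rfl)).smul hc).congr fun U hU hUo f hf x hx => ?_,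
      fun x hx t ht => ?_⟩
    · rw [opAt_monomial, opAt_monomial, pdm_eq_self_of_weight hs, pdm_eq_self_of_weight hs,
        map_smul, smul_comm]
    · have h0 : ∀ b : Fin 2, pderiv (Sum.inl b) (monomial s (1 : ℂ)) = 0 := fun b => by
        have h1 := hs
        rw [weight_xiW] at h1
        have : s (Sum.inl b) = 0 := by
          obtain rfl | rfl : b = 0 ∨ b = 1 := by omega
          all_goals omega
        rw [pderiv_monomial, this]; simp
      simp [h0]
  | succ n ih =>
    obtain ⟨s, a, rfl, hs'⟩ := exists_eq_add_single_inl hs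
    obtain ⟨p₁, h₁, e₁⟩ := ih s hs' (contDiffOn_fderiv_apply hV hc (stdVec a))
    obtain ⟨p₂, h₂, e₂⟩ := ih s hs' hc
    have hy : Finsupp.weight yW (s + Finsupp.single (Sum.inl a) 1) = Finsupp.weight yW s := by
      rw [weight_add_single]; simp
    rw [hy]
    refine ⟨fun x => p₁ x + X (Sum.inl a) * p₂ x,
      ((h₁.mono n.le_succ le_rfl).add (h₂.pdRight a)).congr fun U hU hUo f hf x hx => ?_,
      fun x hx t ht => ?_⟩
    · rw [← X_mul_monomial, opAt_smul_X_mul hUo (hc.mono hU) hf hx]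
    · have hz : coeff t (∑ b, fderiv ℝ (fun y => fderiv ℝ c y (stdVec a)) x (stdVec b) •
          pderiv (Sum.inl b) (monomial s (1 : ℂ))) = 0 := by
        rw [coeff_sum]
        refine Finset.sum_eq_zero fun b _ => ?_
        rw [coeff_smul, coeff_pderiv, coeff_monomial, if_neg, zero_mul, smul_zero]
        intro h
        rw [h, weight_add_single] at hs'
        simp only [xiW_inl] at hs'
        omega
      have h1 : coeff t (p₁ x) = coeff t (fderiv ℝ c x (stdVec a) • monomial s 1) := by
        rw [e₁ x hx t (by omega), coeff_add, hz, add_zero]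
      have h2 : coeff t (X (Sum.inl a) * p₂ x) = coeff t (X (Sum.inl a) *
          (c x • monomial s 1 + ∑ b, fderiv ℝ c x (stdVec b) •
            pderiv (Sum.inl b) (monomial s (1 : ℂ)))) := by
        refine coeff_X_mul_congr fun t' ht' => e₂ x hx t' ?_
        rw [ht', weight_add_single] at ht
        simp only [xiW_inl] at ht
        omega
      rw [coeff_add, h1, h2, ← coeff_add]
      congr 1
      have hX : ∀ b : Fin 2, pderiv (Sum.inl b) (X (Sum.inl a) * monomial s (1 : ℂ)) =
          (if a = b then monomial s 1 else 0) +
            X (Sum.inl a) * pderiv (Sum.inl b) (monomial s (1 : ℂ)) := fun b => by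
        rw [Derivation.leibniz, pderiv_X, smul_eq_mul, smul_eq_mul, add_comm]
        congr 1
        by_cases hab : a = b
        · subst hab; simp
        · have : (Sum.inl a : Fin 2 ⊕ Fin 2) ≠ Sum.inl b := fun h => hab (Sum.inl_injective h)
          simp [hab]
      rw [← X_mul_monomial]
      simp only [hX, smul_add, Finset.sum_add_distrib, mul_add, Finset.mul_sum, mul_smul_comm]
      simp only [smul_ite, smul_zero, Finset.sum_ite_eq, Finset.mem_univ, if_true]
      abel

/-- Composition with the multiplication by a function, up to terms of order `k - 2`. -/
theorem mulRight (hV : IsOpen V) (h : LocSymb V k N L p) {c : Plane → ℂ}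
    (hc : ContDiffOn ℝ ∞ c V) :
    ∃ p', LocSymb V k N (fun f => L fun y => c y • f y) p' ∧
      ∀ x ∈ V, ∀ t, k ≤ Finsupp.weight xiW t + 1 → coeff t (p' x) =
        coeff t (c x • p x + ∑ b, fderiv ℝ c x (stdVec b) • pderiv (Sum.inl b) (p x)) := by
  choose p' h' e' using fun s : Fin 2 ⊕ Fin 2 →₀ ℕ => mulRight_monomial hV _ s rfl hc
  refine ⟨fun x => ∑ s ∈ box k N, coeff s (p x) • p' s x,
    (sum fun s hs => ((h' s).mono (mem_box.1 hs).1 (mem_box.1 hs).2).smul (h.smooth s)).congr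
      fun U hU hUo f hf x hx => h.act_eq_sum hU hUo (hf.smul hUo (hc.mono hU)) hx, fun x hx t ht => ?_⟩
  conv_rhs => rw [eq_sum_box (h.xi x hx) (h.y x hx)]
  have m1 : ∀ s, (monomial s (coeff s (p x)) : Poly) = coeff s (p x) • monomial s 1 := fun s => by
    rw [smul_monomial, smul_eq_mul, mul_one]
  simp only [m1, map_sum, Finset.smul_sum]
  rw [Finset.sum_comm, ← Finset.sum_add_distrib, coeff_sum, coeff_sum]
  refine Finset.sum_congr rfl fun s hs => ?_
  rw [coeff_smul, e' s x hx t ((mem_box.1 hs).1.trans ht), ← coeff_smul, smul_add, Finset.smul_sum,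
    smul_comm]
  congr 2
  refine Finset.sum_congr rfl fun b _ => ?_
  rw [Derivation.map_smul, smul_comm]

end LocSymb

end

section

open Filter Topology Set MvPolynomial

/-! ### Symmetric tensors as polynomials -/

/-- The exponent of the monomial `ξ_{a_1} ⋯ ξ_{a_m} y_{b_1} ⋯ y_{b_j}`. -/
def expo {m j : ℕ} (c : Fin m ⊕ Fin j → Fin 2) : Fin 2 ⊕ Fin 2 →₀ ℕ :=
  Finsupp.equivFunOnFinite.symm
    (Sum.elim ![m - ones (c ∘ Sum.inl), ones (c ∘ Sum.inl)]
      ![j - ones (c ∘ Sum.inr), ones (c ∘ Sum.inr)])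

section Expo

variable {m j : ℕ} (c : Fin m ⊕ Fin j → Fin 2)

@[simp] theorem expo_inl_zero : expo c (Sum.inl 0) = m - ones (c ∘ Sum.inl) := rfl
@[simp] theorem expo_inl_one : expo c (Sum.inl 1) = ones (c ∘ Sum.inl) := rfl
@[simp] theorem expo_inr_zero : expo c (Sum.inr 0) = j - ones (c ∘ Sum.inr) := rfl
@[simp] theorem expo_inr_one : expo c (Sum.inr 1) = ones (c ∘ Sum.inr) := rfl

theorem exponent_ext {s t : Fin 2 ⊕ Fin 2 →₀ ℕ} (h0 : s (Sum.inl 0) = t (Sum.inl 0))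
    (h1 : s (Sum.inl 1) = t (Sum.inl 1)) (h2 : s (Sum.inr 0) = t (Sum.inr 0))
    (h3 : s (Sum.inr 1) = t (Sum.inr 1)) : s = t := by
  ext i
  rcases i with i | i <;> obtain rfl | rfl : i = 0 ∨ i = 1 := by omega
  all_goals assumption

theorem weight_xiW_expo : Finsupp.weight xiW (expo c) = m := by
  rw [weight_xiW]
  simpa using Nat.sub_add_cancel (ones_le (c ∘ Sum.inl))

theorem weight_yW_expo : Finsupp.weight yW (expo c) = j := by
  rw [weight_yW]
  simpa using Nat.sub_add_cancel (ones_le (c ∘ Sum.inr))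

theorem expo_eq_iff {c c' : Fin m ⊕ Fin j → Fin 2} : expo c = expo c' ↔
    ones (c ∘ Sum.inl) = ones (c' ∘ Sum.inl) ∧ ones (c ∘ Sum.inr) = ones (c' ∘ Sum.inr) := by
  refine ⟨fun h => ⟨DFunLike.congr_fun h (Sum.inl 1), DFunLike.congr_fun h (Sum.inr 1)⟩,
    fun ⟨h1, h2⟩ => ?_⟩
  apply exponent_ext <;> simp [h1, h2]

theorem exists_expo_eq {s : Fin 2 ⊕ Fin 2 →₀ ℕ} (h1 : Finsupp.weight xiW s = m)
    (h2 : Finsupp.weight yW s = j) : ∃ c : Fin m ⊕ Fin j → Fin 2, expo c = s := by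
  rw [weight_xiW] at h1
  rw [weight_yW] at h2
  obtain ⟨a, ha⟩ := exists_ones_eq (N := m) (r := s (Sum.inl 1)) (by omega)
  obtain ⟨b, hb⟩ := exists_ones_eq (N := j) (r := s (Sum.inr 1)) (by omega)
  refine ⟨Sum.elim a b, exponent_ext ?_ ?_ ?_ ?_⟩ <;> simp [ha, hb] <;> omega

theorem exists_perm_of_expo_eq {c c' : Fin m ⊕ Fin j → Fin 2} (h : expo c = expo c') :
    ∃ (π : Equiv.Perm (Fin m)) (ρ : Equiv.Perm (Fin j)), c' ∘ Equiv.sumCongr π ρ = c := by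
  obtain ⟨h1, h2⟩ := expo_eq_iff.1 h
  obtain ⟨π, hπ⟩ := exists_perm_of_ones_eq h1
  obtain ⟨ρ, hρ⟩ := exists_perm_of_ones_eq h2
  refine ⟨π, ρ, funext fun i => ?_⟩
  rcases i with i | i
  · exact congrFun hπ i
  · exact congrFun hρ i

theorem expo_comp_sumCongr (π : Equiv.Perm (Fin m)) (ρ : Equiv.Perm (Fin j)) :
    expo (c ∘ Equiv.sumCongr π ρ) = expo c :=
  expo_eq_iff.2 ⟨ones_comp_perm (c ∘ Sum.inl) π, ones_comp_perm (c ∘ Sum.inr) ρ⟩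

/-- The product of the factorials of the exponents. -/
def sfact (s : Fin 2 ⊕ Fin 2 →₀ ℕ) : ℂ := ∏ i, ((s i).factorial : ℂ)

theorem sfact_ne_zero (s : Fin 2 ⊕ Fin 2 →₀ ℕ) : sfact s ≠ 0 :=
  Finset.prod_ne_zero_iff.2 fun _ _ => Nat.cast_ne_zero.2 (Nat.factorial_ne_zero _)

theorem sfact_add_single (s : Fin 2 ⊕ Fin 2 →₀ ℕ) (i : Fin 2 ⊕ Fin 2) :
    sfact (s + Finsupp.single i 1) = (s i + 1) * sfact s := by
  classical
  rw [sfact, sfact, ← Finset.mul_prod_erase _ _ (Finset.mem_univ i),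
    ← Finset.mul_prod_erase _ (fun i => ((s i).factorial : ℂ)) (Finset.mem_univ i)]
  rw [Finset.prod_congr rfl (g := fun i => ((s i).factorial : ℂ)) fun k hk => by
    rw [Finsupp.add_apply, Finsupp.single_eq_of_ne (Finset.ne_of_mem_erase hk), add_zero]]
  rw [Finsupp.add_apply, Finsupp.single_eq_same, Nat.factorial_succ]
  push_cast; ring

/-- Once coefficients are multiplied by the factorials of their exponents, differentiation is a mere
shift of exponents. The entries of the tensor in `toArr` are these rescaled coefficients. -/
theorem coeff_pderiv_mul_sfact (p : Poly) (i : Fin 2 ⊕ Fin 2) (s : Fin 2 ⊕ Fin 2 →₀ ℕ) :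
    coeff s (pderiv i p) * sfact s =
      coeff (s + Finsupp.single i 1) p * sfact (s + Finsupp.single i 1) := by
  rw [coeff_pderiv, sfact_add_single]; ring

/-- The number of index tuples with a given exponent is a product of two binomial coefficients; the
factorials of the exponents complete it to `m! j!`. -/
theorem sum_expo_eq :
    (∑ c' : Fin m ⊕ Fin j → Fin 2, if expo c' = expo c then (1 : ℂ) else 0) * sfact (expo c) =
      m.factorial * j.factorial := by
  have h1 : (∑ c' : Fin m ⊕ Fin j → Fin 2, if expo c' = expo c then (1 : ℂ) else 0) =
      m.choose (ones (c ∘ Sum.inl)) * j.choose (ones (c ∘ Sum.inr)) := by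
    rw [← card_ones_eq, ← card_ones_eq, Finset.sum_mul_sum, ← Fintype.sum_prod_type',
      ← (Equiv.sumArrowEquivProdArrow (Fin m) (Fin j) (Fin 2)).sum_comp]
    refine Finset.sum_congr rfl fun c' _ => ?_
    simp only [expo_eq_iff, Equiv.sumArrowEquivProdArrow, Equiv.coe_fn_mk]
    by_cases ha : ones (c' ∘ Sum.inl) = ones (c ∘ Sum.inl) <;>
      by_cases hb : ones (c' ∘ Sum.inr) = ones (c ∘ Sum.inr) <;> simp [ha, hb]
  have h2 := Nat.choose_mul_factorial_mul_factorial (ones_le (c ∘ Sum.inl))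
  have h3 := Nat.choose_mul_factorial_mul_factorial (ones_le (c ∘ Sum.inr))
  rw [h1, sfact, Fintype.prod_sum_type, Fin.prod_univ_two, Fin.prod_univ_two, ← h2, ← h3]
  simp only [expo_inl_zero, expo_inl_one, expo_inr_zero, expo_inr_one]
  push_cast; ring

end Expo

/-- The polynomial of a tensor. -/
def arrPoly {m j : ℕ} (A : (Fin m ⊕ Fin j → Fin 2) → ℂ) : Poly := ∑ c, monomial (expo c) (A c)

/-- The tensor with `m` and `j` indices of a polynomial. -/
def toArr (m j : ℕ) (p : Poly) (c : Fin m ⊕ Fin j → Fin 2) : ℂ :=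
  coeff (expo c) p * sfact (expo c) / (m.factorial * j.factorial)

theorem toArr_symm (m j : ℕ) (p : Poly) (π : Equiv.Perm (Fin m)) (ρ : Equiv.Perm (Fin j))
    (c : Fin m ⊕ Fin j → Fin 2) : toArr m j p (c ∘ Equiv.sumCongr π ρ) = toArr m j p c := by
  rw [toArr, toArr, expo_comp_sumCongr]

section Arr

variable {m j : ℕ} {A : (Fin m ⊕ Fin j → Fin 2) → ℂ}

theorem wLe_xiW_arrPoly : WLe xiW m (arrPoly A) :=
  WLe.sum fun c _ => wLe_monomial (weight_xiW_expo c).le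

theorem wLe_yW_arrPoly : WLe yW j (arrPoly A) :=
  WLe.sum fun c _ => wLe_monomial (weight_yW_expo c).le

theorem coeff_arrPoly_of_ne {s : Fin 2 ⊕ Fin 2 →₀ ℕ}
    (h : ¬ (Finsupp.weight xiW s = m ∧ Finsupp.weight yW s = j)) : coeff s (arrPoly A) = 0 := by
  classical
  rw [arrPoly, coeff_sum]
  refine Finset.sum_eq_zero fun c _ => ?_
  rw [coeff_monomial, if_neg]
  rintro rfl
  exact h ⟨weight_xiW_expo c, weight_yW_expo c⟩

theorem part_xiW_arrPoly (n : ℕ) :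
    part xiW n (arrPoly A) = if m = n then arrPoly A else 0 := by
  classical
  ext s
  rw [coeff_weightedHomogeneousComponent]
  by_cases h : Finsupp.weight xiW s = m
  · split_ifs with h1 h2 <;> first | rfl | omega
  · have := coeff_arrPoly_of_ne (A := A) (s := s) fun h' => h h'.1
    split_ifs <;> simp [this]

theorem part_yW_arrPoly (n : ℕ) :
    part yW n (arrPoly A) = if j = n then arrPoly A else 0 := by
  classical
  ext s
  rw [coeff_weightedHomogeneousComponent]
  by_cases h : Finsupp.weight yW s = j
  · split_ifs with h1 h2 <;> first | rfl | omega
  · have := coeff_arrPoly_of_ne (A := A) (s := s) fun h' => h h'.2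
    split_ifs <;> simp [this]

theorem coeff_expo_arrPoly (hA : ∀ (π : Equiv.Perm (Fin m)) (ρ : Equiv.Perm (Fin j)) c,
    A (c ∘ Equiv.sumCongr π ρ) = A c) (c : Fin m ⊕ Fin j → Fin 2) :
    coeff (expo c) (arrPoly A) * sfact (expo c) = m.factorial * j.factorial * A c := by
  classical
  rw [← sum_expo_eq c, mul_right_comm, Finset.sum_mul, arrPoly, coeff_sum]
  congr 1
  refine Finset.sum_congr rfl fun c' _ => ?_
  rw [coeff_monomial]
  split_ifs with h
  · obtain ⟨π, ρ, rfl⟩ := exists_perm_of_expo_eq h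
    rw [hA, one_mul]
  · rw [zero_mul]

theorem arrPoly_toArr (m j : ℕ) (p : Poly) :
    arrPoly (toArr m j p) = part xiW m (part yW j p) := by
  classical
  ext s
  rw [coeff_weightedHomogeneousComponent, coeff_weightedHomogeneousComponent]
  by_cases h : Finsupp.weight xiW s = m ∧ Finsupp.weight yW s = j
  · rw [if_pos h.1, if_pos h.2]
    obtain ⟨c, rfl⟩ := exists_expo_eq h.1 h.2
    have h1 := coeff_expo_arrPoly (toArr_symm m j p) c
    have hm : (m.factorial : ℂ) ≠ 0 := Nat.cast_ne_zero.2 m.factorial_ne_zero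
    have hj : (j.factorial : ℂ) ≠ 0 := Nat.cast_ne_zero.2 j.factorial_ne_zero
    rw [toArr, mul_div_cancel₀ _ (mul_ne_zero hm hj)] at h1
    exact mul_right_cancel₀ (sfact_ne_zero _) h1
  · rw [coeff_arrPoly_of_ne h]
    split_ifs with h1 h2 <;> first | rfl | exact absurd ⟨h1, h2⟩ h

/-- Connects the tensor expressions in `DiffOp` with the Weyl calculus: partial derivatives commute,
and symmetry in the `b` indices allows Weyl ordering without lower terms. -/
theorem sum_gammaProd_pdIter_eq_opAt {V : Set Plane} (hV : IsOpen V) {f : Plane → Spinor}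
    (hf : SmoothOn f V) {x : Plane} (hx : x ∈ V)
    (hA : ∀ (π : Equiv.Perm (Fin m)) (ρ : Equiv.Perm (Fin j)) c,
      A (c ∘ Equiv.sumCongr π ρ) = A c) :
    ∑ c, A c • gammaProd (c ∘ Sum.inr) (pdIter m (c ∘ Sum.inl) f x) = opAt f x (arrPoly A) := by
  classical
  rw [arrPoly, map_sum, ← (Equiv.sumArrowEquivProdArrow (Fin m) (Fin j) (Fin 2)).symm.sum_comp,
    ← (Equiv.sumArrowEquivProdArrow (Fin m) (Fin j) (Fin 2)).symm.sum_comp, Fintype.sum_prod_type,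
    Fintype.sum_prod_type]
  refine Finset.sum_congr rfl fun a _ => ?_
  simp only [Equiv.sumArrowEquivProdArrow, Equiv.coe_fn_symm_mk, Sum.elim_comp_inr,
    Sum.elim_comp_inl, opAt_monomial, expo_inl_zero, expo_inl_one, expo_inr_zero, expo_inr_one]
  rw [pdIter_eq_pdm hV hf m a hx]
  obtain ⟨B, hB⟩ : ∃ B : ℕ → ℂ, ∀ b : Fin j → Fin 2, A (Sum.elim a b) = B (ones b) := by
    refine ⟨fun r => if h : ∃ b : Fin j → Fin 2, ones b = r then A (Sum.elim a h.choose) else 0,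
      fun b => ?_⟩
    have h : ∃ b' : Fin j → Fin 2, ones b' = ones b := ⟨b, rfl⟩
    change _ = dite _ _ _
    rw [dif_pos h]
    obtain ⟨ρ, hρ⟩ := exists_perm_of_ones_eq h.choose_spec
    rw [← hA 1 ρ]
    congr 1
    rw [← hρ]
    funext i
    rcases i with i | i <;> rfl
  simp only [hB]
  have h := congrArg (fun T : Spinor →L[ℂ] Spinor => T (pdm (m - ones a) (ones a) f x))
    (sum_ones_smul_gammaProd (N := j) B)
  simpa using h

/-- Contraction of the two groups of indices. -/
def contr : Poly →ₗ[ℂ] Poly :=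
  (pderiv (R := ℂ) (Sum.inl 0 : Fin 2 ⊕ Fin 2)).toLinearMap ∘ₗ (pderiv (Sum.inr 1)).toLinearMap -
    (pderiv (R := ℂ) (Sum.inl 1 : Fin 2 ⊕ Fin 2)).toLinearMap ∘ₗ (pderiv (Sum.inr 0)).toLinearMap

theorem contr_apply (p : Poly) : contr p = pderiv (Sum.inl 0) (pderiv (Sum.inr 1) p) -
    pderiv (Sum.inl 1) (pderiv (Sum.inr 0) p) := rfl

theorem coeff_contr_mul_sfact (p : Poly) (s : Fin 2 ⊕ Fin 2 →₀ ℕ) :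
    coeff s (contr p) * sfact s =
      coeff (s + Finsupp.single (Sum.inl 0) 1 + Finsupp.single (Sum.inr 1) 1) p *
        sfact (s + Finsupp.single (Sum.inl 0) 1 + Finsupp.single (Sum.inr 1) 1) -
      coeff (s + Finsupp.single (Sum.inl 1) 1 + Finsupp.single (Sum.inr 0) 1) p *
        sfact (s + Finsupp.single (Sum.inl 1) 1 + Finsupp.single (Sum.inr 0) 1) := by
  rw [contr_apply, coeff_sub, sub_mul, coeff_pderiv_mul_sfact, coeff_pderiv_mul_sfact,
    coeff_pderiv_mul_sfact, coeff_pderiv_mul_sfact]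

/-- A tensor is totally symmetric if and only if its contraction vanishes. -/
theorem contr_arrPoly_eq_zero_iff (hA : ∀ (π : Equiv.Perm (Fin m)) (ρ : Equiv.Perm (Fin j)) c,
    A (c ∘ Equiv.sumCongr π ρ) = A c) :
    contr (arrPoly A) = 0 ↔ ∀ (π : Equiv.Perm (Fin m ⊕ Fin j)) c, A (c ∘ π) = A c := by
  have hm : (m.factorial : ℂ) * j.factorial ≠ 0 := mul_ne_zero
    (Nat.cast_ne_zero.2 m.factorial_ne_zero) (Nat.cast_ne_zero.2 j.factorial_ne_zero)
  have total : (∀ (π : Equiv.Perm (Fin m ⊕ Fin j)) c, A (c ∘ π) = A c) ↔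
      ∀ c c' : Fin m ⊕ Fin j → Fin 2, ones c = ones c' → A c = A c' := by
    refine ⟨fun h c c' hc => ?_, fun h π c => h _ _ (ones_comp_perm c π)⟩
    obtain ⟨π, rfl⟩ := exists_perm_of_ones_eq hc
    exact h π c'
  rw [total]
  constructor
  · intro h
    -- Induction on the excess `r` of letters `1` in the first group of indices. Each step moves one
    -- letter `1` from the first group to the second; the coefficient of the contraction at the
    -- exponent `s` below is the difference of the two entries, up to a nonzero factor.
    have key : ∀ r (c c' : Fin m ⊕ Fin j → Fin 2),
        ones (c ∘ Sum.inl) = ones (c' ∘ Sum.inl) + r → ones c = ones c' → A c = A c' := by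
      intro r
      induction r with
      | zero =>
        intro c c' h1 h2
        rw [ones_sum, ones_sum c'] at h2
        obtain ⟨π, ρ, rfl⟩ := exists_perm_of_expo_eq
          (expo_eq_iff.2 ⟨h1, by omega⟩ : expo c = expo c')
        exact hA _ _ _
      | succ r ih =>
        intro c c' h1 h2
        rw [ones_sum, ones_sum c'] at h2
        have b1 := ones_le (c ∘ Sum.inl)
        have b2 := ones_le (c ∘ Sum.inr)
        have b3 := ones_le (c' ∘ Sum.inl)
        have b4 := ones_le (c' ∘ Sum.inr)
        obtain ⟨a, ha⟩ := exists_ones_eq (N := m) (r := ones (c ∘ Sum.inl) - 1) (by omega)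
        obtain ⟨b, hb⟩ := exists_ones_eq (N := j) (r := ones (c ∘ Sum.inr) + 1) (by omega)
        have h3 : ones (Sum.elim a b : Fin m ⊕ Fin j → Fin 2) = ones c' := by
          rw [ones_sum, ones_sum c', Sum.elim_comp_inl, Sum.elim_comp_inr]; omega
        rw [← ih (Sum.elim a b) c' (by rw [Sum.elim_comp_inl]; omega) h3]
        let s : Fin 2 ⊕ Fin 2 →₀ ℕ := Finsupp.equivFunOnFinite.symm
          (Sum.elim ![m - ones (c ∘ Sum.inl), ones (c ∘ Sum.inl) - 1]
            ![j - ones (c ∘ Sum.inr) - 1, ones (c ∘ Sum.inr)])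
        have hs := coeff_contr_mul_sfact (arrPoly A) s
        have e1 : s + Finsupp.single (Sum.inl 0) 1 + Finsupp.single (Sum.inr 1) 1 =
            expo (Sum.elim a b : Fin m ⊕ Fin j → Fin 2) := by
          apply exponent_ext <;> simp [s, ha, hb] <;> omega
        have e2 : s + Finsupp.single (Sum.inl 1) 1 + Finsupp.single (Sum.inr 0) 1 = expo c := by
          apply exponent_ext <;> simp [s] <;> omega
        rw [h, coeff_zero, zero_mul, e1, e2, coeff_expo_arrPoly hA, coeff_expo_arrPoly hA] at hs
        exact (mul_left_cancel₀ hm (sub_eq_zero.1 hs.symm)).symm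
    intro c c' hc
    rcases le_total (ones (c' ∘ Sum.inl)) (ones (c ∘ Sum.inl)) with hle | hle
    · obtain ⟨r, hr⟩ := Nat.exists_eq_add_of_le hle
      exact key r c c' hr hc
    · obtain ⟨r, hr⟩ := Nat.exists_eq_add_of_le hle
      exact (key r c' c hr hc.symm).symm
  · intro h
    ext s
    refine mul_right_cancel₀ (sfact_ne_zero s) ?_
    rw [coeff_contr_mul_sfact, coeff_zero, zero_mul]
    by_cases hs : Finsupp.weight xiW s + 1 = m ∧ Finsupp.weight yW s + 1 = j
    · obtain ⟨c, hc⟩ := exists_expo_eq (m := m) (j := j)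
        (s := s + Finsupp.single (Sum.inl 0) 1 + Finsupp.single (Sum.inr 1) 1)
        (by rw [weight_add_single, weight_add_single]; simpa using hs.1)
        (by rw [weight_add_single, weight_add_single]; simpa using hs.2)
      obtain ⟨c', hc'⟩ := exists_expo_eq (m := m) (j := j)
        (s := s + Finsupp.single (Sum.inl 1) 1 + Finsupp.single (Sum.inr 0) 1)
        (by rw [weight_add_single, weight_add_single]; simpa using hs.1)
        (by rw [weight_add_single, weight_add_single]; simpa using hs.2)
      rw [← hc, ← hc', coeff_expo_arrPoly hA, coeff_expo_arrPoly hA, h c c', sub_self]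
      have a1 := DFunLike.congr_fun hc (Sum.inl 1)
      have a2 := DFunLike.congr_fun hc (Sum.inr 1)
      have a3 := DFunLike.congr_fun hc' (Sum.inl 1)
      have a4 := DFunLike.congr_fun hc' (Sum.inr 1)
      simp at a1 a2 a3 a4
      rw [ones_sum, ones_sum c']
      omega
    · rw [coeff_arrPoly_of_ne, coeff_arrPoly_of_ne, zero_mul, zero_mul, sub_self]
      all_goals
        rw [weight_add_single, weight_add_single, weight_add_single, weight_add_single]
        simpa using hs

theorem arrPoly_eq_zero_iff (hA : ∀ (π : Equiv.Perm (Fin m)) (ρ : Equiv.Perm (Fin j)) c,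
    A (c ∘ Equiv.sumCongr π ρ) = A c) : arrPoly A = 0 ↔ A = 0 := by
  refine ⟨fun h => funext fun c => ?_, fun h => by simp [h, arrPoly]⟩
  have h1 := coeff_expo_arrPoly hA c
  rw [h, coeff_zero, zero_mul, zero_eq_mul] at h1
  exact h1.resolve_left (mul_ne_zero (Nat.cast_ne_zero.2 m.factorial_ne_zero)
    (Nat.cast_ne_zero.2 j.factorial_ne_zero))

end Arr

theorem sum_part_eq {w : Fin 2 ⊕ Fin 2 → ℕ} {k : ℕ} {p : Poly} (h : WLe w k p) :
    ∑ m ∈ Finset.range (k + 1), part w m p = p := by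
  classical
  ext s
  rw [coeff_sum]
  simp only [coeff_weightedHomogeneousComponent]
  rw [Finset.sum_ite_eq]
  split_ifs with hs
  · rfl
  · by_contra h0
    have := h s (Ne.symm h0)
    simp at hs
    omega

/-! ### The symbol of a differential operator -/

section Bundle

variable {ι M : Type*} [TopologicalSpace M] [ChartedSpace Plane M]
  {A : MetaplecticStructure ι M} {w w' : ℝ} {k : ℕ}

theorem chart_mem_target (A : MetaplecticStructure ι M) {i j : ι} {x : Plane}
    (hx : x ∈ overlap (A.chart i) (A.chart j)) :
    x ∈ (A.chart i).target ∧ A.chart j ((A.chart i).symm x) ∈ (A.chart j).target := by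
  rw [overlap, OpenPartialHomeomorph.trans_source, OpenPartialHomeomorph.symm_source] at hx
  exact ⟨hx.1, (A.chart j).map_source hx.2⟩

theorem IsSection.congr {φ ψ : ι → Plane → Spinor} (h : IsSection A w φ)
    (hψ : SameSection A ψ φ) : IsSection A w ψ := by
  refine ⟨fun i => (h.smooth i).congr (A.chart i).open_target fun x hx => (hψ i x hx).symm,
    fun i j x hx => ?_⟩
  obtain ⟨h1, h2⟩ := chart_mem_target A hx
  rw [hψ i x h1, hψ j _ h2]
  exact h.compat i j x hx

namespace DiffOp

/-- The full Weyl symbol of a differential operator in a chart. -/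
def poly (P : DiffOp A w w' k) (i : ι) (x : Plane) : Poly :=
  ∑ m ∈ Finset.range (k + 1), ∑ j ∈ Finset.range (P.deg + 1), arrPoly (P.coeff i m j x)

/-- The expression in a chart of a differential operator. -/
def loc (P : DiffOp A w w' k) (i : ι) (f : Plane → Spinor) (x : Plane) : Spinor :=
  ∑ m ∈ Finset.range (k + 1), ∑ j ∈ Finset.range (P.deg + 1), ∑ c : Fin m ⊕ Fin j → Fin 2,
      P.coeff i m j x c • gammaProd (c ∘ Sum.inr) (pdIter m (c ∘ Sum.inl) f x)

theorem apply_eq_loc (P : DiffOp A w w' k) (φ : ι → Plane → Spinor) (i : ι) :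
    P.apply φ i = P.loc i (φ i) := rfl

theorem locSymb (P : DiffOp A w w' k) (i : ι) :
    LocSymb (A.chart i).target k P.deg (P.loc i) (P.poly i) := by
  classical
  refine ⟨fun s => ?_, fun x hx => ?_, fun x hx => ?_, fun U hU hUo f hf x hx => ?_⟩
  · refine LocSymb.smooth_sum (fun m _ => LocSymb.smooth_sum fun j _ =>
      LocSymb.smooth_sum fun c _ s => ?_) s
    simp only [coeff_monomial]
    split_ifs
    · exact P.coeff_smooth i m j c
    · exact contDiffOn_const
  · exact WLe.sum fun m hm => WLe.sum fun j _ => wLe_xiW_arrPoly.mono (by simp at hm; omega)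
  · exact WLe.sum fun m _ => WLe.sum fun j hj => wLe_yW_arrPoly.mono (by simp at hj; omega)
  · rw [poly, map_sum, loc]
    refine Finset.sum_congr rfl fun m _ => ?_
    rw [map_sum]
    exact Finset.sum_congr rfl fun j _ => sum_gammaProd_pdIter_eq_opAt hUo hf hx
      (P.coeff_symm i m j x (hU hx))

theorem part_poly (P : DiffOp A w w' k) (i : ι) (x : Plane) (j : ℕ) :
    part yW j (part xiW k (P.poly i x)) = arrPoly (P.symbol i x j) := by
  classical
  rw [poly, map_sum, map_sum, Finset.sum_eq_single_of_mem k (by simp) fun m _ hm => by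
    rw [map_sum, map_sum]
    refine Finset.sum_eq_zero fun j _ => ?_
    rw [part_xiW_arrPoly, if_neg hm, map_zero]]
  simp only [map_sum, part_xiW_arrPoly, if_true, part_yW_arrPoly]
  rw [Finset.sum_ite_eq']
  unfold symbol
  by_cases h : j ≤ P.deg
  · rw [if_pos (by simp; omega)]; simp [h]
  · rw [if_neg (by simp; omega)]; simp [h, arrPoly]

theorem symbol_symm (P : DiffOp A w w' k) {i : ι} {x : Plane} (hx : x ∈ (A.chart i).target)
    (j : ℕ) (π : Equiv.Perm (Fin k)) (ρ : Equiv.Perm (Fin j)) (c : Fin k ⊕ Fin j → Fin 2) :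
    P.symbol i x j (c ∘ Equiv.sumCongr π ρ) = P.symbol i x j c := by
  unfold symbol
  split_ifs
  · exact P.coeff_symm i k j x hx π ρ c
  · rfl

theorem symbol_eq_zero_iff (P : DiffOp A w w' k) {i : ι} {x : Plane}
    (hx : x ∈ (A.chart i).target) (j : ℕ) :
    P.symbol i x j = 0 ↔ part yW j (part xiW k (P.poly i x)) = 0 := by
  rw [part_poly, arrPoly_eq_zero_iff (P.symbol_symm hx j)]

theorem eq_zero_of_part_eq_zero {w : Fin 2 ⊕ Fin 2 → ℕ} {p : Poly} (h : ∀ j, part w j p = 0) :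
    p = 0 := by
  classical
  ext s
  have := congrArg (MvPolynomial.coeff s) (h (Finsupp.weight w s))
  rwa [coeff_weightedHomogeneousComponent, if_pos rfl] at this

theorem part_contr (p : Poly) (j : ℕ) : part yW j (contr p) = contr (part yW (j + 1) p) := by
  have h1 := part_pderiv yW j (Sum.inl 0) (pderiv (Sum.inr 1) p)
  have h2 := part_pderiv yW j (Sum.inl 1) (pderiv (Sum.inr 0) p)
  have h3 := part_pderiv yW j (Sum.inr 1) p
  have h4 := part_pderiv yW j (Sum.inr 0) p
  simp only [yW_inl, yW_inr, add_zero] at h1 h2 h3 h4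
  rw [contr_apply, contr_apply, map_sub, h1, h2, h3, h4]

theorem contr_part_zero (p : Poly) : contr (part yW 0 p) = 0 := by
  have h : ∀ a, pderiv (Sum.inr a) (part yW 0 p) = 0 := fun a => by
    classical
    ext s
    rw [coeff_pderiv, coeff_weightedHomogeneousComponent, weight_add_single, if_neg]
    · simp
    · simp
  rw [contr_apply, h, h]; simp

theorem contr_eq_zero_iff (p : Poly) : contr p = 0 ↔ ∀ j, contr (part yW j p) = 0 := by
  refine ⟨fun h j => ?_, fun h => eq_zero_of_part_eq_zero (w := yW) fun j => ?_⟩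
  · cases j with
    | zero => exact contr_part_zero p
    | succ j => rw [← part_contr, h, map_zero]
  · rw [part_contr, h]

/-- Total symmetry of all components becomes a single linear equation on the symbol of order `k`. -/
theorem hasCartanSymbol_iff (P : DiffOp A w w' k) : P.HasCartanSymbol ↔
    ∀ i, ∀ x ∈ (A.chart i).target, contr (part xiW k (P.poly i x)) = 0 := by
  refine forall_congr' fun i => forall₂_congr fun x hx => ?_
  rw [contr_eq_zero_iff]
  refine forall_congr' fun j => ?_
  rw [part_poly, contr_arrPoly_eq_zero_iff (P.symbol_symm hx j)]

/-- The differential operator with given local expressions. -/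
def ofLocSymb {N : ℕ} {L : ι → (Plane → Spinor) → Plane → Spinor} {p : ι → Plane → Poly}
    (h : ∀ i, LocSymb (A.chart i).target k N (L i) (p i))
    (hL : ∀ φ, IsSection A w φ → IsSection A w' fun i => L i (φ i)) : DiffOp A w w' k where
  deg := N
  coeff i m j x := toArr m j (p i x)
  coeff_smooth i m j c := by
    simp only [toArr, mul_div_assoc]
    exact ((h i).smooth _).mul contDiffOn_const
  coeff_symm i m j x _ := toArr_symm m j (p i x)
  map_section φ hφ := by
    refine (hL φ hφ).congr fun i x hx => ?_
    refine Eq.trans ?_ ((h i).act _ Subset.rfl (A.chart i).open_target _ (hφ.smooth i) x hx).symm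
    conv_rhs => rw [← sum_part_eq ((h i).xi x hx), map_sum]
    refine Finset.sum_congr rfl fun m _ => ?_
    conv_rhs => rw [← sum_part_eq ((h i).y x hx), map_sum, map_sum]
    refine Finset.sum_congr rfl fun j _ => ?_
    rw [sum_gammaProd_pdIter_eq_opAt (A.chart i).open_target (hφ.smooth i) hx
      (toArr_symm m j (p i x)), arrPoly_toArr]

section

variable {N : ℕ} {L : ι → (Plane → Spinor) → Plane → Spinor} {p : ι → Plane → Poly}
  (h : ∀ i, LocSymb (A.chart i).target k N (L i) (p i))
  (hL : ∀ φ, IsSection A w φ → IsSection A w' fun i => L i (φ i))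

theorem poly_ofLocSymb {i : ι} {x : Plane} (hx : x ∈ (A.chart i).target) :
    (ofLocSymb h hL).poly i x = p i x := by
  conv_rhs => rw [← sum_part_eq ((h i).xi x hx)]
  refine Finset.sum_congr rfl fun m _ => ?_
  conv_rhs => rw [← sum_part_eq ((h i).y x hx), map_sum]
  exact Finset.sum_congr rfl fun j _ => arrPoly_toArr m j (p i x)

theorem apply_ofLocSymb {φ : ι → Plane → Spinor} (hφ : IsSection A w φ) :
    SameSection A ((ofLocSymb h hL).apply φ) fun i => L i (φ i) := fun i x hx => by
  rw [apply_eq_loc, ((ofLocSymb h hL).locSymb i).act _ Subset.rfl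
    (A.chart i).open_target _ (hφ.smooth i) x hx,
    poly_ofLocSymb h hL hx]
  exact ((h i).act _ Subset.rfl (A.chart i).open_target _ (hφ.smooth i) x hx).symm

end

end DiffOp

end Bundle

end

section

open Filter Topology Set MvPolynomial

/-! ### Algebra of the symbol of the Dirac operator -/

/-- The principal symbol of the symplectic Dirac operator. -/
def diracSymb : Poly := X (Sum.inr 0) * X (Sum.inl 1) - X (Sum.inr 1) * X (Sum.inl 0)

/-- The polarization `ξ_a ∂/∂y_a`. -/
def polar (p : Poly) : Poly :=
  X (Sum.inl 0) * pderiv (Sum.inr 0) p + X (Sum.inl 1) * pderiv (Sum.inr 1) p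

/-- The action on principal symbols of the left composition with the Dirac operator. -/
def diracL (p : Poly) : Poly := gl 0 (X (Sum.inl 1) * p) - gl 1 (X (Sum.inl 0) * p)

/-- The action on principal symbols of the right composition with the Dirac operator. -/
def diracR (p : Poly) : Poly := X (Sum.inl 1) * gr 0 p - X (Sum.inl 0) * gr 1 p

/-- The Euler operator. -/
def euler (p : Poly) : Poly := ∑ i, X i * pderiv i p

theorem euler_apply (p : Poly) : euler p =
    X (Sum.inl 0) * pderiv (Sum.inl 0) p + X (Sum.inl 1) * pderiv (Sum.inl 1) p +
      (X (Sum.inr 0) * pderiv (Sum.inr 0) p + X (Sum.inr 1) * pderiv (Sum.inr 1) p) := by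
  rw [euler, Fintype.sum_sum_type, Fin.sum_univ_two, Fin.sum_univ_two]

theorem pderiv_comm (i j : Fin 2 ⊕ Fin 2) (p : Poly) :
    pderiv i (pderiv j p) = pderiv j (pderiv i p) := by
  ext s
  rw [coeff_pderiv, coeff_pderiv, coeff_pderiv, coeff_pderiv, add_right_comm]
  by_cases h : i = j
  · subst h; rfl
  · simp only [Finsupp.add_apply, Finsupp.single_apply, h, Ne.symm h, if_false, add_zero]
    ring

theorem pderiv_X_mul (i j : Fin 2 ⊕ Fin 2) (p : Poly) :
    pderiv i (X j * p) = X j * pderiv i p + if i = j then p else 0 := by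
  rw [Derivation.leibniz, smul_eq_mul, smul_eq_mul, pderiv_X]
  by_cases h : i = j
  · subst h; simp
  · simp [h]

/-- The terms with `ω` from the two gamma matrices combine into `polar`. Its sign is opposite for
composition on the right (`diracR_eq`), which is what makes symmetries restrictive. -/
theorem diracL_eq (p : Poly) : diracL p = diracSymb * p + polar p := by
  simp only [diracL, diracSymb, polar, gl_zero, gl_one, pderiv_X_mul, reduceCtorEq, if_false]
  ring

theorem diracR_eq (p : Poly) : diracR p = diracSymb * p - polar p := by
  simp only [diracR, diracSymb, polar, gr_zero, gr_one]
  ring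

/-- The `sl_2` relation: up to sign, the commutator of the contraction with multiplication by
`diracSymb` is the Euler operator shifted by `2`. -/
theorem contr_diracSymb_mul (p : Poly) :
    contr (diracSymb * p) = diracSymb * contr p - 2 * p - euler p := by
  have e : diracSymb * p = X (Sum.inr 0) * (X (Sum.inl 1) * p) -
      X (Sum.inr 1) * (X (Sum.inl 0) * p) := by rw [diracSymb]; ring
  rw [e, contr_apply, contr_apply, euler_apply, diracSymb]
  simp only [map_sub, map_add, pderiv_X_mul, reduceCtorEq, if_false, Sum.inr.injEq, Sum.inl.injEq,
    zero_ne_one, one_ne_zero, if_true, add_zero]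
  ring

theorem euler_pderiv (i : Fin 2 ⊕ Fin 2) (p : Poly) :
    euler (pderiv i p) = pderiv i (euler p) - pderiv i p := by
  simp only [euler, map_sum, pderiv_X_mul, Finset.sum_add_distrib, Finset.sum_ite_eq,
    Finset.mem_univ, if_true, add_sub_cancel_right]
  exact Finset.sum_congr rfl fun j _ => by rw [pderiv_comm]

theorem euler_contr (p : Poly) : euler (contr p) = contr (euler p) - 2 * contr p := by
  have h : ∀ i j, euler (pderiv i (pderiv j p)) =
      pderiv i (pderiv j (euler p)) - 2 * pderiv i (pderiv j p) := fun i j => by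
    rw [euler_pderiv, euler_pderiv, map_sub]; ring
  have hs : ∀ p q, euler (p - q) = euler p - euler q := fun p q => by
    simp [euler, map_sub, mul_sub, Finset.sum_sub_distrib]
  rw [contr_apply, hs, h, h, contr_apply]
  ring

/-- The commutator is `∂_{y_1} ∂_{y_0} - ∂_{y_0} ∂_{y_1}`, which vanishes. -/
theorem contr_polar (p : Poly) : contr (polar p) = polar (contr p) := by
  simp only [contr_apply, polar, map_add, map_sub, pderiv_X_mul, reduceCtorEq, if_false,
    Sum.inl.injEq, zero_ne_one, one_ne_zero, if_true, add_zero]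
  rw [pderiv_comm (Sum.inr 0) (Sum.inl 0), pderiv_comm (Sum.inr 1) (Sum.inl 0),
    pderiv_comm (Sum.inr 0) (Sum.inl 1), pderiv_comm (Sum.inr 1) (Sum.inl 1),
    pderiv_comm (Sum.inr 1) (Sum.inr 0)]
  ring

theorem euler_contr_iterate {n : ℂ} {p : Poly} (hp : euler p = n • p) (r : ℕ) :
    euler (contr^[r] p) = (n - 2 * r) • contr^[r] p := by
  induction r with
  | zero => simpa using hp
  | succ r ih =>
    rw [Function.iterate_succ_apply', euler_contr, ih, map_smul, smul_eq_C_mul, smul_eq_C_mul]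
    push_cast
    simp only [map_add, map_sub, map_mul, C_1, map_ofNat]
    ring

theorem contr_iterate_smul (r : ℕ) (c : ℂ) (p : Poly) : contr^[r] (c • p) = c • contr^[r] p := by
  induction r with
  | zero => rfl
  | succ r ih => rw [Function.iterate_succ_apply', Function.iterate_succ_apply', ih, map_smul]

/-- The Euler eigenvalue drops by two with each contraction, so the commutators contribute `n + 2 -
2 s` for `s = 0, …, r`, with sum `(r + 1) (n + 2 - r)`. -/
theorem contr_iterate_diracSymb_mul {n : ℂ} {p : Poly} (hp : euler p = n • p) (r : ℕ) :
    contr^[r + 1] (diracSymb * p) = diracSymb * contr^[r + 1] p -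
      ((r + 1) * (n + 2 - r) : ℂ) • contr^[r] p := by
  induction r with
  | zero =>
    simp only [zero_add, Function.iterate_one, Function.iterate_zero, id, contr_diracSymb_mul, hp]
    rw [smul_eq_C_mul, smul_eq_C_mul]
    simp only [map_add, map_sub, map_mul, Nat.cast_zero, C_0, C_1, map_ofNat]
    ring
  | succ r ih =>
    rw [Function.iterate_succ_apply', ih, map_sub, map_smul, contr_diracSymb_mul,
      euler_contr_iterate hp, ← Function.iterate_succ_apply' contr,
      ← Function.iterate_succ_apply' contr]
    rw [smul_eq_C_mul, smul_eq_C_mul, smul_eq_C_mul]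
    push_cast
    simp only [map_add, map_sub, map_mul, C_1, map_ofNat]
    ring

theorem WLe.pderiv_inl {k : ℕ} {p : Poly} (hp : WLe xiW (k + 1) p) (a : Fin 2) :
    WLe xiW k (MvPolynomial.pderiv (Sum.inl a) p) := fun s hs => by
  rw [coeff_pderiv] at hs
  have := hp _ (left_ne_zero_of_mul hs)
  rw [weight_add_single, xiW_inl] at this
  omega

theorem WLe.contr {k : ℕ} {p : Poly} (hp : WLe xiW (k + 1) p) :
    WLe xiW k (SymplecticSpinor.contr p) := by
  rw [contr_apply]
  exact ((hp.pderiv _).pderiv_inl _).sub ((hp.pderiv _).pderiv_inl _)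

theorem WLe.contr_eq_zero {p : Poly} (hp : WLe xiW 0 p) : SymplecticSpinor.contr p = 0 := by
  have h : ∀ (a : Fin 2) (q : Poly), WLe xiW 0 q → MvPolynomial.pderiv (Sum.inl a) q = 0 :=
    fun a q hq => by
      ext s
      by_contra h0
      have h1 : MvPolynomial.coeff (s + Finsupp.single (Sum.inl a) 1) q ≠ 0 := fun h => by
        simp [coeff_pderiv, h] at h0
      have := hq _ h1
      rw [weight_add_single, xiW_inl] at this
      omega
  rw [contr_apply, h _ _ (hp.pderiv _), h _ _ (hp.pderiv _), sub_zero]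

theorem WLe.contr_iterate_eq_zero {k : ℕ} {p : Poly} (hp : WLe xiW k p) {r : ℕ} (hr : k < r) :
    SymplecticSpinor.contr^[r] p = 0 := by
  induction k generalizing p r with
  | zero =>
    obtain ⟨r, rfl⟩ := Nat.exists_eq_succ_of_ne_zero hr.ne'
    rw [Function.iterate_succ_apply, hp.contr_eq_zero, iterate_map_zero]
  | succ k ih =>
    obtain ⟨r, rfl⟩ := Nat.exists_eq_succ_of_ne_zero (show r ≠ 0 by omega)
    rw [Function.iterate_succ_apply]
    exact ih hp.contr (by omega)

theorem sum_X_mul_pderiv_part_xiW (k : ℕ) (p : Poly) :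
    ∑ a, X (Sum.inl a) * pderiv (Sum.inl a) (part xiW k p) = (k : ℂ) • part xiW k p := by
  have h := (weightedHomogeneousComponent_isWeightedHomogeneous (w := xiW) k
    p).sum_weight_X_mul_pderiv
  rw [Fintype.sum_sum_type] at h
  simp only [xiW_inl, xiW_inr, one_smul, zero_smul, Finset.sum_const_zero, add_zero] at h
  rw [h, Nat.cast_smul_eq_nsmul]

theorem sum_X_mul_pderiv_part_yW (j : ℕ) (p : Poly) :
    ∑ a, X (Sum.inr a) * pderiv (Sum.inr a) (part yW j p) = (j : ℂ) • part yW j p := by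
  have h := (weightedHomogeneousComponent_isWeightedHomogeneous (w := yW) j
    p).sum_weight_X_mul_pderiv
  rw [Fintype.sum_sum_type] at h
  simp only [yW_inl, yW_inr, one_smul, zero_smul, Finset.sum_const_zero, zero_add] at h
  rw [h, Nat.cast_smul_eq_nsmul]

theorem part_comm (w w' : Fin 2 ⊕ Fin 2 → ℕ) (k j : ℕ) (p : Poly) :
    part w k (part w' j p) = part w' j (part w k p) := by
  classical
  ext s
  simp only [coeff_weightedHomogeneousComponent]
  split_ifs <;> rfl

theorem euler_part_part (k j : ℕ) (p : Poly) :
    euler (part yW j (part xiW k p)) = (k + j : ℂ) • part yW j (part xiW k p) := by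
  rw [euler, Fintype.sum_sum_type, sum_X_mul_pderiv_part_yW, part_comm, sum_X_mul_pderiv_part_xiW,
    add_smul]

theorem WLe.part {w w' : Fin 2 ⊕ Fin 2 → ℕ} {k : ℕ} {p : Poly} (hp : WLe w k p) (j : ℕ) :
    WLe w k (SymplecticSpinor.part w' j p) := by
  classical
  intro s hs
  rw [coeff_weightedHomogeneousComponent] at hs
  split_ifs at hs with h
  · exact hp s hs
  · exact absurd rfl hs

/-- Let `d` be the bihomogeneous polynomial. The iterated relation turns the vanishing of `contr^[r
+ 1] d` into that of `(r + 1) (k + j + 2 - r)` times `contr^[r] d`. This factor is nonzero for `r ≤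
k`, and `contr^[k + 1] d = 0` for degree reasons, so one descends to `d = 0`. -/
theorem eq_zero_of_contr_diracSymb_mul {k j : ℕ} {p : Poly}
    (h : contr (diracSymb * part yW j (part xiW k p)) = 0) : part yW j (part xiW k p) = 0 := by
  set d := part yW j (part xiW k p) with hd
  have hx : WLe xiW k d := wLe_part.part j
  have key : ∀ r, r ≤ k + 1 → contr^[r] d = 0 → d = 0 := by
    intro r
    induction r with
    | zero => intro _ h0; exact h0
    | succ r ih =>
      intro hr h0
      refine ih (by omega) ?_
      have h1 := contr_iterate_diracSymb_mul (euler_part_part k j p) r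
      rw [← hd, h0, Function.iterate_succ_apply, h, iterate_map_zero, mul_zero, zero_sub,
        eq_comm, neg_eq_zero, smul_eq_zero] at h1
      refine h1.resolve_left (mul_ne_zero (by exact_mod_cast Nat.succ_ne_zero r) ?_)
      have : (k + j + 2 - r : ℂ) = ((k + j + 2 - r : ℕ) : ℂ) := by
        rw [Nat.cast_sub (by omega)]; push_cast; ring
      rw [this]
      exact Nat.cast_ne_zero.2 (by omega)
  exact key (k + 1) le_rfl (hx.contr_iterate_eq_zero (Nat.lt_succ_self k))

theorem part_yW_diracSymb_mul (j : ℕ) (p : Poly) :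
    part yW (j + 1) (diracSymb * p) = diracSymb * part yW j p := by
  have h : ∀ a b : Fin 2, part yW (j + 1) (X (Sum.inr a) * (X (Sum.inl b) * p)) =
      X (Sum.inr a) * (X (Sum.inl b) * part yW j p) := fun a b => by
    have h1 := part_X_mul yW j (Sum.inr a) (X (Sum.inl b) * p)
    have h2 := part_X_mul yW j (Sum.inl b) p
    simp only [yW_inr, yW_inl, add_zero] at h1 h2
    rw [h1, h2]
  simp only [diracSymb, sub_mul, mul_assoc, map_sub, h]

theorem part_yW_zero_diracSymb_mul (p : Poly) : part yW 0 (diracSymb * p) = 0 := by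
  simp only [diracSymb, sub_mul, mul_assoc, map_sub]
  rw [part_zero_X_mul (by simp), part_zero_X_mul (by simp), sub_zero]

theorem part_yW_polar (j : ℕ) (p : Poly) : part yW j (polar p) = polar (part yW (j + 1) p) := by
  have h : ∀ a : Fin 2, part yW j (X (Sum.inl a) * pderiv (Sum.inr a) p) =
      X (Sum.inl a) * pderiv (Sum.inr a) (part yW (j + 1) p) := fun a => by
    have h1 := part_X_mul yW j (Sum.inl a) (pderiv (Sum.inr a) p)
    have h2 := part_pderiv yW j (Sum.inr a) p
    simp only [yW_inr, yW_inl, add_zero] at h1 h2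
    rw [h1, h2]
  simp only [polar, map_add, h]

theorem polar_zero : polar 0 = 0 := by simp [polar]

theorem polar_sub (p q : Poly) : polar (p - q) = polar p - polar q := by
  simp only [polar, map_sub]; ring

theorem diracSymb_ne_zero : diracSymb ≠ 0 := by
  intro h
  have h1 := congrArg (MvPolynomial.eval (Sum.elim ![0, 1] ![1, 0] : Fin 2 ⊕ Fin 2 → ℂ)) h
  simp [diracSymb] at h1

/-- A family vanishing for large indices vanishes if each member vanishes with the one two steps
above it. -/
theorem eq_zero_of_descent {d : ℕ → Poly} {N : ℕ} (hN : ∀ j, N < j → d j = 0)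
    (h : ∀ j, d (j + 2) = 0 → d j = 0) (j : ℕ) : d j = 0 := by
  have key : ∀ m j, N < j + m → d j = 0 := by
    intro m
    induction m with
    | zero => exact hN
    | succ m ih => exact fun j hj => h j (ih _ (by omega))
  exact key (N + 1) j (by omega)

/-- Multiplication by `diracSymb` raises the degree in `y` by one and `polar` lowers it by one, so
the component of degree `j` is tied to that of degree `j + 2`. Descent from large degrees applies
because the polynomials form a domain. -/
theorem eq_zero_of_diracR_eq_zero {N : ℕ} {p : Poly} (hN : WLe yW N p) (h : diracR p = 0) :
    p = 0 := by
  rw [diracR_eq, sub_eq_zero] at h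
  refine DiffOp.eq_zero_of_part_eq_zero (w := yW) (eq_zero_of_descent
    (fun j hj => hN.part_eq_zero hj) fun j hj => ?_)
  have h1 := congrArg (part yW (j + 1)) h
  rw [part_yW_diracSymb_mul, part_yW_polar, hj, polar_zero] at h1
  exact (mul_eq_zero.1 h1).resolve_left diracSymb_ne_zero

theorem part_yW_contr (p : Poly) (j : ℕ) : part yW j (contr p) = contr (part yW (j + 1) p) :=
  DiffOp.part_contr p j

/-- If a Cartan symbol is carried by the Dirac operator to a right multiple of it, its polarization
vanishes. -/
theorem polar_eq_zero_of_diracL_eq_diracR {k N : ℕ} {p q : Poly} (hp : WLe yW N p)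
    (hq : WLe yW N q) (h0 : contr (part xiW k p) = 0)
    (h : diracL (part xiW k p) = diracR (part xiW k q)) : polar (part xiW k p) = 0 := by
  -- With `d` the difference of the two symbols, the hypothesis reads `Q d = P d - 2 P σ`. The
  -- contraction commutes with `P` and kills `σ`, so `contr (Q d) = P (contr d)`. In degree `j` the
  -- right side involves only the component `j + 2` of `d`, and descent gives `d = 0`.
  have hd : part xiW k (p - q) = 0 := by
    refine DiffOp.eq_zero_of_part_eq_zero (w := yW) (eq_zero_of_descent
      (fun j hj => ((hp.sub hq).part k).part_eq_zero hj) fun j hj => ?_)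
    refine eq_zero_of_contr_diracSymb_mul ?_
    rw [diracL_eq, diracR_eq] at h
    have h1 : diracSymb * part xiW k (p - q) =
        polar (part xiW k (p - q)) - (polar (part xiW k p) + polar (part xiW k p)) := by
      rw [map_sub, polar_sub, mul_sub]
      linear_combination h
    have h2 := congrArg contr h1
    rw [contr.map_sub, contr.map_add, contr_polar, contr_polar, h0, polar_zero, add_zero,
      sub_zero] at h2
    have h3 := congrArg (part yW j) h2
    rw [part_yW_contr, part_yW_diracSymb_mul, part_yW_polar, part_yW_contr, hj, map_zero,
      polar_zero] at h3
    exact h3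
  rw [map_sub, sub_eq_zero] at hd
  rw [← hd, diracL_eq, diracR_eq, sub_eq_add_neg, add_right_inj, eq_neg_iff_add_eq_zero,
    ← two_mul] at h
  exact (mul_eq_zero.1 h).resolve_left two_ne_zero

/-- Capelli's identity. -/
theorem capelli (k : ℕ) (p : Poly) :
    (X (Sum.inr 0) * pderiv (Sum.inl 0) (polar (part xiW k p)) +
      X (Sum.inr 1) * pderiv (Sum.inl 1) (polar (part xiW k p))) =
    diracSymb * contr (part xiW k p) +
      (k + 1 : ℂ) • ∑ a, X (Sum.inr a) * pderiv (Sum.inr a) (part xiW k p) := by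
  -- Euler's identity in `ξ`, for the derivatives in `y` of a polynomial homogeneous of degree `k`
  -- in `ξ`.
  have h : ∀ a : Fin 2, X (Sum.inl 0) * pderiv (Sum.inl 0) (pderiv (Sum.inr a) (part xiW k p)) +
      X (Sum.inl 1) * pderiv (Sum.inl 1) (pderiv (Sum.inr a) (part xiW k p)) =
      C (k : ℂ) * pderiv (Sum.inr a) (part xiW k p) := fun a => by
    have h1 := part_pderiv xiW k (Sum.inr a) p
    simp only [xiW_inr, add_zero] at h1
    have h2 := sum_X_mul_pderiv_part_xiW k (pderiv (Sum.inr a) p)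
    rw [h1, Fin.sum_univ_two, smul_eq_C_mul] at h2
    exact h2
  rw [Fin.sum_univ_two, smul_eq_C_mul, map_add, C_1]
  simp only [contr_apply, polar, diracSymb, map_add, pderiv_X_mul, if_false,
    Sum.inl.injEq, zero_ne_one, one_ne_zero, if_true, add_zero]
  linear_combination X (Sum.inr 0) * h 0 + X (Sum.inr 1) * h 1

/-- When contraction and polarization both vanish, Capelli's identity for the component of degree
`j` reduces to `0 = (k + 1) j σ_j`. -/
theorem part_yW_eq_zero_of_polar_eq_zero {k j : ℕ} {p : Poly} (h0 : contr (part xiW k p) = 0)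
    (h : polar (part xiW k p) = 0) (hj : 1 ≤ j) : part yW j (part xiW k p) = 0 := by
  have h1 := capelli k (part yW j p)
  rw [part_comm xiW yW] at h1
  have h2 : contr (part yW j (part xiW k p)) = 0 := (DiffOp.contr_eq_zero_iff _).1 h0 j
  have h3 : polar (part yW j (part xiW k p)) = 0 := by
    obtain ⟨j, rfl⟩ := Nat.exists_eq_add_of_le' hj
    rw [← part_yW_polar, h, map_zero]
  rw [h2, h3, sum_X_mul_pderiv_part_yW, smul_smul] at h1
  simp only [map_zero, mul_zero, add_zero, zero_add] at h1
  refine (smul_eq_zero.1 h1.symm).resolve_left (mul_ne_zero ?_ ?_)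
  · exact_mod_cast Nat.succ_ne_zero k
  · exact Nat.cast_ne_zero.2 (by omega)

/-- The correction in degree `j` comes only from the components `j` and `j + 2`. If all components
above `j` are Cartan, only multiplication by `diracSymb` is left in degree `j`, and the degrees
above are unchanged. -/
theorem part_yW_diracR_contr (j : ℕ) (p : Poly) : part yW j (diracR (contr p)) =
    diracSymb * contr (part yW j p) - polar (contr (part yW (j + 2) p)) := by
  rw [diracR_eq, map_sub, part_yW_polar, part_yW_contr]
  cases j with
  | zero => rw [part_yW_zero_diracSymb_mul, DiffOp.contr_part_zero, mul_zero]
  | succ j => rw [part_yW_diracSymb_mul, part_yW_contr]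

/-- Adding a multiple of the right product of the contraction with the Dirac symbol lowers the
nilpotency order of the contraction on the leading non-Cartan component. -/
theorem exists_correction (k j r : ℕ) : ∃ c : ℂ, ∀ p : Poly,
    (∀ j', j < j' → contr (part yW j' (part xiW k p)) = 0) →
    contr^[r + 2] (part yW j (part xiW k p)) = 0 →
    (∀ j', j < j' → contr (part yW j' (part xiW k p + c • diracR (contr (part xiW k p)))) = 0) ∧
    contr^[r + 1] (part yW j (part xiW k p + c • diracR (contr (part xiW k p)))) = 0 := by
  -- The contracted component has Euler eigenvalue `k + j - 2`, so `contr^[r + 1]` of the correction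
  -- is `-(r + 1) (k + j - r)` times `contr^[r + 1]` of the component; `c` makes the two cancel. For
  -- `r ≥ k` no correction is needed, since `r + 1` contractions exceed the degree in `ξ`.
  refine ⟨if r < k then 1 / ((r + 1) * (k + j - r)) else 0, fun p h1 h2 => ⟨fun j' hj' => ?_, ?_⟩⟩
  · rw [map_add, map_smul, part_yW_diracR_contr, h1 j' hj', h1 (j' + 2) (by omega), mul_zero,
      polar_zero, sub_zero, smul_zero, add_zero, h1 j' hj']
  · rw [map_add, map_smul, part_yW_diracR_contr, h1 (j + 2) (by omega), polar_zero, sub_zero,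
      iterate_map_add, contr_iterate_smul]
    split_ifs with hr
    · have h3 : euler (contr (part yW j (part xiW k p))) =
          (k + j - 2 : ℂ) • contr (part yW j (part xiW k p)) := by
        simpa using euler_contr_iterate (euler_part_part k j p) 1
      have hk : ((k : ℂ) + j - r) ≠ 0 := by
        have : ((k : ℂ) + j - r) = ((k + j - r : ℕ) : ℂ) := by
          rw [Nat.cast_sub (by omega)]; push_cast; ring
        rw [this]
        exact Nat.cast_ne_zero.2 (by omega)
      have hr' : (r + 1 : ℂ) ≠ 0 := by exact_mod_cast Nat.succ_ne_zero r
      rw [contr_iterate_diracSymb_mul h3, ← Function.iterate_succ_apply,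
        ← Function.iterate_succ_apply, h2, mul_zero, zero_sub, smul_neg, smul_smul]
      rw [show 1 / (((r : ℂ) + 1) * (k + j - r)) * ((r + 1) * (k + j - 2 + 2 - r)) = 1 by
        rw [sub_add_cancel]; field_simp]
      rw [one_smul, add_neg_cancel]
    · rw [zero_smul, add_zero]
      exact (wLe_part.part j).contr_iterate_eq_zero (by omega)

end

section

open Filter Topology Set MvPolynomial

/-! ### Coordinate changes -/

section Bundle

variable {ι M : Type*} [TopologicalSpace M] [ChartedSpace Plane M]

namespace MetaplecticStructure

variable (A : MetaplecticStructure ι M)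

/-- The coordinate change from chart `i` to chart `j`. -/
def tau (i j : ι) (x : Plane) : Plane := A.chart j ((A.chart i).symm x)

/-- The coordinates in chart `i` of a subset of `M`. -/
def dom (i : ι) (Ω : Set M) : Set Plane := (A.chart i).target ∩ (A.chart i).symm ⁻¹' Ω

/-- The overlap of two charts. -/
abbrev lap (i j : ι) : Set Plane := overlap (A.chart i) (A.chart j)

/-- The Jacobian matrix of a coordinate change. -/
abbrev jac (i j : ι) (x : Plane) : Matrix (Fin 2) (Fin 2) ℝ := jacobian (A.chart i) (A.chart j) x

/-- The Jacobian matrix of a coordinate change, rescaled to determinant one. -/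
abbrev uni (i j : ι) (x : Plane) : Matrix (Fin 2) (Fin 2) ℝ :=
  unimodularJacobian (A.chart i) (A.chart j) x

variable {A} {i j l : ι} {x : Plane}

theorem mem_lap : x ∈ A.lap i j ↔
    x ∈ (A.chart i).target ∧ (A.chart i).symm x ∈ (A.chart j).source := by
  rw [lap, overlap, OpenPartialHomeomorph.trans_source, OpenPartialHomeomorph.symm_source]
  rfl

theorem lap_eq_dom : A.lap i j = A.dom i (A.chart j).source := by
  ext x; exact mem_lap

theorem isOpen_dom {Ω : Set M} (hΩ : IsOpen Ω) : IsOpen (A.dom i Ω) :=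
  (A.chart i).isOpen_inter_preimage_symm hΩ

theorem isOpen_lap : IsOpen (A.lap i j) := (A.chart i |>.symm.trans (A.chart j)).open_source

theorem dom_univ : A.dom i univ = (A.chart i).target := by simp [dom]

theorem dom_subset {Ω : Set M} : A.dom i Ω ⊆ (A.chart i).target := inter_subset_left

theorem lap_subset : A.lap i j ⊆ (A.chart i).target := fun _ hx => (mem_lap.1 hx).1

theorem symm_tau (hx : x ∈ A.lap i j) :
    (A.chart j).symm (A.tau i j x) = (A.chart i).symm x :=
  (A.chart j).left_inv (mem_lap.1 hx).2

theorem tau_mem (hx : x ∈ A.lap i j) : A.tau i j x ∈ A.lap j i := by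
  refine mem_lap.2 ⟨(A.chart j).map_source (mem_lap.1 hx).2, ?_⟩
  rw [symm_tau hx]
  exact (A.chart i).map_target (mem_lap.1 hx).1

theorem tau_comp (hx : x ∈ A.lap i j) : A.tau j l (A.tau i j x) = A.tau i l x := by
  rw [tau, symm_tau hx]; rfl

theorem tau_mem_lap (hx : x ∈ A.lap i j) (hl : x ∈ A.lap i l) : A.tau i j x ∈ A.lap j l := by
  refine mem_lap.2 ⟨(A.chart j).map_source (mem_lap.1 hx).2, ?_⟩
  rw [symm_tau hx]
  exact (mem_lap.1 hl).2

theorem tau_self (hx : x ∈ (A.chart i).target) : A.tau i i x = x := (A.chart i).right_inv hx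

theorem tau_tau (hx : x ∈ A.lap i j) : A.tau j i (A.tau i j x) = x := by
  rw [tau_comp hx, tau_self (mem_lap.1 hx).1]

theorem lap_self : A.lap i i = (A.chart i).target := by
  ext x
  exact ⟨fun h => (mem_lap.1 h).1, fun h => mem_lap.2 ⟨h, (A.chart i).map_target h⟩⟩

theorem contDiffOn_tau [IsManifold 𝓘(ℝ, Plane) ∞ M] :
    ContDiffOn ℝ ∞ (A.tau i j) (A.lap i j) := by
  rw [← contMDiffOn_iff_contDiffOn]
  refine (contMDiffOn_of_mem_maximalAtlas (A.chart_mem j)).comp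
    ((contMDiffOn_symm_of_mem_maximalAtlas (A.chart_mem i)).mono lap_subset) fun x hx => ?_
  exact (mem_lap.1 hx).2

/-! ### Jacobians, their determinants and their composition laws -/

section Smooth

variable [IsManifold 𝓘(ℝ, Plane) ∞ M]

theorem hasFDerivAt_tau (hx : x ∈ A.lap i j) :
    HasFDerivAt (A.tau i j) (fderiv ℝ (A.tau i j) x) x :=
  ((contDiffOn_tau.contDiffAt (isOpen_lap.mem_nhds hx)).differentiableAt (by simp)).hasFDerivAt

omit [IsManifold 𝓘(ℝ, Plane) ∞ M] in
theorem fderiv_tau_apply (v : Plane) (c : Fin 2) :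
    (fderiv ℝ (A.tau i j) x v) c = ∑ b, A.jac i j x c b * v b := by
  conv_lhs => rw [plane_eq_add v]
  rw [map_add, map_smul, map_smul, Fin.sum_univ_two]
  simp only [jacobian, Matrix.of_apply, PiLp.add_apply, PiLp.smul_apply, smul_eq_mul]
  rw [mul_comm, mul_comm (v 1)]
  rfl

theorem jac_comp (hj : x ∈ A.lap i j) (hl : x ∈ A.lap i l) :
    A.jac i l x = A.jac j l (A.tau i j x) * A.jac i j x := by
  have h1 := (hasFDerivAt_tau (tau_mem_lap hj hl)).comp x (hasFDerivAt_tau hj)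
  have h2 : A.tau j l ∘ A.tau i j =ᶠ[𝓝 x] A.tau i l :=
    Filter.mem_of_superset (isOpen_lap.mem_nhds hj) fun y hy => tau_comp hy
  have h3 := (h1.congr_of_eventuallyEq h2.symm).fderiv
  ext c b
  rw [Matrix.mul_apply]
  have h4 := fderiv_tau_apply (A := A) (i := j) (j := l) (x := A.tau i j x)
    (fderiv ℝ (A.tau i j) x (stdVec b)) c
  exact (congrArg (fun v : Plane => v c) (DFunLike.congr_fun h3 (stdVec b))).trans h4

omit [IsManifold 𝓘(ℝ, Plane) ∞ M] in
theorem jac_self (hx : x ∈ (A.chart i).target) : A.jac i i x = 1 := by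
  have h : A.tau i i =ᶠ[𝓝 x] id :=
    Filter.mem_of_superset ((A.chart i).open_target.mem_nhds hx) fun y hy => tau_self hy
  ext c b
  change (fderiv ℝ (A.tau i i) x (stdVec b)) c = _
  rw [h.fderiv_eq, fderiv_id]
  simp [stdVec, Matrix.one_apply]

theorem contDiffOn_jac (c b : Fin 2) :
    ContDiffOn ℝ ∞ (fun x => A.jac i j x c b) (A.lap i j) :=
  (EuclideanSpace.proj c : Plane →L[ℝ] ℝ).contDiff.comp_contDiffOn
    (contDiffOn_fderiv_apply isOpen_lap contDiffOn_tau (stdVec b))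

theorem contDiffOn_det_jac : ContDiffOn ℝ ∞ (fun x => (A.jac i j x).det) (A.lap i j) := by
  simp only [Matrix.det_fin_two]
  exact ((contDiffOn_jac 0 0).mul (contDiffOn_jac 1 1)).sub
    ((contDiffOn_jac 0 1).mul (contDiffOn_jac 1 0))

omit [IsManifold 𝓘(ℝ, Plane) ∞ M] in
theorem det_jac_pos (hx : x ∈ A.lap i j) : 0 < (A.jac i j x).det := A.oriented i j x hx

theorem contDiffOn_det_jac_rpow (r : ℝ) :
    ContDiffOn ℝ ∞ (fun x => (A.jac i j x).det ^ r) (A.lap i j) :=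
  contDiffOn_det_jac.rpow_const_of_ne fun _ hx => (det_jac_pos hx).ne'

theorem contDiffOn_ofReal {f : Plane → ℝ} {V : Set Plane} (hf : ContDiffOn ℝ ∞ f V) :
    ContDiffOn ℝ ∞ (fun x => (f x : ℂ)) V :=
  Complex.ofRealCLM.contDiff.comp_contDiffOn hf

theorem det_rpow_comp (hj : x ∈ A.lap i j) (hl : x ∈ A.lap i l) (r : ℝ) :
    (A.jac i l x).det ^ r = (A.jac j l (A.tau i j x)).det ^ r * (A.jac i j x).det ^ r := by
  rw [jac_comp hj hl, Matrix.det_mul,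
    Real.mul_rpow (det_jac_pos (tau_mem_lap hj hl)).le (det_jac_pos hj).le]

theorem uni_comp (hj : x ∈ A.lap i j) (hl : x ∈ A.lap i l) :
    A.uni i l x = A.uni j l (A.tau i j x) * A.uni i j x := by
  change (A.jac i l x).det ^ (-(1 / 2) : ℝ) • A.jac i l x = _
  rw [det_rpow_comp hj hl, jac_comp hj hl, ← smul_mul_smul_comm]
  rfl

omit [IsManifold 𝓘(ℝ, Plane) ∞ M] in
theorem det_uni (hx : x ∈ A.lap i j) : (A.uni i j x).det = 1 := by
  rw [uni, unimodularJacobian, Matrix.det_smul, Fintype.card_fin, ← Real.rpow_natCast,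
    ← Real.rpow_mul (det_jac_pos hx).le]
  norm_num
  rw [Real.rpow_neg_one, inv_mul_cancel₀ (det_jac_pos hx).ne']

theorem contDiffOn_uni (c b : Fin 2) : ContDiffOn ℝ ∞ (fun x => A.uni i j x c b) (A.lap i j) := by
  simp only [uni, unimodularJacobian, Matrix.smul_apply, smul_eq_mul]
  exact (contDiffOn_det_jac_rpow _).mul (contDiffOn_jac c b)

-- The cocycle condition makes this lift idempotent, and it is invertible.
omit [IsManifold 𝓘(ℝ, Plane) ∞ M] in
theorem lift_self (hx : x ∈ (A.chart i).target) (f : Spinor) : A.lift i i x f = f := by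
  rw [← lap_self] at hx
  have h := A.cocycle i i i x hx hx f
  have e : A.chart i ((A.chart i).symm x) = x := (A.chart i).right_inv (mem_lap.1 hx).1
  rw [e] at h
  exact (A.lift i i x).injective h

/-! ### Transport of spinor fields between charts -/

variable (A) in
/-- The expression in chart `j` of a spinor field of weight `w` given in chart `i`. -/
def tr (w : ℝ) (i j : ι) (f : Plane → Spinor) (y : Plane) : Spinor :=
  (((A.jac i j (A.tau j i y)).det ^ (w / 3) : ℝ) : ℂ) •
    A.lift i j (A.tau j i y) (f (A.tau j i y))

variable (A) in
/-- The coordinates in chart `j` of a set given in chart `i`. -/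
def img (i j : ι) (U : Set Plane) : Set Plane := A.lap j i ∩ A.tau j i ⁻¹' U

theorem isOpen_img {U : Set Plane} (hU : IsOpen U) : IsOpen (A.img i j U) :=
  (contDiffOn_tau.continuousOn).isOpen_inter_preimage isOpen_lap hU

omit [IsManifold 𝓘(ℝ, Plane) ∞ M] in
theorem tau_mem_img {U : Set Plane} (hx : x ∈ A.lap i j) (hU : x ∈ U) :
    A.tau i j x ∈ A.img i j U :=
  ⟨tau_mem hx, by rw [mem_preimage, tau_tau hx]; exact hU⟩

omit [IsManifold 𝓘(ℝ, Plane) ∞ M] in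
theorem tr_tau {w : ℝ} {f : Plane → Spinor} (hx : x ∈ A.lap i j) :
    A.tr w i j f (A.tau i j x) =
      (((A.jac i j x).det ^ (w / 3) : ℝ) : ℂ) • A.lift i j x (f x) := by
  rw [tr, tau_tau hx]

omit [IsManifold 𝓘(ℝ, Plane) ∞ M] in
theorem img_subset_dom {U : Set Plane} {Ω : Set M} (hU : U ⊆ A.dom i Ω) :
    A.img i j U ⊆ A.dom j Ω := fun y hy => by
  refine ⟨lap_subset hy.1, ?_⟩
  have := (hU hy.2).2
  rwa [mem_preimage, symm_tau hy.1] at this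

theorem smoothOn_tr {w : ℝ} {f : Plane → Spinor} {U : Set Plane} (hU : IsOpen U)
    (hUi : U ⊆ A.lap i j) (hf : SmoothOn f U) : SmoothOn (A.tr w i j f) (A.img i j U) := by
  have h1 : SmoothOn (fun x => (((A.jac i j x).det ^ (w / 3) : ℝ) : ℂ) • A.lift i j x (f x)) U :=
    ((A.lift_smooth i j U hUi hU f hf).1).smul hU
      (contDiffOn_ofReal ((contDiffOn_det_jac_rpow _).mono hUi))
  exact h1.comp hU (isOpen_img hU) (contDiffOn_tau.mono inter_subset_left) fun y hy => hy.2

end Smooth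

end MetaplecticStructure

open MetaplecticStructure

variable {A : MetaplecticStructure ι M} {w w' w'' : ℝ}

theorem IsSection.eq_tr {φ : ι → Plane → Spinor} (hφ : IsSection A w φ) (i j : ι) :
    EqOn (φ j) (A.tr w i j (φ i)) (A.lap j i) := fun y hy => by
  have h := hφ.compat i j (A.tau j i y) (tau_mem hy)
  rw [tr, ← h]
  exact congrArg (φ j) (tau_tau hy).symm

variable (A w w') in
/-- A family of local operators that commute with the coordinate changes over an open set. -/
structure Equivar (Ω : Set M) (L : ι → (Plane → Spinor) → Plane → Spinor) : Prop where
  smooth : ∀ i U, IsOpen U → U ⊆ A.dom i Ω → ∀ f, SmoothOn f U → SmoothOn (L i f) U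
  eqOn : ∀ i U, IsOpen U → U ⊆ A.dom i Ω → ∀ f g, SmoothOn f U → EqOn f g U →
    EqOn (L i f) (L i g) U
  tr : ∀ i j U, IsOpen U → U ⊆ A.lap i j → U ⊆ A.dom i Ω → ∀ f, SmoothOn f U → ∀ x ∈ U,
    L j (A.tr w i j f) (A.tau i j x) =
      (((A.jac i j x).det ^ (w' / 3) : ℝ) : ℂ) • A.lift i j x (L i f x)

namespace Equivar

variable [IsManifold 𝓘(ℝ, Plane) ∞ M] {Ω : Set M} {L L' : ι → (Plane → Spinor) → Plane → Spinor}

omit [IsManifold 𝓘(ℝ, Plane) ∞ M] in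
theorem mono (h : Equivar A w w' Ω L) {Ω' : Set M} (hΩ : Ω' ⊆ Ω) : Equivar A w w' Ω' L := by
  have hd : ∀ i, A.dom i Ω' ⊆ A.dom i Ω := fun i => inter_subset_inter_right _ (preimage_mono hΩ)
  exact ⟨fun i U hU hUi => h.smooth i U hU (hUi.trans (hd i)),
    fun i U hU hUi => h.eqOn i U hU (hUi.trans (hd i)),
    fun i j U hU hUj hUi => h.tr i j U hU hUj (hUi.trans (hd i))⟩

theorem comp (h' : Equivar A w' w'' Ω L') (h : Equivar A w w' Ω L) :
    Equivar A w w'' Ω fun i f => L' i (L i f) := by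
  refine ⟨fun i U hU hUi f hf => h'.smooth i U hU hUi _ (h.smooth i U hU hUi f hf),
    fun i U hU hUi f g hf hfg => h'.eqOn i U hU hUi _ _ (h.smooth i U hU hUi f hf)
      (h.eqOn i U hU hUi f g hf hfg), fun i j U hU hUj hUi f hf x hx => ?_⟩
  have h1 : EqOn (L j (A.tr w i j f)) (A.tr w' i j (L i f)) (A.img i j U) := fun y hy => by
    have h2 := h.tr i j U hU hUj hUi f hf (A.tau j i y) hy.2
    rwa [tau_tau hy.1] at h2
  rw [h'.eqOn j _ (isOpen_img hU) (img_subset_dom hUi) _ _ (h.smooth j _ (isOpen_img hU)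
    (img_subset_dom hUi) _ (smoothOn_tr hU hUj hf)) h1 (tau_mem_img (hUj hx) hx)]
  exact h'.tr i j U hU hUj hUi _ (h.smooth i U hU hUi f hf) x hx

omit [IsManifold 𝓘(ℝ, Plane) ∞ M] in
theorem add (h : Equivar A w w' Ω L) (h' : Equivar A w w' Ω L') :
    Equivar A w w' Ω fun i f x => L i f x + L' i f x :=
  ⟨fun i U hU hUi f hf => (h.smooth i U hU hUi f hf).add hU (h'.smooth i U hU hUi f hf),
    fun i U hU hUi f g hf hfg x hx => congrArg₂ (· + ·) (h.eqOn i U hU hUi f g hf hfg hx)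
      (h'.eqOn i U hU hUi f g hf hfg hx),
    fun i j U hU hUj hUi f hf x hx => by
      rw [h.tr i j U hU hUj hUi f hf x hx, h'.tr i j U hU hUj hUi f hf x hx, map_add, smul_add]⟩

omit [IsManifold 𝓘(ℝ, Plane) ∞ M] in
theorem const_smul (h : Equivar A w w' Ω L) (c : ℂ) :
    Equivar A w w' Ω fun i f x => c • L i f x :=
  ⟨fun i U hU hUi f hf => (h.smooth i U hU hUi f hf).smul hU contDiffOn_const,
    fun i U hU hUi f g hf hfg x hx => congrArg (c • ·) (h.eqOn i U hU hUi f g hf hfg hx),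
    fun i j U hU hUj hUi f hf x hx => by
      rw [h.tr i j U hU hUj hUi f hf x hx, map_smul, smul_comm]⟩

omit [IsManifold 𝓘(ℝ, Plane) ∞ M] in
theorem sub (h : Equivar A w w' Ω L) (h' : Equivar A w w' Ω L') :
    Equivar A w w' Ω fun i f x => L i f x - L' i f x := by
  simpa [sub_eq_add_neg] using h.add (h'.const_smul (-1))

omit [IsManifold 𝓘(ℝ, Plane) ∞ M] in
theorem isSection (h : Equivar A w w' univ L) {φ : ι → Plane → Spinor} (hφ : IsSection A w φ) :
    IsSection A w' fun i => L i (φ i) := by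
  have hd : ∀ i, (A.chart i).target ⊆ A.dom i univ := fun i => dom_univ.ge
  refine ⟨fun i => h.smooth i _ (A.chart i).open_target (hd i) _ (hφ.smooth i),
    fun i j x hx => ?_⟩
  have h1 := h.eqOn j _ isOpen_lap (lap_subset.trans (hd j)) _ _
    ((hφ.smooth j).mono lap_subset) (hφ.eq_tr i j) (tau_mem hx)
  exact h1.trans (h.tr i j _ isOpen_lap Subset.rfl (lap_subset.trans (hd i)) _
    ((hφ.smooth i).mono lap_subset) x hx)

end Equivar

/-! ### Extension of germs of sections -/

section Extension

variable [IsManifold 𝓘(ℝ, Plane) ∞ M] [T2Space M]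

omit [IsManifold 𝓘(ℝ, Plane) ∞ M] [T2Space M] in
theorem contDiffOn_comp_symm {χ : M → ℝ} (hχ : ContMDiff 𝓘(ℝ, Plane) 𝓘(ℝ, ℝ) ∞ χ) (i : ι) :
    ContDiffOn ℝ ∞ (fun x => χ ((A.chart i).symm x)) (A.chart i).target := by
  rw [← contMDiffOn_iff_contDiffOn]
  exact hχ.comp_contMDiffOn (contMDiffOn_symm_of_mem_maximalAtlas (A.chart_mem i))

omit [IsManifold 𝓘(ℝ, Plane) ∞ M] [T2Space M] in
theorem isOpen_symm_preimage_compl_tsupport (χ : M → ℝ) (i : ι) :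
    IsOpen (A.dom i (tsupport χ)ᶜ) :=
  isOpen_dom (isClosed_tsupport χ).isOpen_compl

/-- Every germ of a smooth section extends to a global section. -/
theorem exists_section_eqOn {i : ι} {U : Set Plane} (hU : IsOpen U) (hUi : U ⊆ (A.chart i).target)
    {f : Plane → Spinor} (hf : SmoothOn f U) {x : Plane} (hx : x ∈ U) :
    ∃ φ, IsSection A w φ ∧ ∃ V ⊆ U, IsOpen V ∧ x ∈ V ∧ EqOn (φ i) f V := by
  classical
  set e := A.chart i with he
  have hW : e.source ∩ e ⁻¹' U ∈ 𝓝 (e.symm x) := by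
    refine (e.isOpen_inter_preimage hU).mem_nhds ⟨e.map_target (hUi hx), ?_⟩
    rw [mem_preimage, e.right_inv (hUi hx)]; exact hx
  obtain ⟨χ, -, hχ⟩ := (SmoothBumpFunction.nhds_basis_tsupport (I := 𝓘(ℝ, Plane))
    (e.symm x)).mem_iff.1 hW
  have hχs := χ.contMDiff
  -- The germ is multiplied by a bump function equal to `1` near the point and supported in `U`,
  -- then extended by zero over the chart `i`.
  set g : Plane → Spinor := fun y => ((χ (e.symm y) : ℝ) : ℂ) • f y with hg
  have hg0 : ∀ y, e.symm y ∉ tsupport χ → g y = 0 := fun y hy => by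
    simp [hg, image_eq_zero_of_notMem_tsupport hy]
  have hgs : SmoothOn g e.target := by
    refine smoothOn_of_locally fun y hy => ?_
    by_cases hyU : y ∈ U
    · exact ⟨U, hU, hyU, hf.smul hU
        (contDiffOn_ofReal ((contDiffOn_comp_symm hχs i).mono hUi))⟩
    · refine ⟨A.dom i (tsupport χ)ᶜ, isOpen_symm_preimage_compl_tsupport _ i, ⟨hy, fun h => ?_⟩,
        (smoothOn_const _ 0).congr (isOpen_symm_preimage_compl_tsupport _ i) fun z hz =>
          (hg0 z hz.2).symm⟩
      have := (hχ h).2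
      rw [mem_preimage, e.right_inv hy] at this
      exact hyU this
  have h0 : ∀ j y, (A.chart j).symm y ∉ tsupport χ → y ∈ A.lap j i → A.tr w i j g y = 0 :=
    fun j y hy hl => by
      rw [tr, hg0, map_zero, smul_zero]
      exact fun h => hy ((symm_tau hl) ▸ h)
  -- In every other chart the section is the transport of `g` where the charts overlap and zero
  -- elsewhere. It is smooth across the boundary of the overlap because the bump function is
  -- supported inside the domain of the chart `i`.
  refine ⟨fun j y => if y ∈ A.lap j i then A.tr w i j g y else 0, ⟨fun j => ?_, fun j l y hy => ?_⟩,
    ?_⟩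
  · refine smoothOn_of_locally fun y hy => ?_
    by_cases hl : y ∈ A.lap j i
    · have himg : A.img i j (A.lap i j) = A.lap j i :=
        Subset.antisymm inter_subset_left fun z hz => ⟨hz, tau_mem hz⟩
      have h1 := smoothOn_tr (w := w) isOpen_lap (Subset.rfl : A.lap i j ⊆ _)
        (hgs.mono lap_subset)
      rw [himg] at h1
      exact ⟨A.lap j i, isOpen_lap, hl, h1.congr isOpen_lap fun z hz => (if_pos hz).symm⟩
    · refine ⟨A.dom j (tsupport χ)ᶜ, isOpen_symm_preimage_compl_tsupport _ j, ⟨hy, fun h => ?_⟩,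
        (smoothOn_const _ 0).congr (isOpen_symm_preimage_compl_tsupport _ j) fun z hz => ?_⟩
      · exact hl (mem_lap.2 ⟨hy, (hχ h).1⟩)
      · change 0 = ite _ _ _
        split_ifs with hz'
        · exact (h0 j z hz.2 hz').symm
        · rfl
  · change ite (A.tau j l y ∈ A.lap l i) _ _ = _
    by_cases hl : y ∈ A.lap j i
    · have h1 : A.tau j l y ∈ A.lap l i := tau_mem_lap hy hl
      rw [if_pos hl, if_pos h1]
      have e1 : A.tau l i (A.tau j l y) = A.tau j i y := tau_comp hy
      have hz : A.tau j i y ∈ A.lap i j := tau_mem hl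
      have hzl : A.tau j i y ∈ A.lap i l := tau_mem_lap hl hy
      -- Both expressions arise by transport from the chart `i`; the cocycle condition and the
      -- multiplicativity of the determinant make them agree.
      have hc := A.cocycle i j l _ hz hzl (g (A.tau j i y))
      have hd := det_rpow_comp hz hzl (w / 3)
      change A.lift j l (A.tau i j (A.tau j i y)) _ = _ at hc
      rw [tau_tau hl] at hc hd
      change A.tr w i l g (A.tau j l y) = _
      rw [tr, tr, e1, ← hc, hd, Complex.ofReal_mul, mul_smul]
      exact congrArg _ ((A.lift j l y).map_smul _ _).symm
    · have h1 : A.tau j l y ∉ A.lap l i := fun h => hl <| by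
        have := tau_mem_lap (tau_mem hy) h
        rwa [tau_tau hy] at this
      rw [if_neg hl, if_neg h1, map_zero, smul_zero]
  · have hc : Tendsto e.symm (𝓝 x) (𝓝 (e.symm x)) :=
      e.symm.continuousAt (by simpa using hUi hx)
    have h1 := hc.eventually χ.eventuallyEq_one
    obtain ⟨V, hV, hVo, hxV⟩ := mem_nhds_iff.1 (Filter.inter_mem h1 (hU.mem_nhds hx))
    refine ⟨V, fun y hy => (hV hy).2, hVo, hxV, fun y hy => ?_⟩
    have hyt : y ∈ (A.chart i).target := hUi (hV hy).2
    have h2 : χ (e.symm y) = 1 := (hV hy).1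
    change ite _ _ _ = _
    rw [if_pos (lap_self.ge hyt), tr, tau_self hyt, lift_self hyt, jac_self hyt]
    simp [hg, h2]

/-- `DiffOp` only requires global sections to be mapped to sections. As germs extend to global
sections and the operator is local, the transformation law holds for locally defined fields too. -/
theorem DiffOp.equivar {k : ℕ} (P : DiffOp A w w' k) : Equivar A w w' univ P.loc := by
  refine ⟨fun i U hU hUi f hf => (P.locSymb i).smoothOn (hUi.trans dom_subset) hU hf,
    fun i U hU hUi f g hf hfg => (P.locSymb i).eqOn (hUi.trans dom_subset) hU hf hfg,
    fun i j U hU hUj hUi f hf x hx => ?_⟩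
  obtain ⟨φ, hφ, V, hVU, hV, hxV, hE⟩ := exists_section_eqOn (w := w) hU (hUi.trans dom_subset) hf hx
  have h1 := (P.map_section φ hφ).compat i j x (hUj hx)
  have hVt : V ⊆ (A.chart i).target := hVU.trans (hUi.trans dom_subset)
  have h2 : P.loc i (φ i) x = P.loc i f x :=
    (P.locSymb i).eqOn hVt hV ((hφ.smooth i).mono hVt) hE hxV
  have hsub : A.img i j V ⊆ (A.chart j).target := fun y hy => lap_subset hy.1
  have h3 : P.loc j (φ j) (A.tau i j x) = P.loc j (A.tr w i j f) (A.tau i j x) := by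
    refine (P.locSymb j).eqOn hsub (isOpen_img hV) ((hφ.smooth j).mono hsub) (fun y hy => ?_)
      (tau_mem_img (hUj hx) hxV)
    rw [hφ.eq_tr i j hy.1, tr, tr, hE hy.2]
  rw [← h3, ← h2]
  exact h1

end Extension

end Bundle

end

section

open Filter Topology Set MvPolynomial

/-! ### Coordinate vector fields -/

section Coord

variable {M : Type*} [TopologicalSpace M] [ChartedSpace Plane M] [IsManifold 𝓘(ℝ, Plane) ∞ M]
  {e e' : OpenPartialHomeomorph M Plane}

theorem contMDiffOn_coordField (he : e ∈ IsManifold.maximalAtlas 𝓘(ℝ, Plane) ∞ M) (b : Fin 2) :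
    ContMDiffOn 𝓘(ℝ, Plane) 𝓘(ℝ, Plane).tangent ∞
      (fun p => (⟨p, coordField e b p⟩ : TangentBundle 𝓘(ℝ, Plane) M)) e.source := by
  have h1 := (contMDiffOn_symm_of_mem_maximalAtlas he).contMDiffOn_tangentMapWithin
    (m := ∞) (by simp) e.open_target.uniqueMDiffOn
  have h2 : ContMDiff 𝓘(ℝ, Plane) 𝓘(ℝ, Plane).tangent ∞
      (fun x : Plane => (⟨x, stdVec b⟩ : TangentBundle 𝓘(ℝ, Plane) Plane)) :=
    contMDiff_vectorSpace_iff_contDiff (V := fun _ => stdVec b).2 contDiff_const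
  have h3 := h2.comp_contMDiffOn (contMDiffOn_of_mem_maximalAtlas he)
  refine (h1.comp h3 fun p hp => e.map_source hp).congr fun p hp => ?_
  have h4 : mfderivWithin 𝓘(ℝ, Plane) 𝓘(ℝ, Plane) e.symm e.target (e p) =
      mfderiv 𝓘(ℝ, Plane) 𝓘(ℝ, Plane) e.symm (e p) :=
    mfderivWithin_of_isOpen e.open_target (e.map_source hp)
  -- The points `p` and `e.symm (e p)` are equal but not by definition, so tangent vectors over them
  -- are identified by substitution.
  have h5 : ∀ (q : M) (v : Plane), p = q →
    (⟨p, v⟩ : TangentBundle 𝓘(ℝ, Plane) M) = ⟨q, v⟩ := by rintro q v rfl; rfl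
  exact (h5 _ _ (e.left_inv hp).symm).trans (congrArg (fun T : Plane →L[ℝ] Plane =>
    (⟨e.symm (e p), T (stdVec b)⟩ : TangentBundle 𝓘(ℝ, Plane) M)) h4.symm)

omit [IsManifold 𝓘(ℝ, Plane) ∞ M] in
theorem mdifferentiableAt_chart (he : e ∈ IsManifold.maximalAtlas 𝓘(ℝ, Plane) ∞ M) {p : M}
    (hp : p ∈ e.source) : MDifferentiableAt 𝓘(ℝ, Plane) 𝓘(ℝ, Plane) e p :=
  (contMDiffAt_of_mem_maximalAtlas he hp).mdifferentiableAt (by simp)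

omit [IsManifold 𝓘(ℝ, Plane) ∞ M] in
theorem mdifferentiableAt_chart_symm (he : e ∈ IsManifold.maximalAtlas 𝓘(ℝ, Plane) ∞ M)
    {x : Plane} (hx : x ∈ e.target) : MDifferentiableAt 𝓘(ℝ, Plane) 𝓘(ℝ, Plane) e.symm x :=
  (contMDiffAt_symm_of_mem_maximalAtlas he hx).mdifferentiableAt (by simp)

omit [IsManifold 𝓘(ℝ, Plane) ∞ M] in
theorem mfderiv_chart_coordField (he : e ∈ IsManifold.maximalAtlas 𝓘(ℝ, Plane) ∞ M) {p : M}
    (hp : p ∈ e.source) (b : Fin 2) :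
    mfderiv 𝓘(ℝ, Plane) 𝓘(ℝ, Plane) e p (coordField e b p) = stdVec b := by
  have h1 := mfderiv_comp (I := 𝓘(ℝ, Plane)) (I' := 𝓘(ℝ, Plane)) (I'' := 𝓘(ℝ, Plane)) (e p)
    (by rw [e.left_inv hp]; exact mdifferentiableAt_chart he hp)
    (mdifferentiableAt_chart_symm he (e.map_source hp))
  have h2 : e ∘ e.symm =ᶠ[𝓝 (e p)] id :=
    Filter.mem_of_superset (e.open_target.mem_nhds (e.map_source hp)) fun x hx => e.right_inv hx
  rw [h2.mfderiv_eq, mfderiv_id] at h1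
  have h3 := DFunLike.congr_fun h1 (stdVec b)
  rw [e.left_inv hp] at h3
  exact h3.symm

theorem mdifferentiableAt_coordField (he : e ∈ IsManifold.maximalAtlas 𝓘(ℝ, Plane) ∞ M) {p : M}
    (hp : p ∈ e.source) (b : Fin 2) : MDifferentiableAt 𝓘(ℝ, Plane) 𝓘(ℝ, Plane).tangent
      (fun p => (⟨p, coordField e b p⟩ : TangentBundle 𝓘(ℝ, Plane) M)) p :=
  ((contMDiffOn_coordField he b).contMDiffAt (e.open_source.mem_nhds hp)).mdifferentiableAt
    (by simp)

theorem christoffel_apply (e : OpenPartialHomeomorph M Plane) (nabla : AffineConnection M)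
    (a c b : Fin 2) (x : Plane) : christoffel e nabla a x c b =
      (show Plane from mfderiv 𝓘(ℝ, Plane) 𝓘(ℝ, Plane) e (e.symm x)
        (nabla (coordField e b) (e.symm x) (coordField e a (e.symm x)))) c := rfl

/-- Smoothness of a connection is stated for global fields, whereas a coordinate field lives on a
chart. It is cut off by a bump function equal to `1` near the point, which does not change the
covariant derivative there. -/
theorem contDiffOn_christoffel [T2Space M] (he : e ∈ IsManifold.maximalAtlas 𝓘(ℝ, Plane) ∞ M)
    {nabla : AffineConnection M} (hn : nabla.ContMDiffCovariantDerivative ∞) (a c b : Fin 2) :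
    ContDiffOn ℝ ∞ (fun x => christoffel e nabla a x c b) e.target := by
  intro x hx
  refine ContDiffAt.contDiffWithinAt ?_
  have hp : e.symm x ∈ e.source := e.map_target hx
  obtain ⟨χ, -, hχ⟩ := (SmoothBumpFunction.nhds_basis_tsupport (I := 𝓘(ℝ, Plane))
    (e.symm x)).mem_iff.1 (e.open_source.mem_nhds hp)
  have h1 : ContMDiff 𝓘(ℝ, Plane) 𝓘(ℝ, Plane).tangent ∞ (fun p =>
      (⟨p, ((χ : M → ℝ) • coordField e b) p⟩ : TangentBundle 𝓘(ℝ, Plane) M)) :=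
    ContMDiffOn.smul_section_of_tsupport χ.contMDiff.contMDiffOn e.open_source hχ
      (contMDiffOn_coordField he b)
  have h2 := (hn.contMDiff.contMDiff (σ := (χ : M → ℝ) • coordField e b)
    (by simpa using h1.contMDiffOn)).contMDiffAt (x := e.symm x) univ_mem
  have h3 := h2.clm_bundle_apply
    ((contMDiffOn_coordField he a).contMDiffAt (e.open_source.mem_nhds hp))
  have h4 : ContMDiffAt 𝓘(ℝ, Plane) 𝓘(ℝ, Plane).tangent ∞ (fun p =>
      (⟨p, nabla (coordField e b) p (coordField e a p)⟩ : TangentBundle 𝓘(ℝ, Plane) M))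
      (e.symm x) := by
    refine h3.congr_of_eventuallyEq ?_
    have h5 : ∀ᶠ p in 𝓝 (e.symm x), ∀ᶠ q in 𝓝 p, χ q = 1 :=
      eventually_eventually_nhds.2 χ.eventuallyEq_one
    filter_upwards [h5, e.open_source.mem_nhds hp] with p hp1 hp2
    have h6 : nabla (coordField e b) p = nabla ((χ : M → ℝ) • coordField e b) p :=
      nabla.isCovariantDerivativeOn.congr_of_eventuallyEq (s := univ)
        (mdifferentiableAt_coordField he hp2 b) ((h1 p).mdifferentiableAt (by simp)) univ_mem
        (hp1.mono fun q hq => by simp [hq])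
    rw [h6]
  have h5 := (contMDiffOn_of_mem_maximalAtlas he).contMDiffOn_tangentMapWithin
    (m := ∞) (by simp) e.open_source.uniqueMDiffOn
  have h6 : ContMDiffAt 𝓘(ℝ, Plane).tangent 𝓘(ℝ, Plane).tangent ∞
      (tangentMapWithin 𝓘(ℝ, Plane) 𝓘(ℝ, Plane) e e.source)
      (⟨e.symm x, nabla (coordField e b) (e.symm x) (coordField e a (e.symm x))⟩ :
        TangentBundle 𝓘(ℝ, Plane) M) :=
    h5.contMDiffAt (((FiberBundle.continuous_proj Plane (TangentSpace 𝓘(ℝ, Plane) : M → Type _)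
      ).isOpen_preimage _ e.open_source).mem_nhds hp)
  have h7 := (contMDiff_snd_tangentBundle_modelSpace Plane 𝓘(ℝ, Plane) (n := ∞)).contMDiffAt.comp
    _ (h6.comp (e.symm x) h4)
  have h8 := (h7.comp x (contMDiffAt_symm_of_mem_maximalAtlas he hx)).contDiffAt
  refine ((EuclideanSpace.proj c : Plane →L[ℝ] ℝ).contDiff.contDiffAt.comp x
    h8).congr_of_eventuallyEq ?_
  filter_upwards [e.open_target.mem_nhds hx] with y hy
  have h9 : mfderivWithin 𝓘(ℝ, Plane) 𝓘(ℝ, Plane) e e.source (e.symm y) =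
      mfderiv 𝓘(ℝ, Plane) 𝓘(ℝ, Plane) e (e.symm y) :=
    mfderivWithin_of_isOpen e.open_source (e.map_target hy)
  rw [christoffel_apply]
  exact congrArg (fun T : Plane →L[ℝ] Plane =>
    (T (nabla (coordField e b) (e.symm y) (coordField e a (e.symm y)))) c) h9.symm

end Coord

/-! ### Transformation law of the connection under coordinate changes -/

section Bundle

open MetaplecticStructure

variable {ι M : Type*} [TopologicalSpace M] [ChartedSpace Plane M] [IsManifold 𝓘(ℝ, Plane) ∞ M]
  {A : MetaplecticStructure ι M} {i j : ι}

omit [IsManifold 𝓘(ℝ, Plane) ∞ M] in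
theorem mem_lap_chart {p : M} (hi : p ∈ (A.chart i).source) (hj : p ∈ (A.chart j).source) :
    A.chart i p ∈ A.lap i j :=
  mem_lap.2 ⟨(A.chart i).map_source hi, by rwa [(A.chart i).left_inv hi]⟩

omit [IsManifold 𝓘(ℝ, Plane) ∞ M] in
theorem fderiv_tau_stdVec (x : Plane) (b : Fin 2) :
    fderiv ℝ (A.tau i j) x (stdVec b) = ∑ c, A.jac i j x c b • stdVec c := by
  conv_lhs => rw [plane_eq_add (fderiv ℝ (A.tau i j) x (stdVec b))]
  rw [Fin.sum_univ_two]
  rfl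

theorem coordField_change {p : M} (hi : p ∈ (A.chart i).source) (hj : p ∈ (A.chart j).source)
    (b : Fin 2) : coordField (A.chart i) b p =
      ∑ c, A.jac i j (A.chart i p) c b • coordField (A.chart j) c p := by
  have hx := mem_lap_chart hi hj
  have ht : A.tau i j (A.chart i p) = A.chart j p := by
    rw [tau, (A.chart i).left_inv hi]
  have h1 := mfderiv_comp (I := 𝓘(ℝ, Plane)) (I' := 𝓘(ℝ, Plane)) (I'' := 𝓘(ℝ, Plane))
    (A.chart i p) (g := (A.chart j).symm) (f := A.tau i j)
    (mdifferentiableAt_chart_symm (A.chart_mem j) (lap_subset (tau_mem hx)))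
    (hasFDerivAt_tau hx).differentiableAt.mdifferentiableAt
  have h2 : (A.chart j).symm ∘ A.tau i j =ᶠ[𝓝 (A.chart i p)] (A.chart i).symm :=
    Filter.mem_of_superset (isOpen_lap.mem_nhds hx) fun x hx => symm_tau hx
  rw [h2.mfderiv_eq, mfderiv_eq_fderiv] at h1
  have h3 : ∀ (T : Plane →L[ℝ] Plane), T (fderiv ℝ (A.tau i j) (A.chart i p) (stdVec b)) =
      ∑ c, A.jac i j (A.chart i p) c b • T (stdVec c) := fun T => by
    rw [fderiv_tau_stdVec, map_sum]
    exact Finset.sum_congr rfl fun c _ => map_smul _ _ _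
  have h4 : ∀ y, y = A.chart j p →
      (mfderiv 𝓘(ℝ, Plane) 𝓘(ℝ, Plane) (A.chart j).symm y : Plane →L[ℝ] Plane) =
        mfderiv 𝓘(ℝ, Plane) 𝓘(ℝ, Plane) (A.chart j).symm (A.chart j p) := by
    rintro y rfl; rfl
  exact (DFunLike.congr_fun h1 (stdVec b)).trans ((h3 _).trans (congrArg
    (fun T : Plane →L[ℝ] Plane => ∑ c, A.jac i j (A.chart i p) c b • T (stdVec c)) (h4 _ ht)))

theorem mfderiv_chart_change {p : M} (hi : p ∈ (A.chart i).source) (hj : p ∈ (A.chart j).source)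
    (v : Plane) : (mfderiv 𝓘(ℝ, Plane) 𝓘(ℝ, Plane) (A.chart j) p : Plane →L[ℝ] Plane) v =
      fderiv ℝ (A.tau i j) (A.chart i p)
        ((mfderiv 𝓘(ℝ, Plane) 𝓘(ℝ, Plane) (A.chart i) p : Plane →L[ℝ] Plane) v) := by
  have hx := mem_lap_chart hi hj
  have h1 := mfderiv_comp (I := 𝓘(ℝ, Plane)) (I' := 𝓘(ℝ, Plane)) (I'' := 𝓘(ℝ, Plane)) p
    (g := A.tau i j) (f := A.chart i) (hasFDerivAt_tau hx).differentiableAt.mdifferentiableAt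
    (mdifferentiableAt_chart (A.chart_mem i) hi)
  have h2 : A.tau i j ∘ A.chart i =ᶠ[𝓝 p] A.chart j :=
    Filter.mem_of_superset ((A.chart i).open_source.mem_nhds hi) fun q hq =>
      congrArg (A.chart j) ((A.chart i).left_inv hq)
  rw [h2.mfderiv_eq, mfderiv_eq_fderiv] at h1
  exact DFunLike.congr_fun h1 v

/-- The Leibniz rule applied to `coordField_change`, with linearity in the direction of
differentiation; the inhomogeneous term is the derivative of the Jacobian. -/
theorem nabla_coordField_change (nabla : AffineConnection M) {p : M}
    (hi : p ∈ (A.chart i).source) (hj : p ∈ (A.chart j).source) (a b : Fin 2) :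
    nabla (coordField (A.chart i) b) p (coordField (A.chart i) a p) =
      ∑ c, (A.jac i j (A.chart i p) c b • ∑ s, A.jac i j (A.chart i p) s a •
          nabla (coordField (A.chart j) c) p (coordField (A.chart j) s p) +
        fderiv ℝ (fun y => A.jac i j y c b) (A.chart i p) (stdVec a) •
          coordField (A.chart j) c p) := by
  have hx := mem_lap_chart hi hj
  let g : Fin 2 → M → ℝ := fun c q => A.jac i j (A.chart i q) c b
  have hjd : ∀ c, DifferentiableAt ℝ (fun y => A.jac i j y c b) (A.chart i p) := fun c =>
    ((contDiffOn_jac c b).contDiffAt (isOpen_lap.mem_nhds hx)).differentiableAt (by simp)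
  have hgd : ∀ c, MDifferentiableAt 𝓘(ℝ, Plane) 𝓘(ℝ, ℝ) (g c) p := fun c =>
    (hjd c).mdifferentiableAt.comp p (mdifferentiableAt_chart (A.chart_mem i) hi)
  have hC : ∀ c, MDifferentiableAt 𝓘(ℝ, Plane) 𝓘(ℝ, Plane).tangent (fun p =>
      (⟨p, coordField (A.chart j) c p⟩ : TangentBundle 𝓘(ℝ, Plane) M)) p := fun c =>
    mdifferentiableAt_coordField (A.chart_mem j) hj c
  have hgC : ∀ c, MDifferentiableAt 𝓘(ℝ, Plane) 𝓘(ℝ, Plane).tangent (fun p =>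
      (⟨p, (g c • coordField (A.chart j) c) p⟩ : TangentBundle 𝓘(ℝ, Plane) M)) p := fun c =>
    (hgd c).smul_section (hC c)
  have h1 : nabla (coordField (A.chart i) b) p =
      nabla (g 0 • coordField (A.chart j) 0 + g 1 • coordField (A.chart j) 1) p := by
    refine nabla.isCovariantDerivativeOn.congr_of_eventuallyEq (s := univ)
      (mdifferentiableAt_coordField (A.chart_mem i) hi b) (mdifferentiableAt_add_section (hgC 0) (hgC 1)) univ_mem ?_
    filter_upwards [(A.chart i).open_source.mem_nhds hi, (A.chart j).open_source.mem_nhds hj] with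
      q h1 h2
    rw [coordField_change h1 h2, Fin.sum_univ_two]
    rfl
  have hd : ∀ c, mvfderiv 𝓘(ℝ, Plane) (g c) p (coordField (A.chart i) a p) =
      fderiv ℝ (fun y => A.jac i j y c b) (A.chart i p) (stdVec a) := fun c => by
    have h2 := mfderiv_comp (I := 𝓘(ℝ, Plane)) (I' := 𝓘(ℝ, Plane)) (I'' := 𝓘(ℝ, ℝ)) p
      (g := fun y => A.jac i j y c b) (f := A.chart i) (hjd c).mdifferentiableAt
      (mdifferentiableAt_chart (A.chart_mem i) hi)
    rw [mfderiv_eq_fderiv] at h2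
    refine (DFunLike.congr_fun h2 (coordField (A.chart i) a p)).trans ?_
    exact congrArg (fderiv ℝ (fun y => A.jac i j y c b) (A.chart i p))
      (mfderiv_chart_coordField (A.chart_mem i) hi a)
  have hn : ∀ c, nabla (coordField (A.chart j) c) p (coordField (A.chart i) a p) =
      ∑ s, A.jac i j (A.chart i p) s a •
        nabla (coordField (A.chart j) c) p (coordField (A.chart j) s p) := fun c => by
    rw [coordField_change hi hj, map_sum]
    exact Finset.sum_congr rfl fun s _ => map_smul _ _ _
  rw [h1, nabla.isCovariantDerivativeOn.add (s := univ) (hgC 0) (hgC 1),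
    nabla.isCovariantDerivativeOn.leibniz (s := univ) (hC 0) (hgd 0),
    nabla.isCovariantDerivativeOn.leibniz (s := univ) (hC 1) (hgd 1), Fin.sum_univ_two, ← hn, ← hn,
    ← hd, ← hd]
  rfl

-- The linear algebra of the transformation law, separated from the dependent types of the tangent
-- spaces.
omit [IsManifold 𝓘(ℝ, Plane) ∞ M] in
theorem apply_eq_of_eq_sum (T : Plane →L[ℝ] Plane) {v : Plane} {J : Matrix (Fin 2) (Fin 2) ℝ}
    {D : Fin 2 → ℝ} {K : Fin 2 → Fin 2 → Plane} {C : Fin 2 → Plane}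
    {Γ : Fin 2 → Matrix (Fin 2) (Fin 2) ℝ} {a b d : Fin 2}
    (hv : v = ∑ c, (J c b • ∑ s, J s a • K c s + D c • C c)) (hC : ∀ c, T (C c) = stdVec c)
    (hK : ∀ c s, (T (K c s)) d = Γ s d c) :
    (T v) d = ((∑ s, J s a • Γ s) * J) d b + D d := by
  have hD : ∑ c, D c * (stdVec c) d = D d := by
    obtain rfl | rfl : d = 0 ∨ d = 1 := by omega
    all_goals simp [stdVec]
  rw [hv, map_sum, Matrix.mul_apply, ← hD, WithLp.ofLp_sum, Finset.sum_apply,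
    ← Finset.sum_add_distrib]
  refine Finset.sum_congr rfl fun c _ => ?_
  rw [map_add, map_smul, map_smul, map_sum, hC]
  simp only [map_smul, PiLp.add_apply, PiLp.smul_apply, WithLp.ofLp_sum, Finset.sum_apply, hK,
    smul_eq_mul, Matrix.sum_apply, Matrix.smul_apply]
  rw [mul_comm (∑ _, _)]

/-- The transformation law of the Christoffel symbols. -/
theorem christoffel_change (nabla : AffineConnection M) {x : Plane} (hx : x ∈ A.lap i j)
    (a : Fin 2) : A.jac i j x * christoffel (A.chart i) nabla a x =
      (∑ s, A.jac i j x s a • christoffel (A.chart j) nabla s (A.tau i j x)) * A.jac i j x +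
        Matrix.of fun c b => fderiv ℝ (fun y => A.jac i j y c b) x (stdVec a) := by
  set p := (A.chart i).symm x with hp
  have hi : p ∈ (A.chart i).source := (A.chart i).map_target (mem_lap.1 hx).1
  have hj : p ∈ (A.chart j).source := (mem_lap.1 hx).2
  have hxp : A.chart i p = x := (A.chart i).right_inv (mem_lap.1 hx).1
  ext d b
  have h1 := nabla_coordField_change nabla hi hj a b
  have h2 := mfderiv_chart_change hi hj
    (nabla (coordField (A.chart i) b) p (coordField (A.chart i) a p))
  have h3 := congrArg (fun v : Plane => v d) h2
  have h4 : (show Plane from mfderiv 𝓘(ℝ, Plane) 𝓘(ℝ, Plane) (A.chart j) p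
      (nabla (coordField (A.chart i) b) p (coordField (A.chart i) a p))) d =
      (A.jac i j x * christoffel (A.chart i) nabla a x) d b := by
    rw [hxp] at h3
    exact h3.trans (fderiv_tau_apply _ d)
  rw [hxp] at h1
  refine h4.symm.trans (apply_eq_of_eq_sum _ h1
    (fun c => mfderiv_chart_coordField (A.chart_mem j) hj c) fun c s => ?_)
  rw [christoffel_apply, symm_tau hx]
  rfl

end Bundle

end

section

open Filter Topology Set MvPolynomial

/-! ### The action of trace-free matrices on spinors -/

theorem spinAct_apply (F : Matrix (Fin 2) (Fin 2) ℝ) (f : Spinor) : spinAct F f =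
    (-(1 / 4 : ℂ)) • ((F 0 0 : ℂ) • gamma 0 (gamma 1 f) - (F 0 1 : ℂ) • gamma 0 (gamma 0 f) +
      ((F 1 0 : ℂ) • gamma 1 (gamma 1 f) - (F 1 1 : ℂ) • gamma 1 (gamma 0 f))) := by
  have h0 : gammaUp 0 = gamma 1 := by simp [gammaUp, omegaInv]
  have h1 : gammaUp 1 = -gamma 0 := by simp [gammaUp, omegaInv]
  rw [spinAct, Fin.sum_univ_two, Fin.sum_univ_two, Fin.sum_univ_two, h0, h1]
  simp [sub_eq_add_neg]

theorem spinAct_add (F G : Matrix (Fin 2) (Fin 2) ℝ) (f : Spinor) :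
    spinAct (F + G) f = spinAct F f + spinAct G f := by
  simp only [spinAct_apply, Matrix.add_apply, Complex.ofReal_add]
  module

theorem spinAct_smul (c : ℝ) (F : Matrix (Fin 2) (Fin 2) ℝ) (f : Spinor) :
    spinAct (c • F) f = (c : ℂ) • spinAct F f := by
  simp only [spinAct_apply, Matrix.smul_apply, smul_eq_mul, Complex.ofReal_mul]
  module

theorem spinAct_sum {κ : Type*} (t : Finset κ) (F : κ → Matrix (Fin 2) (Fin 2) ℝ) (f : Spinor) :
    spinAct (∑ s ∈ t, F s) f = ∑ s ∈ t, spinAct (F s) f := by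
  classical
  induction t using Finset.induction_on with
  | empty => simp [spinAct]
  | insert a t ha ih => rw [Finset.sum_insert ha, Finset.sum_insert ha, spinAct_add, ih]

theorem cliff_apply (v : Fin 2 → ℝ) (f : Spinor) :
    cliff v f = (v 0 : ℂ) • gamma 0 f + (v 1 : ℂ) • gamma 1 f := by
  simp [cliff, Fin.sum_univ_two]

/-! ### Equivariance of the spinor derivative and of the Dirac operator -/

section Bundle

open MetaplecticStructure

variable {ι M : Type*} [TopologicalSpace M] [ChartedSpace Plane M]
  {A : MetaplecticStructure ι M} {i j : ι} {x : Plane}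

theorem lift_gamma (hx : x ∈ A.lap i j) (c : Fin 2) (f : Spinor) : A.lift i j x (gamma c f) =
    (A.uni i j x 0 c : ℂ) • gamma 0 (A.lift i j x f) +
      (A.uni i j x 1 c : ℂ) • gamma 1 (A.lift i j x f) := by
  have h := A.lift_cliff i j x hx (Pi.single c 1) f
  have h1 : cliff (Pi.single c 1) f = gamma c f := by
    rw [cliff_apply]
    obtain rfl | rfl : c = 0 ∨ c = 1 := by omega
    all_goals simp
  rw [h1, cliff_apply] at h
  simpa [Matrix.mulVec_single] using h

theorem inv_uni (hx : x ∈ A.lap i j) : (A.uni i j x)⁻¹ =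
    !![A.uni i j x 1 1, -A.uni i j x 0 1; -A.uni i j x 1 0, A.uni i j x 0 0] := by
  rw [Matrix.inv_def, det_uni hx, Matrix.adjugate_fin_two]; simp

/-- Each gamma factor is transformed by `A.uni i j x`. Its inverse is the adjugate, as the
determinant is one, so the claim is a polynomial identity in the matrix entries. -/
theorem lift_spinAct (hx : x ∈ A.lap i j) (F : Matrix (Fin 2) (Fin 2) ℝ) (hF : F.trace = 0)
    (f : Spinor) : A.lift i j x (spinAct F f) =
      spinAct (A.uni i j x * F * (A.uni i j x)⁻¹) (A.lift i j x f) := by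
  have hd := det_uni hx
  rw [Matrix.det_fin_two] at hd
  rw [Matrix.trace_fin_two] at hF
  rw [inv_uni hx, spinAct_apply, spinAct_apply]
  simp only [map_smul, map_add, map_sub, lift_gamma hx, Matrix.mul_apply, Fin.sum_univ_two,
    Matrix.of_apply, Matrix.cons_val', Matrix.cons_val_zero, Matrix.cons_val_one,
    Matrix.empty_val', Matrix.cons_val_fin_one]
  have hF' : F 1 1 = -F 0 0 := by linarith
  rw [hF']
  push_cast
  generalize A.uni i j x = g at *
  module

theorem jac_mul_inv (hx : x ∈ A.lap i j) : A.jac i j x * (A.jac i j x)⁻¹ = 1 :=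
  Matrix.mul_nonsing_inv _ (isUnit_iff_ne_zero.2 (det_jac_pos hx).ne')

theorem uni_inv_eq (hx : x ∈ A.lap i j) :
    (A.uni i j x)⁻¹ = (A.jac i j x).det ^ (1 / 2 : ℝ) • (A.jac i j x)⁻¹ := by
  refine Matrix.inv_eq_right_inv ?_
  change ((A.jac i j x).det ^ (-(1 / 2) : ℝ) • A.jac i j x) * _ = 1
  rw [smul_mul_smul_comm, jac_mul_inv hx, ← Real.rpow_add (det_jac_pos hx)]
  norm_num

theorem uni_conj (hx : x ∈ A.lap i j) (F : Matrix (Fin 2) (Fin 2) ℝ) :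
    A.uni i j x * F * (A.uni i j x)⁻¹ = A.jac i j x * F * (A.jac i j x)⁻¹ := by
  rw [uni_inv_eq hx]
  change ((A.jac i j x).det ^ (-(1 / 2) : ℝ) • A.jac i j x) * _ * _ = _
  rw [smul_mul_assoc, smul_mul_smul_comm, ← Real.rpow_add (det_jac_pos hx)]
  norm_num

variable (A) in
/-- The partial derivative `∂_a` of the Jacobian matrix. -/
def jacDeriv (i j : ι) (a : Fin 2) (x : Plane) : Matrix (Fin 2) (Fin 2) ℝ :=
  Matrix.of fun c b => fderiv ℝ (fun y => A.jac i j y c b) x (stdVec a)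

variable [IsManifold 𝓘(ℝ, Plane) ∞ M]

theorem hasFDerivAt_jac (hx : x ∈ A.lap i j) (c b : Fin 2) :
    HasFDerivAt (fun y => A.jac i j y c b) (fderiv ℝ (fun y => A.jac i j y c b) x) x :=
  (((contDiffOn_jac c b).contDiffAt (isOpen_lap.mem_nhds hx)).differentiableAt
    (by simp)).hasFDerivAt

theorem hasFDerivAt_det_jac (hx : x ∈ A.lap i j) :
    HasFDerivAt (fun y => (A.jac i j y).det) (fderiv ℝ (fun y => (A.jac i j y).det) x) x :=
  ((contDiffOn_det_jac.contDiffAt (isOpen_lap.mem_nhds hx)).differentiableAt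
    (by simp)).hasFDerivAt

theorem fderiv_det_jac (hx : x ∈ A.lap i j) (a : Fin 2) :
    fderiv ℝ (fun y => (A.jac i j y).det) x (stdVec a) =
      (A.jac i j x).det * (jacDeriv A i j a x * (A.jac i j x)⁻¹).trace := by
  have h := ((hasFDerivAt_jac hx 0 0).mul (hasFDerivAt_jac hx 1 1)).sub
    ((hasFDerivAt_jac hx 0 1).mul (hasFDerivAt_jac hx 1 0))
  have h1 := h.congr_of_eventuallyEq (f₁ := fun y => (A.jac i j y).det)
    (Eventually.of_forall fun y => Matrix.det_fin_two _)
  have hd : (A.jac i j x).det ≠ 0 := (det_jac_pos hx).ne'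
  have h2 : (A.jac i j x)⁻¹ = ((A.jac i j x).det)⁻¹ •
      !![A.jac i j x 1 1, -A.jac i j x 0 1; -A.jac i j x 1 0, A.jac i j x 0 0] := by
    rw [Matrix.inv_def, Matrix.adjugate_fin_two, Ring.inverse_eq_inv']
  rw [h1.fderiv, h2, Matrix.mul_smul, Matrix.trace_smul, smul_eq_mul,
    mul_inv_cancel_left₀ hd, Matrix.trace_fin_two]
  simp [jacDeriv, Matrix.mul_apply, Fin.sum_univ_two]
  ring

theorem fderiv_det_jac_rpow (hx : x ∈ A.lap i j) (a : Fin 2) (r : ℝ) :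
    fderiv ℝ (fun y => (A.jac i j y).det ^ r) x (stdVec a) =
      r * (jacDeriv A i j a x * (A.jac i j x)⁻¹).trace * (A.jac i j x).det ^ r := by
  have h := (hasFDerivAt_det_jac hx).rpow_const (p := r) (Or.inl (det_jac_pos hx).ne')
  rw [h.fderiv, smul_apply, smul_eq_mul, fderiv_det_jac hx,
    Real.rpow_sub_one (det_jac_pos hx).ne']
  have hd : (A.jac i j x).det ≠ 0 := (det_jac_pos hx).ne'
  field_simp

/-- Scaling by `det ^ (-1/2)` removes half the trace times the identity from the logarithmic
derivative; in dimension two this is the trace-free part. -/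
theorem unimodularJacobianDeriv_mul_inv (hx : x ∈ A.lap i j) (a : Fin 2) :
    unimodularJacobianDeriv (A.chart i) (A.chart j) a x * (A.uni i j x)⁻¹ =
      jacDeriv A i j a x * (A.jac i j x)⁻¹ -
        ((jacDeriv A i j a x * (A.jac i j x)⁻¹).trace / 2) • (1 : Matrix (Fin 2) (Fin 2) ℝ) := by
  have h1 : unimodularJacobianDeriv (A.chart i) (A.chart j) a x =
      (A.jac i j x).det ^ (-(1 / 2) : ℝ) • (jacDeriv A i j a x -
        ((jacDeriv A i j a x * (A.jac i j x)⁻¹).trace / 2) • A.jac i j x) := by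
    ext c b
    have h2 := (((contDiffOn_det_jac_rpow (A := A) (i := i) (j := j) (-(1 / 2))).contDiffAt
      (isOpen_lap.mem_nhds hx)).differentiableAt (by simp)).hasFDerivAt.mul
        (hasFDerivAt_jac hx c b)
    have h3 := h2.congr_of_eventuallyEq (f₁ := fun y => A.uni i j y c b)
      (Eventually.of_forall fun y => rfl)
    rw [unimodularJacobianDeriv, Matrix.of_apply]
    change fderiv ℝ (fun y => A.uni i j y c b) x (stdVec a) = _
    rw [h3.fderiv, add_apply, smul_apply, smul_apply, fderiv_det_jac_rpow hx]
    simp only [Matrix.smul_apply, Matrix.sub_apply, smul_eq_mul, jacDeriv, Matrix.of_apply]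
    ring
  rw [h1, uni_inv_eq hx, smul_mul_smul_comm, ← Real.rpow_add (det_jac_pos hx), sub_mul,
    smul_mul_assoc, jac_mul_inv hx]
  norm_num

/-- The covariant derivative of spinors commutes with the coordinate changes. -/
theorem sum_spinNabla_tr (nabla : AffineConnection M) (w : ℝ) {U : Set Plane} (hU : IsOpen U)
    (hUj : U ⊆ A.lap i j) {f : Plane → Spinor} (hf : SmoothOn f U) (hx : x ∈ U) (a : Fin 2) :
    ∑ s, (A.jac i j x s a : ℂ) •
      spinNabla (A.chart j) nabla w s (A.tr w i j f) (A.tau i j x) =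
    (((A.jac i j x).det ^ (w / 3) : ℝ) : ℂ) •
      A.lift i j x (spinNabla (A.chart i) nabla w a f x) := by
  have hxl := hUj hx
  set K := jacDeriv A i j a x * (A.jac i j x)⁻¹ with hK
  set Γ := christoffel (A.chart i) nabla a x with hΓ
  set B := ∑ s, A.jac i j x s a • christoffel (A.chart j) nabla s (A.tau i j x) with hB
  -- The conjugated Christoffel matrix is the new one plus the logarithmic derivative `K` of the
  -- Jacobian. The trace-free part of `K` matches the derivative of the lift, and its trace the
  -- derivative of the density factor.
  have hBK : A.jac i j x * Γ * (A.jac i j x)⁻¹ = B + K := by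
    rw [christoffel_change nabla hxl a, add_mul, Matrix.mul_assoc, jac_mul_inv hxl,
      Matrix.mul_one]
    rfl
  have htr : Γ.trace = B.trace + K.trace := by
    rw [← Matrix.trace_add, ← hBK, Matrix.trace_mul_comm, ← Matrix.mul_assoc,
      Matrix.nonsing_inv_mul _ (isUnit_iff_ne_zero.2 (det_jac_pos hxl).ne'), Matrix.one_mul]
  have hdc : ContDiffOn ℝ ∞ (fun y => (((A.jac i j y).det ^ (w / 3) : ℝ) : ℂ)) U :=
    contDiffOn_ofReal ((contDiffOn_det_jac_rpow _).mono hUj)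
  obtain ⟨hl1, hl2⟩ := A.lift_smooth i j U hUj hU f hf
  have h1 : pd a (fun y => A.tr w i j f (A.tau i j y)) x =
      ∑ s, (A.jac i j x s a : ℂ) • pd s (A.tr w i j f) (A.tau i j x) :=
    pd_comp (isOpen_img hU) hU (smoothOn_tr hU hUj hf) (contDiffOn_tau.mono hUj)
      (fun y hy => tau_mem_img (hUj hy) hy) hx a
  have h2 : EqOn (fun y => A.tr w i j f (A.tau i j y))
      (fun y => (((A.jac i j y).det ^ (w / 3) : ℝ) : ℂ) • A.lift i j y (f y)) U :=
    fun y hy => tr_tau (hUj hy)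
  have hder : fderiv ℝ (fun y => (((A.jac i j y).det ^ (w / 3) : ℝ) : ℂ)) x (stdVec a) =
      ((w / 3 * K.trace * (A.jac i j x).det ^ (w / 3) : ℝ) : ℂ) := by
    have h3 := (((contDiffOn_det_jac_rpow (A := A) (i := i) (j := j) (w / 3)).contDiffAt
      (isOpen_lap.mem_nhds hxl)).differentiableAt (by simp)).hasFDerivAt
    have h4 := Complex.ofRealCLM.hasFDerivAt.comp x h3
    have h5 := h4.congr_of_eventuallyEq
      (f₁ := fun y => (((A.jac i j y).det ^ (w / 3) : ℝ) : ℂ)) (Eventually.of_forall fun y => rfl)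
    rw [h5.fderiv]
    exact congrArg Complex.ofReal (fderiv_det_jac_rpow hxl a (w / 3))
  have h3 : ∑ s, (A.jac i j x s a : ℂ) • pd s (A.tr w i j f) (A.tau i j x) =
      ((w / 3 * K.trace * (A.jac i j x).det ^ (w / 3) : ℝ) : ℂ) • A.lift i j x (f x) +
      (((A.jac i j x).det ^ (w / 3) : ℝ) : ℂ) •
        (spinAct (K - (K.trace / 2) • (1 : Matrix (Fin 2) (Fin 2) ℝ)) (A.lift i j x (f x)) +
          A.lift i j x (pd a f x)) := by
    rw [← h1, eqOn_pd hU h2 a hx, pd_smul hU hdc hl1 hx, hl2 x hx a, hder,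
      unimodularJacobianDeriv_mul_inv hxl]
  have h4 : ∑ s, (A.jac i j x s a : ℂ) • spinAct (christoffel (A.chart j) nabla s (A.tau i j x) -
      ((christoffel (A.chart j) nabla s (A.tau i j x)).trace / 2) •
        (1 : Matrix (Fin 2) (Fin 2) ℝ)) (A.tr w i j f (A.tau i j x)) =
      spinAct (B - (B.trace / 2) • (1 : Matrix (Fin 2) (Fin 2) ℝ))
        (A.tr w i j f (A.tau i j x)) := by
    simp only [← spinAct_smul]
    rw [← spinAct_sum]
    congr 2
    simp only [smul_sub, Finset.sum_sub_distrib, smul_smul, ← Finset.sum_smul, hB,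
      Matrix.trace_sum, Matrix.trace_smul, smul_eq_mul, Finset.sum_div, mul_div_assoc]
  have h5 : ∑ s, (A.jac i j x s a : ℂ) •
      (((w / 3 * (christoffel (A.chart j) nabla s (A.tau i j x)).trace : ℝ) : ℂ) •
        A.tr w i j f (A.tau i j x)) =
      ((w / 3 * B.trace : ℝ) : ℂ) • A.tr w i j f (A.tau i j x) := by
    simp only [smul_smul, ← Finset.sum_smul]
    congr 1
    rw [hB, Matrix.trace_sum, Finset.mul_sum, Complex.ofReal_sum]
    refine Finset.sum_congr rfl fun s _ => ?_
    rw [Matrix.trace_smul, smul_eq_mul]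
    push_cast
    ring
  have h6 : A.lift i j x (spinAct (Γ - (Γ.trace / 2) • (1 : Matrix (Fin 2) (Fin 2) ℝ)) (f x)) =
      spinAct (B - (B.trace / 2) • (1 : Matrix (Fin 2) (Fin 2) ℝ)) (A.lift i j x (f x)) +
      spinAct (K - (K.trace / 2) • (1 : Matrix (Fin 2) (Fin 2) ℝ)) (A.lift i j x (f x)) := by
    rw [lift_spinAct hxl _ (by simp [Matrix.trace_sub, Matrix.trace_smul]), uni_conj hxl,
      ← spinAct_add]
    congr 2
    rw [mul_sub, sub_mul, hBK, htr, Matrix.mul_smul, Matrix.mul_one, smul_mul_assoc,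
      jac_mul_inv hxl, add_div, add_smul]
    abel
  simp only [spinNabla, smul_add, Finset.sum_add_distrib, map_add, map_smul]
  rw [h3, h4, h5, h6, tr_tau hxl, htr, map_smul]
  push_cast
  module

variable (A) in
/-- The expression of the symplectic Dirac operator in a chart. -/
def diracLoc (nabla : AffineConnection M) (i : ι) (f : Plane → Spinor) (x : Plane) : Spinor :=
  ∑ r, ∑ s, ((omegaInv r s : ℝ) : ℂ) •
    gamma r (spinNabla (A.chart i) nabla (-3 / 4) s f x)

theorem symplecticDirac_apply (nabla : AffineConnection M) (φ : ι → Plane → Spinor) (i : ι) :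
    symplecticDirac A nabla φ i = diracLoc A nabla i (φ i) := rfl

theorem diracLoc_eq (nabla : AffineConnection M) (i : ι) (f : Plane → Spinor) (x : Plane) :
    diracLoc A nabla i f x = gamma 0 (spinNabla (A.chart i) nabla (-3 / 4) 1 f x) -
      gamma 1 (spinNabla (A.chart i) nabla (-3 / 4) 0 f x) := by
  simp [diracLoc, omegaInv, Fin.sum_univ_two, sub_eq_add_neg]

/-- The symplectic Dirac operator commutes with the coordinate changes. -/
theorem diracLoc_tr (nabla : AffineConnection M) {U : Set Plane} (hU : IsOpen U)
    (hUj : U ⊆ A.lap i j) {f : Plane → Spinor} (hf : SmoothOn f U) (hx : x ∈ U) :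
    diracLoc A nabla j (A.tr (-3 / 4) i j f) (A.tau i j x) =
    (((A.jac i j x).det ^ ((-9 / 4 : ℝ) / 3) : ℝ) : ℂ) • A.lift i j x (diracLoc A nabla i f x) := by
  have hxl := hUj hx
  have h0 := sum_spinNabla_tr nabla (-3 / 4) hU hUj hf hx 0
  have h1 := sum_spinNabla_tr nabla (-3 / 4) hU hUj hf hx 1
  have hd := det_jac_pos hxl
  set δ := (A.jac i j x).det with hδ
  have e1 : δ ^ ((-9 / 4 : ℝ) / 3) = δ ^ (-(1 / 2) : ℝ) * δ ^ ((-3 / 4 : ℝ) / 3) := by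
    rw [← Real.rpow_add hd]; norm_num
  -- Transporting the outer gamma matrix contributes the unimodular Jacobian, the source of the
  -- extra `δ ^ (-1/2)`. Together with the Jacobian from the derivative it leaves `δ⁻¹ det J = 1`,
  -- so the weights `-9/4` and `-3/4` are matched.
  rw [diracLoc_eq, diracLoc_eq, map_sub, lift_gamma hxl, lift_gamma hxl, e1]
  have eu : ∀ c b, A.uni i j x c b = δ ^ (-(1 / 2) : ℝ) * A.jac i j x c b := fun c b => rfl
  simp only [eu]
  rw [Fin.sum_univ_two] at h0 h1
  set n0 := spinNabla (A.chart j) nabla (-3 / 4) 0 (A.tr (-3 / 4) i j f) (A.tau i j x)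
  set n1 := spinNabla (A.chart j) nabla (-3 / 4) 1 (A.tr (-3 / 4) i j f) (A.tau i j x)
  set v0 := A.lift i j x (spinNabla (A.chart i) nabla (-3 / 4) 0 f x)
  set v1 := A.lift i j x (spinNabla (A.chart i) nabla (-3 / 4) 1 f x)
  have hh : δ ^ (-(1 / 2) : ℝ) * δ ^ (-(1 / 2) : ℝ) * δ = 1 := by
    rw [← Real.rpow_add hd]
    norm_num
    rw [Real.rpow_neg_one, inv_mul_cancel₀ hd.ne']
  have hh' : ((δ ^ (-(1 / 2) : ℝ) : ℝ) : ℂ) * ((δ ^ (-(1 / 2) : ℝ) : ℝ) : ℂ) *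
      ((A.jac i j x 0 0 : ℂ) * A.jac i j x 1 1 - A.jac i j x 0 1 * A.jac i j x 1 0) = 1 := by
    rw [hδ, Matrix.det_fin_two] at hh
    rw [hδ, Matrix.det_fin_two]
    exact_mod_cast hh
  have g0 : ∀ r, gamma r ((((δ ^ ((-3 / 4 : ℝ) / 3) : ℝ)) : ℂ) • v0) =
      (A.jac i j x 0 0 : ℂ) • gamma r n0 + (A.jac i j x 1 0 : ℂ) • gamma r n1 := fun r => by
    rw [← h0, map_add, map_smul, map_smul]
  have g1 : ∀ r, gamma r ((((δ ^ ((-3 / 4 : ℝ) / 3) : ℝ)) : ℂ) • v1) =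
      (A.jac i j x 0 1 : ℂ) • gamma r n0 + (A.jac i j x 1 1 : ℂ) • gamma r n1 := fun r => by
    rw [← h1, map_add, map_smul, map_smul]
  simp only [map_smul] at g0 g1
  push_cast
  generalize ((δ ^ (-(1 / 2) : ℝ) : ℝ) : ℂ) = d at *
  generalize ((δ ^ ((-3 / 4 : ℝ) / 3) : ℝ) : ℂ) = d' at *
  generalize (A.jac i j x) = J at *
  have k1 : (d * d') • ((d * (J 0 0 : ℂ)) • gamma 0 v1 + (d * (J 1 0 : ℂ)) • gamma 1 v1 -
      ((d * (J 0 1 : ℂ)) • gamma 0 v0 + (d * (J 1 1 : ℂ)) • gamma 1 v0)) =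
      (d * d * (J 0 0 : ℂ)) • (d' • gamma 0 v1) + (d * d * (J 1 0 : ℂ)) • (d' • gamma 1 v1) -
      ((d * d * (J 0 1 : ℂ)) • (d' • gamma 0 v0) + (d * d * (J 1 1 : ℂ)) • (d' • gamma 1 v0)) := by
    module
  rw [k1, g0, g0, g1, g1]
  have k2 : (d * d * (J 0 0 : ℂ)) • ((J 0 1 : ℂ) • gamma 0 n0 + (J 1 1 : ℂ) • gamma 0 n1) +
      (d * d * (J 1 0 : ℂ)) • ((J 0 1 : ℂ) • gamma 1 n0 + (J 1 1 : ℂ) • gamma 1 n1) -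
      ((d * d * (J 0 1 : ℂ)) • ((J 0 0 : ℂ) • gamma 0 n0 + (J 1 0 : ℂ) • gamma 0 n1) +
        (d * d * (J 1 1 : ℂ)) • ((J 0 0 : ℂ) • gamma 1 n0 + (J 1 0 : ℂ) • gamma 1 n1)) =
      (d * d * ((J 0 0 : ℂ) * J 1 1 - J 0 1 * J 1 0)) • (gamma 0 n1 - gamma 1 n0) := by
    module
  rw [k2, hh', one_smul]

end Bundle

end

section

open Filter Topology Set MvPolynomial

/-! ### The symbol of a composition with the Dirac operator -/

/-- The operator `B` is differential of order at most one: it raises the order of the operators it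
is composed with by at most one, and transforms their symbols by `F` (for `B L`) and by `G`
(for `L B`). -/
structure FirstOrder (V : Set Plane) (n : ℕ) (B : (Plane → Spinor) → Plane → Spinor)
    (F G : Poly → Poly) : Prop where
  smooth : ∀ U ⊆ V, IsOpen U → ∀ f, SmoothOn f U → SmoothOn (B f) U
  left : ∀ {k N L p}, LocSymb V k N L p → ∃ q, LocSymb V (k + 1) (N + n) (fun f => B (L f)) q ∧
    ∀ x ∈ V, part xiW (k + 1) (q x) = F (part xiW k (p x))
  right : ∀ {k N L p}, LocSymb V k N L p → ∃ q, LocSymb V (k + 1) (N + n) (fun f => L (B f)) q ∧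
    ∀ x ∈ V, part xiW (k + 1) (q x) = G (part xiW k (p x))

namespace FirstOrder

variable {V : Set Plane} {n n' : ℕ} {B B' : (Plane → Spinor) → Plane → Spinor}
  {F G F' G' : Poly → Poly}

theorem mono (h : FirstOrder V n B F G) (hn : n ≤ n') : FirstOrder V n' B F G :=
  ⟨h.smooth, fun hL => let ⟨q, hq, e⟩ := h.left hL; ⟨q, hq.mono le_rfl (by omega), e⟩,
    fun hL => let ⟨q, hq, e⟩ := h.right hL; ⟨q, hq.mono le_rfl (by omega), e⟩⟩

theorem pd (hV : IsOpen V) (a : Fin 2) :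
    FirstOrder V 0 (pd a) (fun p => X (Sum.inl a) * p) (fun p => X (Sum.inl a) * p) := by
  refine ⟨fun U _ _ f hf => hf.pd a, fun {k N L p} hL => ⟨_, hL.pdLeft hV a, fun x hx => ?_⟩,
    fun {k N L p} hL => ⟨_, hL.pdRight a, fun x hx => ?_⟩⟩
  · rw [map_add, LocSymb.part_dx, add_zero]
    exact part_X_mul xiW k (Sum.inl a) (p x)
  · exact part_X_mul xiW k (Sum.inl a) (p x)

/-- A multiplication has order zero and contributes nothing in order `k + 1`, so both symbol maps
are zero. The zeroth order terms of the connection enter in this way. -/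
theorem mul (hV : IsOpen V) {c : Plane → ℂ} (hc : ContDiffOn ℝ ∞ c V) :
    FirstOrder V 0 (fun f x => c x • f x) (fun _ => 0) (fun _ => 0) := by
  refine ⟨fun U hU hUo f hf => hf.smul hUo (hc.mono hU),
    fun {k N L p} hL => ⟨_, (hL.smul hc).mono k.le_succ le_rfl, fun x hx => ?_⟩,
    fun {k N L p} hL => ?_⟩
  · exact ((hL.xi x hx).smul _).part_eq_zero k.lt_succ_self
  · obtain ⟨q, hq, -⟩ := hL.mulRight hV hc
    exact ⟨q, hq.mono k.le_succ le_rfl, fun x hx => (hq.xi x hx).part_eq_zero k.lt_succ_self⟩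

theorem add (h : FirstOrder V n B F G) (h' : FirstOrder V n B' F' G') :
    FirstOrder V n (fun f x => B f x + B' f x) (fun p => F p + F' p) (fun p => G p + G' p) := by
  refine ⟨fun U hU hUo f hf => (h.smooth U hU hUo f hf).add hUo (h'.smooth U hU hUo f hf),
    fun hL => ?_, fun hL => ?_⟩
  · obtain ⟨q, hq, e⟩ := h.left hL
    obtain ⟨q', hq', e'⟩ := h'.left hL
    exact ⟨_, hq.add hq', fun x hx => by rw [map_add, e x hx, e' x hx]⟩
  · obtain ⟨q, hq, e⟩ := h.right hL
    obtain ⟨q', hq', e'⟩ := h'.right hL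
    refine ⟨_, (hq.add hq').congr fun U hU hUo f hf x hx => ?_,
      fun x hx => by rw [map_add, e x hx, e' x hx]⟩
    have h1 := h.smooth U hU hUo f hf
    have h2 := h'.smooth U hU hUo f hf
    rw [hL.act U hU hUo _ (h1.add hUo h2) x hx, hL.act U hU hUo _ h1 x hx,
      hL.act U hU hUo _ h2 x hx, opAt_add hUo h1 h2 hx]

theorem const_smul (h : FirstOrder V n B F G) (c : ℂ) :
    FirstOrder V n (fun f x => c • B f x) (fun p => c • F p) (fun p => c • G p) := by
  refine ⟨fun U hU hUo f hf => (h.smooth U hU hUo f hf).smul hUo contDiffOn_const,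
    fun hL => ?_, fun hL => ?_⟩
  · obtain ⟨q, hq, e⟩ := h.left hL
    exact ⟨_, hq.smul (c := fun _ => c) contDiffOn_const, fun x hx => by rw [map_smul, e x hx]⟩
  · obtain ⟨q, hq, e⟩ := h.right hL
    refine ⟨_, (hq.smul (c := fun _ => c) contDiffOn_const).congr fun U hU hUo f hf x hx => ?_,
      fun x hx => by rw [map_smul, e x hx]⟩
    have h1 := h.smooth U hU hUo f hf
    rw [hL.act U hU hUo _ (h1.smul hUo contDiffOn_const) x hx, hL.act U hU hUo _ h1 x hx,
      opAt_const_smul hUo h1 hx]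

theorem gamma (h : FirstOrder V n B F G) (a : Fin 2) :
    FirstOrder V (n + 1) (fun f x => gamma a (B f x)) (fun p => gl a (F p))
      (fun p => G (gr a p)) := by
  refine ⟨fun U hU hUo f hf => (h.smooth U hU hUo f hf).clm hUo _, fun {k N L p} hL => ?_,
    fun {k N L p} hL => ?_⟩
  · obtain ⟨q, hq, e⟩ := h.left hL
    exact ⟨_, hq.gammaLeft a, fun x hx => by rw [part_xiW_gl, e x hx]⟩
  · obtain ⟨q, hq, e⟩ := h.right (hL.gammaRight a)
    exact ⟨q, hq.mono le_rfl (by omega), fun x hx => by rw [e x hx, part_xiW_gr]⟩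

theorem mul_comp (hV : IsOpen V) (h : FirstOrder V n B (fun _ => 0) (fun _ => 0)) {c : Plane → ℂ}
    (hc : ContDiffOn ℝ ∞ c V) :
    FirstOrder V n (fun f x => c x • B f x) (fun _ => 0) (fun _ => 0) := by
  refine ⟨fun U hU hUo f hf => (h.smooth U hU hUo f hf).smul hUo (hc.mono hU),
    fun {k N L p} hL => ?_, fun {k N L p} hL => ?_⟩
  · obtain ⟨q, hq, e⟩ := h.left hL
    exact ⟨_, hq.smul hc, fun x hx => by rw [map_smul, e x hx, smul_zero]⟩
  · obtain ⟨q', hq', -⟩ := hL.mulRight hV hc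
    obtain ⟨q, hq, e⟩ := h.right hq'
    exact ⟨q, hq, e⟩

theorem spinAct (hV : IsOpen V) {Φ : Plane → Matrix (Fin 2) (Fin 2) ℝ}
    (hΦ : ∀ a b, ContDiffOn ℝ ∞ (fun x => Φ x a b) V) :
    FirstOrder V 2 (fun f x => spinAct (Φ x) (f x)) (fun _ => 0) (fun _ => 0) := by
  have h1 : FirstOrder V 0 (fun f x => f x) (fun _ => 0) (fun _ => 0) := by
    simpa using mul hV (c := fun _ => 1) contDiffOn_const
  have hw : ∀ a b, FirstOrder V 2 (fun f x => SymplecticSpinor.gamma a (SymplecticSpinor.gamma b (f x)))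
      (fun _ => 0) (fun _ => 0) := fun a b => by simpa using (h1.gamma b).gamma a
  have hc : ∀ a b, ContDiffOn ℝ ∞ (fun x => ((Φ x a b : ℝ) : ℂ)) V := fun a b =>
    MetaplecticStructure.contDiffOn_ofReal (hΦ a b)
  have := ((((hw 0 1).mul_comp hV (hc 0 0)).add (((hw 0 0).mul_comp hV (hc 0 1)).const_smul
    (-1))).add ((((hw 1 1).mul_comp hV (hc 1 0)).add (((hw 1 0).mul_comp hV (hc 1 1)).const_smul
    (-1))))).const_smul (-1 / 4)
  simp only [add_zero, smul_zero] at this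
  convert this using 3
  rw [spinAct_apply]
  module

end FirstOrder

variable {ι M : Type*} [TopologicalSpace M] [ChartedSpace Plane M]
  {A : MetaplecticStructure ι M} [T2Space M] [IsManifold 𝓘(ℝ, Plane) ∞ M]

theorem firstOrder_spinNabla {nabla : AffineConnection M}
    (hn : nabla.ContMDiffCovariantDerivative ∞) (w : ℝ) (i : ι) (a : Fin 2) :
    FirstOrder (A.chart i).target 2 (spinNabla (A.chart i) nabla w a)
      (fun p => X (Sum.inl a) * p) (fun p => X (Sum.inl a) * p) := by
  have hV := (A.chart i).open_target
  have hc : ∀ c b, ContDiffOn ℝ ∞ (fun x => christoffel (A.chart i) nabla a x c b)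
    (A.chart i).target := fun c b => contDiffOn_christoffel (A.chart_mem i) hn a c b
  have ht : ContDiffOn ℝ ∞ (fun x => (christoffel (A.chart i) nabla a x).trace)
      (A.chart i).target := by
    simp only [Matrix.trace_fin_two]
    exact (hc 0 0).add (hc 1 1)
  have h1 := FirstOrder.spinAct hV (Φ := fun x => christoffel (A.chart i) nabla a x -
      ((christoffel (A.chart i) nabla a x).trace / 2) • (1 : Matrix (Fin 2) (Fin 2) ℝ))
      fun c b => by
    simp only [Matrix.sub_apply, Matrix.smul_apply, smul_eq_mul]
    exact (hc c b).sub ((ht.div_const 2).mul contDiffOn_const)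
  have h2 := FirstOrder.mul hV (MetaplecticStructure.contDiffOn_ofReal
    ((contDiffOn_const (c := w / 3)).mul ht))
  have := (((FirstOrder.pd hV a).mono (Nat.zero_le 2)).add h1).add (h2.mono (Nat.zero_le 2))
  simp only [add_zero] at this
  exact this

theorem firstOrder_diracLoc {nabla : AffineConnection M}
    (hn : nabla.ContMDiffCovariantDerivative ∞) (i : ι) :
    FirstOrder (A.chart i).target 3 (diracLoc A nabla i) diracL diracR := by
  have := ((firstOrder_spinNabla (A := A) hn (-3 / 4) i 1).gamma 0).add
    (((firstOrder_spinNabla (A := A) hn (-3 / 4) i 0).gamma 1).const_smul (-1))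
  convert this using 3
  · rw [diracLoc_eq]; module
  · rw [diracL]; module
  · rw [diracR]; module

theorem equivar_diracLoc {nabla : AffineConnection M}
    (hn : nabla.ContMDiffCovariantDerivative ∞) :
    Equivar A (-3 / 4) (-9 / 4) univ (diracLoc A nabla) := by
  refine ⟨fun i U hU hUi => ?_, fun i U hU hUi f g hf hfg => ?_,
    fun i j U hU hUj _ f hf x hx => diracLoc_tr nabla hU hUj hf hx⟩
  · rw [MetaplecticStructure.dom_univ] at hUi
    exact (firstOrder_diracLoc hn i).smooth U hUi hU
  · rw [MetaplecticStructure.dom_univ] at hUi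
    -- Composing with the identity exhibits the Dirac operator itself as an operator with a local
    -- symbol.
    obtain ⟨q, hq, -⟩ := (firstOrder_diracLoc (A := A) hn i).left (LocSymb.id _)
    exact hq.eqOn hUi hU hf hfg

end

section

open Filter Topology Set MvPolynomial

/-! ### Commutators -/

namespace LocSymb

variable {V : Set Plane} {k N : ℕ} {L : (Plane → Spinor) → Plane → Spinor} {p : Plane → Poly}

theorem part_mulRight {q : Poly} {c : ℂ} {d : Fin 2 → ℂ} {p' : Poly} (hp : WLe xiW k q)
    (h : ∀ t, k ≤ Finsupp.weight xiW t + 1 → coeff t p' =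
      coeff t (c • q + ∑ b, d b • pderiv (Sum.inl b) q)) :
    part xiW k p' = c • part xiW k q := by
  have h0 : ∀ b : Fin 2, part xiW k (pderiv (Sum.inl b) q) = 0 := fun b => by
    have h1 := part_pderiv xiW k (Sum.inl b) q
    rw [h1, hp.part_eq_zero (by simp), map_zero]
  have h2 : part xiW k p' = part xiW k (c • q + ∑ b, d b • pderiv (Sum.inl b) q) := by
    ext t
    rw [part, coeff_weightedHomogeneousComponent, coeff_weightedHomogeneousComponent]
    split_ifs with ht
    · exact h t (by omega)
    · rfl
  rw [h2, map_add, map_smul, map_sum]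
  simp [h0]

/-- The commutator with the multiplication by a function. -/
theorem commutator (hV : IsOpen V) (h : LocSymb V (k + 1) N L p) {c : Plane → ℂ}
    (hc : ContDiffOn ℝ ∞ c V) :
    ∃ q, LocSymb V k N (fun f x => L (fun y => c y • f y) x - c x • L f x) q ∧
      ∀ x ∈ V, part xiW k (q x) = ∑ b, fderiv ℝ c x (stdVec b) •
        pderiv (Sum.inl b) (part xiW (k + 1) (p x)) := by
  obtain ⟨p', h', e⟩ := h.mulRight hV hc
  have hs := h'.sub (h.smul hc)
  have e' : ∀ x ∈ V, ∀ t, k + 1 ≤ Finsupp.weight xiW t + 1 → coeff t (p' x - c x • p x) =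
      coeff t (∑ b, fderiv ℝ c x (stdVec b) • pderiv (Sum.inl b) (p x)) := fun x hx t ht => by
    rw [coeff_sub, e x hx t ht, coeff_add, add_sub_cancel_left]
  have hd : ∀ x ∈ V, WLe xiW k (∑ b, fderiv ℝ c x (stdVec b) • pderiv (Sum.inl b) (p x)) :=
    fun x hx => WLe.sum fun b _ => WLe.smul (by
      intro t ht
      rw [coeff_pderiv] at ht
      have := h.xi x hx _ (left_ne_zero_of_mul ht)
      rw [weight_add_single] at this
      simpa using this) _
  -- The terms of order `k + 1` cancel in the difference: by `e'` its two leading orders agree with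
  -- an expression of order at most `k`.
  refine ⟨_, ⟨hs.smooth, fun x hx t ht => ?_, hs.y, hs.act⟩, fun x hx => ?_⟩
  · by_contra! hlt
    refine ht ?_
    rw [e' x hx t (by omega)]
    by_contra h0
    exact absurd (hd x hx t h0) (by omega)
  · have h2 : part xiW k (p' x - c x • p x) =
        part xiW k (∑ b, fderiv ℝ c x (stdVec b) • pderiv (Sum.inl b) (p x)) := by
      ext t
      rw [part, coeff_weightedHomogeneousComponent, coeff_weightedHomogeneousComponent]
      split_ifs with ht
      · exact e' x hx t (by omega)
      · rfl
    change part xiW k (p' x - c x • p x) = _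
    rw [h2, map_sum]
    refine Finset.sum_congr rfl fun b _ => ?_
    rw [map_smul]
    congr 1
    exact part_pderiv xiW k (Sum.inl b) (p x)

theorem mul_comp (hV : IsOpen V) (h : LocSymb V k N L p) {c : Plane → ℂ}
    (hc : ContDiffOn ℝ ∞ c V) :
    ∃ q, LocSymb V k N (fun f => L (fun y => c y • f y)) q ∧
      ∀ x ∈ V, part xiW k (q x) = c x • part xiW k (p x) := by
  obtain ⟨p', h', e⟩ := h.mulRight hV hc
  exact ⟨p', h', fun x hx => part_mulRight (h.xi x hx) (e x hx)⟩

theorem gr_sub_gl (a : Fin 2) (p : Poly) :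
    gr a p - gl a p = -((2 : ℂ) • ∑ b, ((omega a b : ℝ) : ℂ) • pderiv (Sum.inr b) p) := by
  rw [gr_apply, gl_apply]; module

/-- The commutator with the Clifford multiplication by a vector field. -/
theorem commutator_cliff (hV : IsOpen V) (h : LocSymb V k N L p) {v : Plane → Fin 2 → ℝ}
    (hv : ∀ c, ContDiffOn ℝ ∞ (fun x => v x c) V) :
    ∃ q, LocSymb V k (N + 1)
      (fun f x => L (fun y => cliff (v y) (f y)) x - cliff (v x) (L f x)) q ∧
      ∀ x ∈ V, part xiW k (q x) = ∑ c, (v x c : ℂ) •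
        (gr c (part xiW k (p x)) - gl c (part xiW k (p x))) := by
  have hc : ∀ c, ContDiffOn ℝ ∞ (fun x => ((v x c : ℝ) : ℂ)) V := fun c =>
    MetaplecticStructure.contDiffOn_ofReal (hv c)
  choose q hq e using fun c => h.mul_comp hV (hc c)
  have hs := ((hq 0).gammaRight 0).add ((hq 1).gammaRight 1)
  have hs' := ((h.gammaLeft 0).smul (hc 0)).add ((h.gammaLeft 1).smul (hc 1))
  refine ⟨_, (hs.sub hs').congr fun U hU hUo f hf x hx => ?_, fun x hx => ?_⟩
  · have h0 := (hf.clm hUo (gamma 0)).smul hUo ((hc 0).mono hU)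
    have h1 := (hf.clm hUo (gamma 1)).smul hUo ((hc 1).mono hU)
    simp only [cliff_apply]
    rw [h.act U hU hUo _ (h0.add hUo h1) x hx, opAt_add hUo h0 h1 hx, h.act U hU hUo _ h0 x hx,
      h.act U hU hUo _ h1 x hx]
  · rw [map_sub, map_add, map_add, map_smul, map_smul, part_xiW_gl, part_xiW_gl, part_xiW_gr,
      part_xiW_gr, e 0 x hx, e 1 x hx, Fin.sum_univ_two, map_smul, map_smul]
    module

theorem of_locally (h : ∀ x ∈ V, ∃ W, IsOpen W ∧ x ∈ W ∧ W ⊆ V ∧ ∃ p', LocSymb W k N L p' ∧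
    ∀ y ∈ W, p y = p' y) : LocSymb V k N L p := by
  choose! W hWo hxW hWV p' hp' e using h
  have hW : ∀ x ∈ V, LocSymb (W x) k N L p := fun x hx => (hp' x hx).congr_symb (e x hx)
  refine ⟨fun s x hx => ?_, fun x hx => (hW x hx).xi x (hxW x hx),
    fun x hx => (hW x hx).y x (hxW x hx), fun U hU hUo f hf x hx => ?_⟩
  · exact (((hW x hx).smooth s).contDiffAt ((hWo x hx).mem_nhds (hxW x hx))).contDiffWithinAt
  · have hx' := hU hx
    exact (hW x hx').act (U ∩ W x) inter_subset_right (hUo.inter (hWo x hx')) f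
      (hf.mono inter_subset_left) x ⟨hx, hxW x hx'⟩

end LocSymb

/-! ### Local operators -/

section

open MetaplecticStructure

variable {ι M : Type*} [TopologicalSpace M] [ChartedSpace Plane M]
  {A : MetaplecticStructure ι M} {w w' : ℝ}

theorem equivar_of_clm {Ω : Set M} {Φ : ι → Plane → Spinor →L[ℂ] Spinor}
    (hs : ∀ i U, IsOpen U → U ⊆ A.dom i Ω → ∀ f, SmoothOn f U → SmoothOn (fun x => Φ i x (f x)) U)
    (ht : ∀ i j, ∀ x ∈ A.lap i j, x ∈ A.dom i Ω → ∀ f,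
      (((A.jac i j x).det ^ (w / 3) : ℝ) : ℂ) • Φ j (A.tau i j x) (A.lift i j x f) =
        (((A.jac i j x).det ^ (w' / 3) : ℝ) : ℂ) • A.lift i j x (Φ i x f)) :
    Equivar A w w' Ω fun i f x => Φ i x (f x) :=
  ⟨hs, fun _ _ _ _ _ _ _ hfg x hx => congrArg (Φ _ x) (hfg hx),
    fun i j U _ hUj hUi f _ x hx => by
      rw [tr_tau (hUj hx), map_smul]; exact ht i j x (hUj hx) (hUi hx) (f x)⟩

variable [IsManifold 𝓘(ℝ, Plane) ∞ M] (A)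

theorem equivar_coord (w : ℝ) (n : ι) (a : Fin 2) : Equivar A w w (A.chart n).source
    fun i f x => ((A.tau i n x a : ℝ) : ℂ) • f x := by
  refine equivar_of_clm (A := A) (Φ := fun i x => ((A.tau i n x a : ℝ) : ℂ) • ContinuousLinearMap.id ℂ _)
    (fun i U hU hUi f hf => ?_) fun i j x hx hxi f => ?_
  · rw [← lap_eq_dom] at hUi
    refine hf.smul hU (contDiffOn_ofReal ?_)
    exact ((contDiff_coord a).comp_contDiffOn contDiffOn_tau).mono hUi
  · simp only [smul_apply, ContinuousLinearMap.id_apply, map_smul, tau_comp hx]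

/-- The vectors `u⁻¹ e_a`, where `u` is the normalized Jacobian matrix of the coordinate change. -/
def MetaplecticStructure.frame (n : ι) (a : Fin 2) (i : ι) (x : Plane) : Fin 2 → ℝ :=
  fun c => (A.uni i n x)⁻¹ c a

theorem contDiffOn_frame (n : ι) (a : Fin 2) (i : ι) (c : Fin 2) :
    ContDiffOn ℝ ∞ (fun x => A.frame n a i x c) (A.lap i n) := by
  have h : ∀ c b, ContDiffOn ℝ ∞ (fun x => A.uni i n x c b) (A.lap i n) := fun c b =>
    contDiffOn_uni c b
  have e : ∀ x ∈ A.lap i n, A.frame n a i x c = (!![A.uni i n x 1 1, -A.uni i n x 0 1;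
      -A.uni i n x 1 0, A.uni i n x 0 0] : Matrix (Fin 2) (Fin 2) ℝ) c a := fun x hx => by
    rw [frame, inv_uni hx]
  refine ContDiffOn.congr ?_ e
  obtain rfl | rfl : c = 0 ∨ c = 1 := by omega
  all_goals obtain rfl | rfl : a = 0 ∨ a = 1 := by omega
  · exact h 1 1
  · exact (h 0 1).neg
  · exact (h 1 0).neg
  · exact h 0 0

theorem equivar_frame (w : ℝ) (n : ι) (a : Fin 2) : Equivar A w w (A.chart n).source
    fun i f x => cliff (A.frame n a i x) (f x) := by
  refine equivar_of_clm (Φ := fun i x => cliff (A.frame n a i x))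
    (fun i U hU hUi f hf => ?_) fun i j x hx hxi f => ?_
  · rw [← lap_eq_dom] at hUi
    simp only [cliff_apply]
    exact ((hf.clm hU _).smul hU (contDiffOn_ofReal ((contDiffOn_frame A n a i 0).mono hUi))).add hU
      ((hf.clm hU _).smul hU (contDiffOn_ofReal ((contDiffOn_frame A n a i 1).mono hUi)))
  · rw [← lap_eq_dom] at hxi
    have h := A.lift_cliff i j x hx (A.frame n a i x) f
    rw [h]
    congr 3
    change _ = (A.uni i j x).mulVec _
    have h1 : A.frame n a i x = (A.uni i n x)⁻¹.mulVec (Pi.single a 1) := by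
      rw [Matrix.mulVec_single_one]; rfl
    have h2 : A.frame n a j (A.tau i j x) =
        (A.uni j n (A.tau i j x))⁻¹.mulVec (Pi.single a 1) := by
      rw [Matrix.mulVec_single_one]; rfl
    have hu : IsUnit (A.uni i j x).det := by rw [det_uni hx]; exact isUnit_one
    rw [h1, h2, Matrix.mulVec_mulVec, uni_comp hx hxi, Matrix.mul_inv_rev, ← Matrix.mul_assoc,
      Matrix.mul_nonsing_inv _ hu, Matrix.one_mul]

theorem equivar_density (n : ι) : Equivar A (-9 / 4) (-3 / 4) (A.chart n).source
    fun i f x => (((A.jac i n x).det ^ (-(1 / 2) : ℝ) : ℝ) : ℂ) • f x := by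
  refine equivar_of_clm (A := A) (Φ := fun i x =>
    (((A.jac i n x).det ^ (-(1 / 2) : ℝ) : ℝ) : ℂ) • ContinuousLinearMap.id ℂ _)
    (fun i U hU hUi f hf => ?_) fun i j x hx hxi f => ?_
  · rw [← lap_eq_dom] at hUi
    exact hf.smul hU (contDiffOn_ofReal ((contDiffOn_det_jac_rpow _).mono hUi))
  · rw [← lap_eq_dom] at hxi
    have hd := det_jac_pos hx
    have e : (A.jac i j x).det ^ ((-9 / 4 : ℝ) / 3) =
        (A.jac i j x).det ^ ((-3 / 4 : ℝ) / 3) * (A.jac i j x).det ^ (-(1 / 2) : ℝ) := by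
      rw [← Real.rpow_add hd]; norm_num
    simp only [smul_apply, ContinuousLinearMap.id_apply, map_smul]
    rw [e, det_rpow_comp hx hxi, smul_smul, smul_smul]
    congr 1
    push_cast
    ring

variable {A}

/-- The double commutator of an operator with the coordinates and the frame of a chart. -/
def doubleComm (A : MetaplecticStructure ι M) (L : ι → (Plane → Spinor) → Plane → Spinor) (n : ι)
    (a : Fin 2) (i : ι) (f : Plane → Spinor) (x : Plane) : Spinor :=
  (L i (fun y => ((A.tau i n y a : ℝ) : ℂ) • cliff (A.frame n a i y) (f y)) x -
    ((A.tau i n x a : ℝ) : ℂ) • L i (fun y => cliff (A.frame n a i y) (f y)) x) -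
  cliff (A.frame n a i x) (L i (fun y => ((A.tau i n y a : ℝ) : ℂ) • f y) x -
    ((A.tau i n x a : ℝ) : ℂ) • L i f x)

/-- The local model of the contraction of the symbol. -/
def localContr (A : MetaplecticStructure ι M) (L : ι → (Plane → Spinor) → Plane → Spinor) (n : ι)
    (i : ι) (f : Plane → Spinor) (x : Plane) : Spinor :=
  doubleComm A L n 0 i (fun y => (((A.jac i n y).det ^ (-(1 / 2) : ℝ) : ℝ) : ℂ) • f y) x +
  doubleComm A L n 1 i (fun y => (((A.jac i n y).det ^ (-(1 / 2) : ℝ) : ℝ) : ℂ) • f y) x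

/-- The coordinates of the fixed chart `n` are functions and its frame consists of weighted vector
fields on the chart domain, so both commute with coordinate changes. The density factor supplies the
passage from weight `-9/4` to `-3/4`. -/
theorem equivar_localContr {L : ι → (Plane → Spinor) → Plane → Spinor}
    (h : Equivar A (-3 / 4) (-3 / 4) univ L) (n : ι) :
    Equivar A (-9 / 4) (-3 / 4) (A.chart n).source (localContr A L n) := by
  have h := h.mono (subset_univ (A.chart n).source)
  have h1 : ∀ a, Equivar A (-3 / 4) (-3 / 4) (A.chart n).source (doubleComm A L n a) := fun a => by
    have hc := equivar_coord A (-3 / 4) n a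
    have hf := equivar_frame A (-3 / 4) n a
    have hcomm := (h.comp hc).sub (hc.comp h)
    exact (hcomm.comp hf).sub (hf.comp hcomm)
  exact ((h1 0).comp (equivar_density A n)).add ((h1 1).comp (equivar_density A n))

-- Summed over the frame, the products of frame vectors and coordinate differentials, rescaled by
-- the density, are the identity. This removes the dependence on the chart `n` from the symbol of
-- `localContr`.
omit [IsManifold 𝓘(ℝ, Plane) ∞ M] in
theorem frame_mul_jac {i n : ι} {x : Plane} (hx : x ∈ A.lap i n) (c b : Fin 2) :
    (A.jac i n x).det ^ (-(1 / 2) : ℝ) * (A.frame n 0 i x c * A.jac i n x 0 b +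
      A.frame n 1 i x c * A.jac i n x 1 b) = if c = b then 1 else 0 := by
  have h1 : ((A.uni i n x)⁻¹ * A.uni i n x) c b = if c = b then 1 else 0 := by
    rw [Matrix.nonsing_inv_mul _ (by rw [det_uni hx]; exact isUnit_one), Matrix.one_apply]
  rw [← h1, Matrix.mul_apply, Fin.sum_univ_two]
  change _ = A.frame n 0 i x c * ((A.jac i n x).det ^ (-(1 / 2) : ℝ) * A.jac i n x 0 b) +
    A.frame n 1 i x c * ((A.jac i n x).det ^ (-(1 / 2) : ℝ) * A.jac i n x 1 b)
  ring

/-- The commutator with a coordinate differentiates the symbol in `ξ` along the differential of that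
coordinate. The commutator with a frame vector differentiates it in `y` through `ω`, with factor
`-2`. By `frame_mul_jac` the sum is the invariant contraction, the same for every `n`. -/
theorem locSymb_localContr {L : ι → (Plane → Spinor) → Plane → Spinor} {i n : ι} {k N : ℕ}
    {p : Plane → Poly} (h : LocSymb (A.lap i n) (k + 1) N (L i) p) :
    ∃ q, LocSymb (A.lap i n) k (N + 1) (localContr A L n i) q ∧
      ∀ x ∈ A.lap i n, part xiW k (q x) = (-2 : ℂ) • contr (part xiW (k + 1) (p x)) := by
  have hV := A.isOpen_lap (i := i) (j := n)
  have ht : ∀ a, ContDiffOn ℝ ∞ (fun x => ((A.tau i n x a : ℝ) : ℂ)) (A.lap i n) := fun a =>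
    contDiffOn_ofReal ((contDiff_coord a).comp_contDiffOn contDiffOn_tau)
  have hd : ∀ a, ∀ x ∈ A.lap i n, ∀ b, fderiv ℝ (fun x => ((A.tau i n x a : ℝ) : ℂ)) x
      (stdVec b) = (A.jac i n x a b : ℂ) := fun a x hx b => by
    have h1 : HasFDerivAt (fun x => ((A.tau i n x a : ℝ) : ℂ)) (Complex.ofRealCLM ∘L
        (EuclideanSpace.proj a : Plane →L[ℝ] ℝ) ∘L fderiv ℝ (A.tau i n) x) x :=
      Complex.ofRealCLM.hasFDerivAt.comp x
        ((EuclideanSpace.proj a : Plane →L[ℝ] ℝ).hasFDerivAt.comp x (hasFDerivAt_tau hx))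
    rw [h1.fderiv]
    rfl
  choose q₁ h₁ e₁ using fun a => h.commutator hV (ht a)
  choose q₂ h₂ e₂ using fun a => (h₁ a).commutator_cliff hV (contDiffOn_frame A n a i)
  choose q₃ h₃ e₃ using fun a => (h₂ a).mul_comp hV
    (contDiffOn_ofReal (contDiffOn_det_jac_rpow (A := A) (i := i) (j := n) (-(1 / 2))))
  refine ⟨_, (h₃ 0).add (h₃ 1), fun x hx => ?_⟩
  rw [map_add, e₃ 0 x hx, e₃ 1 x hx, e₂ 0 x hx, e₂ 1 x hx, e₁ 0 x hx, e₁ 1 x hx]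
  simp only [LocSymb.gr_sub_gl, hd _ x hx]
  have hf := fun c b => congrArg (fun r : ℝ => (r : ℂ)) (frame_mul_jac hx c b)
  push_cast at hf
  have f00 := hf 0 0
  have f01 := hf 0 1
  have f10 := hf 1 0
  have f11 := hf 1 1
  simp only [if_true, zero_ne_one, one_ne_zero, if_false, Complex.ofReal_zero,
    Complex.ofReal_one] at f00 f01 f10 f11
  rw [contr_apply]
  have o00 : omega 0 0 = 0 := rfl
  have o01 : omega 0 1 = 1 := rfl
  have o10 : omega 1 0 = -1 := rfl
  have o11 : omega 1 1 = 0 := rfl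
  simp only [Fin.sum_univ_two, o00, o01, o10, o11, map_add, Derivation.map_smul, Complex.ofReal_zero,
    Complex.ofReal_one, Complex.ofReal_neg, zero_smul, add_zero, zero_add, one_smul, neg_smul,
    pderiv_comm (Sum.inr _) (Sum.inl _)]
  generalize pderiv (Sum.inl 0) (pderiv (Sum.inr 0) (part xiW (k + 1) (p x))) = z00
  generalize pderiv (Sum.inl 0) (pderiv (Sum.inr 1) (part xiW (k + 1) (p x))) = z01
  generalize pderiv (Sum.inl 1) (pderiv (Sum.inr 0) (part xiW (k + 1) (p x))) = z10
  generalize pderiv (Sum.inl 1) (pderiv (Sum.inr 1) (part xiW (k + 1) (p x))) = z11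
  linear_combination (norm := module) ((-2 : ℂ) * f00) • z01 + ((-2 : ℂ) * f01) • z11 +
    ((2 : ℂ) * f10) • z00 + ((2 : ℂ) * f11) • z10

end

end

section

open Filter Topology Set MvPolynomial MetaplecticStructure

/-! ### Gluing of local operators -/

variable {ι M : Type*} [TopologicalSpace M] [ChartedSpace Plane M]
  {A : MetaplecticStructure ι M} {w w' : ℝ} {k N : ℕ}

theorem LocSymb.cutoff [IsManifold 𝓘(ℝ, Plane) ∞ M] {χ : M → ℝ}
    (hχ : ContMDiff 𝓘(ℝ, Plane) 𝓘(ℝ, ℝ) ∞ χ) {i n : ι} (hs : tsupport χ ⊆ (A.chart n).source)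
    {L : (Plane → Spinor) → Plane → Spinor} {p : Plane → Poly}
    (h : LocSymb (A.lap i n) k N L p) :
    LocSymb (A.chart i).target k N (fun f x => (χ ((A.chart i).symm x) : ℂ) • L f x)
      (fun x => (χ ((A.chart i).symm x) : ℂ) • p x) := by
  refine LocSymb.of_locally fun x hx => ?_
  by_cases hxs : (A.chart i).symm x ∈ tsupport χ
  · refine ⟨A.lap i n, isOpen_lap, mem_lap.2 ⟨hx, hs hxs⟩, lap_subset, _, h.smul ?_,
      fun _ _ => rfl⟩
    exact contDiffOn_ofReal ((contDiffOn_comp_symm hχ i).mono lap_subset)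
  · refine ⟨_, isOpen_symm_preimage_compl_tsupport χ i, ⟨hx, hxs⟩, dom_subset, fun _ => 0, ?_, ?_⟩
    · refine (LocSymb.zero _ k N).congr fun U hU _ f _ y hy => ?_
      rw [image_eq_zero_of_notMem_tsupport (hU hy).2, Complex.ofReal_zero, zero_smul]
    · intro y hy
      rw [image_eq_zero_of_notMem_tsupport hy.2, Complex.ofReal_zero, zero_smul]

theorem equivar_of_locSymb {L : ι → (Plane → Spinor) → Plane → Spinor} {p : ι → Plane → Poly}
    (h : ∀ i, LocSymb (A.chart i).target k N (L i) (p i))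
    (ht : ∀ i j U, IsOpen U → U ⊆ A.lap i j → ∀ f, SmoothOn f U → ∀ x ∈ U,
      L j (A.tr w i j f) (A.tau i j x) =
        (((A.jac i j x).det ^ (w' / 3) : ℝ) : ℂ) • A.lift i j x (L i f x)) :
    Equivar A w w' univ L :=
  ⟨fun i _ hU hUi _ hf => (h i).smoothOn (hUi.trans dom_subset) hU hf,
    fun i _ hU hUi _ _ hf hfg => (h i).eqOn (hUi.trans dom_subset) hU hf hfg,
    fun i j U hU hUj _ f hf x hx => ht i j U hU hUj f hf x hx⟩

/-- Operators on the domains of the charts with the same principal symbol may be glued. -/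
theorem exists_glued [T2Space M] [SigmaCompactSpace M] [IsManifold 𝓘(ℝ, Plane) ∞ M]
    {L : ι → ι → (Plane → Spinor) → Plane → Spinor} {q : ι → ι → Plane → Poly}
    (hL : ∀ n, Equivar A w w' (A.chart n).source (L n))
    (hq : ∀ n i, LocSymb (A.lap i n) k N (L n i) (q n i)) {v : ι → Plane → Poly}
    (hv : ∀ n i, ∀ x ∈ A.lap i n, part xiW k (q n i x) = v i x) :
    ∃ (L' : ι → (Plane → Spinor) → Plane → Spinor) (p : ι → Plane → Poly),
      Equivar A w w' univ L' ∧ (∀ i, LocSymb (A.chart i).target k N (L' i) (p i)) ∧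
      ∀ i, ∀ x ∈ (A.chart i).target, part xiW k (p i x) = v i x := by
  obtain ⟨χ, hχ⟩ := SmoothPartitionOfUnity.exists_isSubordinate 𝓘(ℝ, Plane) (isClosed_univ (X := M))
    (fun n => (A.chart n).source) (fun n => (A.chart n).open_source)
    (fun m _ => mem_iUnion.2 (A.cover m))
  have hfin : ∀ m, (Function.support fun n => χ n m).Finite := fun m => χ.locallyFinite.point_finite m
  let L' : ι → (Plane → Spinor) → Plane → Spinor := fun i f x =>
    ∑ᶠ n, (χ n ((A.chart i).symm x) : ℂ) • L n i f x
  let p : ι → Plane → Poly := fun i x => ∑ᶠ n, (χ n ((A.chart i).symm x) : ℂ) • q n i x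
  have hp : ∀ i, LocSymb (A.chart i).target k N (L' i) (p i) := fun i => by
    refine LocSymb.of_locally fun x hx => ?_
    obtain ⟨W, hW, hWf⟩ := χ.locallyFinite ((A.chart i).symm x)
    obtain ⟨W', hW', hWo, hxW⟩ := mem_nhds_iff.1 hW
    have key : ∀ y ∈ A.dom i W', ∀ n, χ n ((A.chart i).symm y) ≠ 0 → n ∈ hWf.toFinset :=
      fun y hy n hn => hWf.mem_toFinset.2 ⟨_, hn, hW' hy.2⟩
    refine ⟨A.dom i W', isOpen_dom hWo, ⟨hx, hxW⟩, dom_subset, _,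
      ((LocSymb.sum (t := hWf.toFinset) fun n _ => ((hq n i).cutoff (χ n).contMDiff
        (hχ n))).restrict dom_subset).congr fun U hU hUo f hf y hy => ?_, fun y hy => ?_⟩
    · refine finsum_eq_sum_of_support_subset _ fun n hn => key y (hU hy) n fun h0 => hn ?_
      simp [h0]
    · refine finsum_eq_sum_of_support_subset _ fun n hn => key y hy n fun h0 => hn ?_
      simp [h0]
  refine ⟨L', p, equivar_of_locSymb hp fun i j U hU hUj f hf x hx => ?_, hp, fun i x hx => ?_⟩
  · have hsum : ∀ g : ι → Spinor, (∑ᶠ n, (χ n ((A.chart i).symm x) : ℂ) • g n) =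
        ∑ n ∈ (hfin ((A.chart i).symm x)).toFinset, (χ n ((A.chart i).symm x) : ℂ) • g n := fun g =>
      finsum_eq_sum_of_support_subset _ fun n hn => by
        rw [Finite.coe_toFinset]
        intro h0
        refine hn ?_
        simp [h0]
    change (∑ᶠ n, (χ n ((A.chart j).symm (A.tau i j x)) : ℂ) • _) =
      _ • A.lift i j x (∑ᶠ n, (χ n ((A.chart i).symm x) : ℂ) • _)
    rw [symm_tau (hUj hx), hsum, hsum, map_sum, Finset.smul_sum]
    refine Finset.sum_congr rfl fun n _ => ?_
    rw [map_smul, smul_comm]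
    -- The operator `L n` is equivariant only over the source of the chart `n`; where the cutoff is
    -- nonzero the point lies in that source.
    by_cases h0 : χ n ((A.chart i).symm x) = 0
    · simp [h0]
    · congr 1
      have hxn : x ∈ A.dom i (A.chart n).source :=
        ⟨lap_subset (hUj hx), hχ n (subset_tsupport _ h0)⟩
      exact (hL n).tr i j (U ∩ A.dom i (A.chart n).source)
        (hU.inter (isOpen_dom (A.chart n).open_source)) (inter_subset_left.trans hUj)
        inter_subset_right f (hf.mono inter_subset_left) x ⟨hx, hxn⟩
  · have h1 : p i x = ∑ n ∈ (hfin ((A.chart i).symm x)).toFinset,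
        (χ n ((A.chart i).symm x) : ℂ) • q n i x :=
      finsum_eq_sum_of_support_subset _ fun n hn => by
        rw [Finite.coe_toFinset]
        intro h0
        refine hn ?_
        simp [h0]
    -- The weights add up to one and all local symbols of order `k` agree, so the glued operator has
    -- the same symbol.
    have h2 : (∑ n ∈ (hfin ((A.chart i).symm x)).toFinset, (χ n ((A.chart i).symm x) : ℂ)) = 1 := by
      have h3 := χ.sum_eq_one (mem_univ ((A.chart i).symm x))
      rw [finsum_eq_sum_of_support_subset (s := (hfin ((A.chart i).symm x)).toFinset) _
        (by rw [Finite.coe_toFinset])] at h3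
      exact_mod_cast h3
    rw [h1, map_sum]
    have h4 : ∀ n ∈ (hfin ((A.chart i).symm x)).toFinset,
        part xiW k ((χ n ((A.chart i).symm x) : ℂ) • q n i x) =
          (χ n ((A.chart i).symm x) : ℂ) • v i x := fun n hn => by
      rw [Finite.mem_toFinset] at hn
      rw [map_smul, hv n i x (mem_lap.2 ⟨hx, hχ n (subset_tsupport _ hn)⟩)]
    rw [Finset.sum_congr rfl h4, ← Finset.sum_smul, h2, one_smul]

/-- An operator whose principal symbol is the contraction of a given one. -/
theorem exists_contraction [T2Space M] [SigmaCompactSpace M] [IsManifold 𝓘(ℝ, Plane) ∞ M]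
    {L : ι → (Plane → Spinor) → Plane → Spinor} {p : ι → Plane → Poly}
    (hL : Equivar A (-3 / 4) (-3 / 4) univ L)
    (hp : ∀ i, LocSymb (A.chart i).target (k + 1) N (L i) (p i)) :
    ∃ (L' : ι → (Plane → Spinor) → Plane → Spinor) (q : ι → Plane → Poly),
      Equivar A (-9 / 4) (-3 / 4) univ L' ∧
      (∀ i, LocSymb (A.chart i).target k (N + 1) (L' i) (q i)) ∧
      ∀ i, ∀ x ∈ (A.chart i).target, part xiW k (q i x) =
        (-2 : ℂ) • contr (part xiW (k + 1) (p i x)) := by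
  choose q hq e using fun n i => locSymb_localContr (n := n) ((hp i).restrict (A.lap_subset (j := n)))
  exact exists_glued (equivar_localContr hL) hq e

end

section

open Filter Topology Set MvPolynomial MetaplecticStructure

variable {ι M : Type*} [TopologicalSpace M] [T2Space M] [ChartedSpace Plane M]
  [IsManifold 𝓘(ℝ, Plane) ∞ M] {A : MetaplecticStructure ι M} {nabla : AffineConnection M} {k : ℕ}

theorem isSection_symplecticDirac (hn : nabla.ContMDiffCovariantDerivative ∞)
    {φ : ι → Plane → Spinor} (hφ : IsSection A (-3 / 4) φ) :
    IsSection A (-9 / 4) (symplecticDirac A nabla φ) :=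
  (equivar_diracLoc hn).isSection hφ

/-! ### Reduction to a Cartan symbol -/

section Reduction

variable [SigmaCompactSpace M]

variable (A nabla k) in
/-- The operators `L` of order `k + 1` for which `contr^[r + 1]` annihilates the component with `j`
gamma factors of the symbol, and `contr` those with more factors, are Cartan modulo `D`. -/
def ReducesToCartan (j r : ℕ) : Prop :=
    ∀ (N : ℕ) (L : ι → (Plane → Spinor) → Plane → Spinor) (p : ι → Plane → Poly),
      Equivar A (-3 / 4) (-3 / 4) univ L →
      (∀ i, LocSymb (A.chart i).target (k + 1) N (L i) (p i)) →
      (∀ i, ∀ x ∈ (A.chart i).target, ∀ j', j < j' →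
        contr (part yW j' (part xiW (k + 1) (p i x))) = 0) →
      (∀ i, ∀ x ∈ (A.chart i).target,
        contr^[r + 1] (part yW j (part xiW (k + 1) (p i x))) = 0) →
      ∃ (N' : ℕ) (T : ι → (Plane → Spinor) → Plane → Spinor) (t p' : ι → Plane → Poly),
        Equivar A (-9 / 4) (-3 / 4) univ T ∧
        (∀ i, LocSymb (A.chart i).target k N' (T i) (t i)) ∧
        (∀ i, LocSymb (A.chart i).target (k + 1) N'
          (fun f x => L i f x - T i (diracLoc A nabla i f) x) (p' i)) ∧
        ∀ i, ∀ x ∈ (A.chart i).target, contr (part xiW (k + 1) (p' i x)) = 0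

/-- One application of `exists_correction`, realised by subtracting the composite of a global
contraction operator with the Dirac operator; the two correcting operators then add up. -/
theorem ReducesToCartan.succ (hn : nabla.ContMDiffCovariantDerivative ∞) {j r : ℕ}
    (h : ReducesToCartan A nabla k j r) : ReducesToCartan A nabla k j (r + 1) := by
  intro N L p hL hp h1 h2
  obtain ⟨c, hc⟩ := exists_correction (k + 1) j r
  obtain ⟨C, q, hC, hq, eq⟩ := exists_contraction hL hp
  -- The contraction operator has symbol `-2` times the contraction. Subtracting `c / 2` times its
  -- composite with the Dirac operator therefore adds `c • diracR (contr _)`.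
  have hC' := hC.const_smul (c / 2)
  have hq' : ∀ i, LocSymb (A.chart i).target k (N + 1) (fun f x => (c / 2) • C i f x)
      (fun x => (c / 2) • q i x) := fun i => (hq i).smul (c := fun _ => c / 2) contDiffOn_const
  choose s hs es using fun i => (firstOrder_diracLoc (A := A) hn i).right (hq' i)
  have hL' := hL.sub (hC'.comp (equivar_diracLoc hn))
  have hp' := fun i => ((hp i).mono le_rfl (by omega : N ≤ N + 1 + 3)).sub (hs i)
  have e : ∀ i, ∀ x ∈ (A.chart i).target, part xiW (k + 1) (p i x - s i x) =
      part xiW (k + 1) (p i x) + c • diracR (contr (part xiW (k + 1) (p i x))) := fun i x hx => by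
    rw [map_sub, es i x hx, map_smul, eq i x hx, smul_smul, diracR, diracR]
    simp only [map_smul, mul_smul_comm]
    module
  obtain ⟨N', T, t, p', hT, ht, hp'', hc'⟩ := h _ _ _ hL' hp'
    (fun i x hx j' hj' => by rw [e i x hx]; exact (hc _ (h1 i x hx) (h2 i x hx)).1 j' hj')
    (fun i x hx => by rw [e i x hx]; exact (hc _ (h1 i x hx) (h2 i x hx)).2)
  refine ⟨max N' (N + 1), _, _, p', hC'.add hT, fun i => ((hq' i).mono le_rfl (le_max_right _ _)).add
    ((ht i).mono le_rfl (le_max_left _ _)), fun i => ?_, hc'⟩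
  refine ((hp'' i).mono le_rfl (le_max_left _ _)).congr fun U _ _ f _ x _ => ?_
  exact (sub_sub _ _ _).symm

theorem reducesToCartan (hn : nabla.ContMDiffCovariantDerivative ∞) (j r : ℕ) :
    ReducesToCartan A nabla k j r := by
  induction j generalizing r with
  | zero =>
    induction r with
    | zero =>
      intro N L p hL hp h1 h2
      refine ⟨N, fun _ _ _ => 0, fun _ _ => 0, p, ?_, fun i => LocSymb.zero _ _ _,
        fun i => (hp i).congr fun U _ _ f _ x _ => sub_zero _, fun i x hx => ?_⟩
      · exact equivar_of_locSymb (fun i => LocSymb.zero _ 0 0) fun i j U _ _ f _ x _ => by simp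
      · rw [DiffOp.contr_eq_zero_iff]
        intro j
        rcases Nat.eq_zero_or_pos j with rfl | hj
        · exact h2 i x hx
        · exact h1 i x hx j hj
    | succ r ih =>
      exact ih.succ hn
  | succ j ihj =>
    induction r with
    | zero =>
      intro N L p hL hp h1 h2
      -- The component `j + 1` is now Cartan as well. The next one starts at `r = k + 1`, since `k +
      -- 2` contractions kill any symbol of degree `k + 1` in `ξ`.
      refine ihj (k + 1) N L p hL hp (fun i x hx j' hj' => ?_) fun i x hx =>
        (wLe_part.part j).contr_iterate_eq_zero (by omega)
      rcases eq_or_lt_of_le (Nat.succ_le_of_lt hj') with rfl | h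
      · exact h2 i x hx
      · exact h1 i x hx j' h
    | succ r ih => exact ih.succ hn

/-- Every operator is, modulo the Dirac operator, an operator of the same order with Cartan
symbol. -/
theorem exists_cartan (hn : nabla.ContMDiffCovariantDerivative ∞)
    (O : DiffOp A (-3 / 4) (-3 / 4) k) :
    ∃ (l : ℕ) (T : DiffOp A (-9 / 4) (-3 / 4) l) (R : DiffOp A (-3 / 4) (-3 / 4) k),
      EqModDirac nabla R O.apply T ∧ R.HasCartanSymbol := by
  have hD := equivar_diracLoc (A := A) hn
  -- A symbol of order zero contains no `ξ`, so it is already Cartan and no correction is made.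
  cases k with
  | zero =>
    have h0 : Equivar A (-9 / 4) (-3 / 4) univ fun _ _ _ => 0 :=
      equivar_of_locSymb (fun i => LocSymb.zero _ 0 0) fun i j U _ _ f _ x _ => by simp
    refine ⟨0, DiffOp.ofLocSymb (fun i => LocSymb.zero _ 0 0) fun φ hφ => h0.isSection hφ, O,
      fun φ hφ i x hx => ?_, (O.hasCartanSymbol_iff).2 fun i x hx =>
        (((O.locSymb i).xi x hx).part 0).contr_eq_zero⟩
    rw [Pi.sub_apply, Pi.sub_apply, DiffOp.apply_ofLocSymb _ _ (isSection_symplecticDirac hn hφ) i x hx, sub_zero]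
  | succ k =>
    obtain ⟨N', T, t, p', hT, ht, hp', hc⟩ := reducesToCartan hn O.deg (k + 1) O.deg
      O.loc O.poly O.equivar O.locSymb
      (fun i x hx j hj => by
        rw [part_comm, ((O.locSymb i).y x hx).part_eq_zero hj, map_zero, map_zero])
      (fun i x hx => (wLe_part.part O.deg).contr_iterate_eq_zero (by omega))
    have hR := O.equivar.sub (hT.comp hD)
    refine ⟨k, DiffOp.ofLocSymb ht fun φ hφ => hT.isSection hφ,
      DiffOp.ofLocSymb hp' fun φ hφ => hR.isSection hφ, fun φ hφ i x hx => ?_,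
      (DiffOp.hasCartanSymbol_iff _).2 fun i x hx => ?_⟩
    · rw [DiffOp.apply_ofLocSymb _ _ hφ i x hx, Pi.sub_apply, Pi.sub_apply,
        DiffOp.apply_ofLocSymb _ _ (isSection_symplecticDirac hn hφ) i x hx]
      rfl
    · rw [DiffOp.poly_ofLocSymb _ _ hx]
      exact hc i x hx

end Reduction

/-! ### The symbol of `D O` modulo `D` -/

/-- Faithfulness of the symbol calculus needs all local functions as test functions; global sections
suffice because germs extend. -/
theorem eq_zero_of_opAt_section {w : ℝ} {i : ι} {x : Plane} (hx : x ∈ (A.chart i).target) {p : Poly}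
    (h : ∀ φ, IsSection A w φ → opAt (φ i) x p = 0) : p = 0 := by
  refine eq_zero_of_opAt_eq_zero (A.chart i).open_target hx fun f hf => ?_
  obtain ⟨φ, hφ, V, hV, hVo, hxV, e⟩ := exists_section_eqOn (A := A) (w := w)
    (A.chart i).open_target Subset.rfl hf hx
  rw [← opAt_congr_of_eqOn hVo e hxV]
  exact h φ hφ

theorem LocSymb.act_sub {V : Set Plane} {k N : ℕ} {L : (Plane → Spinor) → Plane → Spinor}
    {p : Plane → Poly} (h : LocSymb V k N L p) (hV : IsOpen V) {f g : Plane → Spinor}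
    (hf : SmoothOn f V) (hg : SmoothOn g V) {x : Plane} (hx : x ∈ V) :
    L (fun y => f y - g y) x = L f x - L g x := by
  have e : (fun y => f y - g y) = fun y => f y + (-1 : ℂ) • g y := by
    funext y; rw [neg_one_smul, sub_eq_add_neg]
  have hg' : SmoothOn (fun y => (-1 : ℂ) • g y) V := hg.smul hV contDiffOn_const
  rw [e, h.act V Subset.rfl hV _ (hf.add hV hg') x hx, opAt_add hV hf hg' hx,
    opAt_const_smul hV hg hx, h.act V Subset.rfl hV f hf x hx, h.act V Subset.rfl hV g hg x hx,
    neg_one_smul, sub_eq_add_neg]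

/-- If `D R = T D + Q` at a point, with `R` and `Q` of order at most `k` and `R` of Cartan symbol,
then the symbol of `R` is scalar there. -/
theorem part_yW_eq_zero_of_dirac_comp (hn : nabla.ContMDiffCovariantDerivative ∞)
    (R : DiffOp A (-3 / 4) (-3 / 4) k) (hR : R.HasCartanSymbol) {i : ι} {x : Plane}
    (hx : x ∈ (A.chart i).target) {l N : ℕ} {t q : Poly} (htl : WLe xiW l t) (htN : WLe yW N t)
    (hq : WLe xiW k q) (h : ∀ φ, IsSection A (-3 / 4) φ → diracLoc A nabla i (R.loc i (φ i)) x =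
      opAt (diracLoc A nabla i (φ i)) x t + opAt (φ i) x q) {j : ℕ} (hj : 1 ≤ j) :
    part yW j (part xiW k (R.poly i x)) = 0 := by
  have hV := (A.chart i).open_target
  have hD := firstOrder_diracLoc (A := A) hn i
  obtain ⟨p, hp, ep⟩ := hD.left (R.locSymb i)
  -- By faithfulness the two sides of `h` have the same full symbol at `x`. The operator with
  -- constant symbol `t` can replace the one multiplying the Dirac operator, because only its value
  -- at `x` matters.
  have key : ∀ m, WLe xiW m t → ∃ t₁, WLe xiW (m + 1) t₁ ∧
      part xiW (m + 1) t₁ = diracR (part xiW m t) ∧ p x = t₁ + q := fun m hm => by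
    obtain ⟨t₁, ht₁, et₁⟩ := hD.right (LocSymb.const (A.chart i).target hm htN)
    refine ⟨t₁ x, ht₁.xi x hx, et₁ x hx, sub_eq_zero.1 ?_⟩
    refine eq_zero_of_opAt_section (w := -3 / 4) hx fun φ hφ => ?_
    rw [map_sub, map_add, ← hp.act _ Subset.rfl hV _ (hφ.smooth i) x hx,
      ← ht₁.act _ Subset.rfl hV _ (hφ.smooth i) x hx, h φ hφ, sub_self]
  -- If `t` had order above `k`, its leading part would lie in the kernel of `diracR`, because the
  -- other terms have order at most `k + 1`. Injectivity lowers the order step by step to `k`.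
  have hdesc : ∀ d, WLe xiW (k + d) t → WLe xiW k t := by
    intro d
    induction d with
    | zero => exact id
    | succ d ih =>
      intro hd
      obtain ⟨t₁, -, e₁, e₂⟩ := key _ hd
      refine ih (WLe.of_part_eq_zero hd (eq_zero_of_diracR_eq_zero (htN.part _) ?_))
      change diracR (part xiW (k + (d + 1)) t) = 0
      rw [← e₁, eq_sub_of_add_eq e₂.symm, map_sub, (hp.xi x hx).part_eq_zero (by omega),
        hq.part_eq_zero (by omega), sub_zero]
  have htk : WLe xiW k t := hdesc l (htl.mono (Nat.le_add_left l k))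
  obtain ⟨t₁, -, e₁, e₂⟩ := key k htk
  have h0 := (R.hasCartanSymbol_iff).1 hR i x hx
  refine part_yW_eq_zero_of_polar_eq_zero h0 (polar_eq_zero_of_diracL_eq_diracR
    (N := max R.deg N) (((R.locSymb i).y x hx).mono (le_max_left _ _))
    (htN.mono (le_max_right _ _)) h0 ?_) hj
  rw [← ep x hx, ← e₁, e₂, map_add, hq.part_eq_zero (Nat.lt_succ_self k), add_zero]

/-- The core of the classification: if `D O = T' D + Q` at a point with `Q` of order at most `k`,
then every Cartan representative of `O` modulo `D` has a scalar symbol there. -/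
theorem symbol_eq_zero_of_dirac_comp (hn : nabla.ContMDiffCovariantDerivative ∞)
    {O R : DiffOp A (-3 / 4) (-3 / 4) k} {l : ℕ} {T : DiffOp A (-9 / 4) (-3 / 4) l}
    (hE : EqModDirac nabla R O.apply T) (hR : R.HasCartanSymbol) {i : ι} {x : Plane}
    (hx : x ∈ (A.chart i).target) {l' : ℕ} (T' : DiffOp A (-9 / 4) (-9 / 4) l') {q : Poly}
    (hq : WLe xiW k q) (h : ∀ φ, IsSection A (-3 / 4) φ →
      symplecticDirac A nabla (O.apply φ) i x =
        T'.apply (symplecticDirac A nabla φ) i x + opAt (φ i) x q) {j : ℕ} (hj : 1 ≤ j) :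
    R.symbol i x j = 0 := by
  have hV := (A.chart i).open_target
  have hD := firstOrder_diracLoc (A := A) hn i
  obtain ⟨p, hp, -⟩ := hD.left (T.locSymb i)
  obtain ⟨d, hd, -⟩ := hD.left (LocSymb.id (A.chart i).target)
  -- From `R = O - T D` one gets `D R = (T' - D T) D + q`; this is the symbol of `T' - D T`.
  have ht := ((T'.locSymb i).mono (le_max_left l' (l + 1)) (le_max_left T'.deg (T.deg + 3))).sub
    (hp.mono (le_max_right l' (l + 1)) (le_max_right T'.deg (T.deg + 3)))
  rw [DiffOp.symbol_eq_zero_iff R hx]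
  refine part_yW_eq_zero_of_dirac_comp hn R hR hx (ht.xi x hx) (ht.y x hx) hq (fun φ hφ => ?_) hj
  have hDφ : SmoothOn (diracLoc A nabla i (φ i)) (A.chart i).target :=
    hD.smooth _ Subset.rfl hV _ (hφ.smooth i)
  have e1 : EqOn (R.loc i (φ i)) (fun y => O.loc i (φ i) y - T.loc i (diracLoc A nabla i (φ i)) y)
      (A.chart i).target := fun y hy => hE φ hφ i y hy
  have hO := (O.locSymb i).smoothOn Subset.rfl hV (hφ.smooth i)
  rw [← ht.act _ Subset.rfl hV _ hDφ x hx,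
    hd.eqOn Subset.rfl hV ((R.locSymb i).smoothOn Subset.rfl hV (hφ.smooth i)) e1 hx,
    hd.act_sub hV hO ((T.locSymb i).smoothOn Subset.rfl hV hDφ) hx]
  have e2 := h φ hφ
  rw [symplecticDirac_apply, DiffOp.apply_eq_loc, DiffOp.apply_eq_loc, symplecticDirac_apply] at e2
  rw [e2]
  abel

end

end SymplecticSpinor

end

theorem mainTheorem4 {ι M : Type*} [TopologicalSpace M] [T2Space M] [SigmaCompactSpace M]
    [ChartedSpace Plane M] [IsManifold 𝓘(ℝ, Plane) ∞ M]
    (A : MetaplecticStructure ι M) (nabla : AffineConnection M)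
    (nabla_smooth : nabla.ContMDiffCovariantDerivative ∞)
    (nabla_torsionFree : nabla.torsion = 0)
    (k : ℕ) (O : DiffOp A (-3 / 4) (-3 / 4) k) :
    -- modulo `D_s`, the principal symbol of `O` lies in the Cartan part
    (∃ (l : ℕ) (T : DiffOp A (-9 / 4) (-3 / 4) l) (R : DiffOp A (-3 / 4) (-3 / 4) k),
      EqModDirac nabla R O.apply T ∧ R.HasCartanSymbol) ∧
    -- if this principal symbol modulo `D_s` has a component with `j ≥ 1` gamma factors that does
    -- not vanish at a point, then `D_s O` is of order at most `k + 1`, and no operator congruent to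
    -- it modulo `D_s` has order `≤ k` or a symbol of order `k + 1` vanishing at that point
    (∀ (l : ℕ) (T : DiffOp A (-9 / 4) (-3 / 4) l) (R : DiffOp A (-3 / 4) (-3 / 4) k),
      EqModDirac nabla R O.apply T → R.HasCartanSymbol →
      ∀ i, ∀ x ∈ (A.chart i).target, ∀ j : ℕ, 1 ≤ j → R.symbol i x j ≠ 0 →
        (∃ P : DiffOp A (-3 / 4) (-9 / 4) (k + 1), ∀ φ, IsSection A (-3 / 4) φ →
          SameSection A (P.apply φ) (symplecticDirac A nabla (O.apply φ))) ∧
        ∀ (l' : ℕ) (T' : DiffOp A (-9 / 4) (-9 / 4) l'),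
          (∀ Q : DiffOp A (-3 / 4) (-9 / 4) (k + 1),
            EqModDirac nabla Q (fun φ => symplecticDirac A nabla (O.apply φ)) T' →
              ∃ j', Q.symbol i x j' ≠ 0) ∧
          ∀ Q : DiffOp A (-3 / 4) (-9 / 4) k,
            ¬ EqModDirac nabla Q (fun φ => symplecticDirac A nabla (O.apply φ)) T') ∧
    -- the principal symbol of a symmetry is, modulo `D_s`, a section of `S^k TM ⊗ 1`
    (IsSymmetry nabla O →
      (∃ (l : ℕ) (T : DiffOp A (-9 / 4) (-3 / 4) l) (R : DiffOp A (-3 / 4) (-3 / 4) k),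
        EqModDirac nabla R O.apply T ∧ R.HasScalarSymbol) ∧
      ∀ (l : ℕ) (T : DiffOp A (-9 / 4) (-3 / 4) l) (R : DiffOp A (-3 / 4) (-3 / 4) k),
        EqModDirac nabla R O.apply T → R.HasCartanSymbol → R.HasScalarSymbol) := by
  refine ⟨exists_cartan nabla_smooth O, fun l T R hE hR i x hx j hj hs => ⟨?_, fun l' T' => ?_⟩,
    fun ⟨l', O', hO'⟩ => ?_⟩
  · choose p hp _ using fun i => (firstOrder_diracLoc (A := A) nabla_smooth i).left (O.locSymb i)
    have hN : ∀ i, LocSymb (A.chart i).target (k + 1) (O.deg + 3)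
      (fun f => diracLoc A nabla i (O.loc i f)) (p i) := hp
    exact ⟨DiffOp.ofLocSymb hN fun φ hφ =>
      ((equivar_diracLoc nabla_smooth).comp O.equivar).isSection hφ, fun φ hφ =>
      DiffOp.apply_ofLocSymb _ _ hφ⟩
  -- Only the order at the point `x` matters. A representative of order at most `k + 1` whose symbol
  -- vanishes there has order at most `k` at `x`, so both nonexistence claims reduce to this one.
  · have key : ∀ {m : ℕ} (Q : DiffOp A (-3 / 4) (-9 / 4) m), WLe xiW k (Q.poly i x) →
        ¬ EqModDirac nabla Q (fun φ => symplecticDirac A nabla (O.apply φ)) T' :=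
      fun Q hQ hEQ => hs (symbol_eq_zero_of_dirac_comp nabla_smooth hE hR hx T' hQ
        (fun φ hφ => by
          rw [← (Q.locSymb i).act _ Set.Subset.rfl (A.chart i).open_target _ (hφ.smooth i) x hx,
            ← DiffOp.apply_eq_loc, hEQ φ hφ i x hx, Pi.sub_apply, Pi.sub_apply,
            add_sub_cancel]) hj)
    refine ⟨fun Q hEQ => ?_, fun Q => key Q ((Q.locSymb i).xi x hx)⟩
    by_contra! h0
    refine key Q (WLe.of_part_eq_zero ((Q.locSymb i).xi x hx) ?_) hEQ
    exact DiffOp.eq_zero_of_part_eq_zero fun j' => (Q.symbol_eq_zero_iff hx j').1 (h0 j')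
  -- For a symmetry the pointwise criterion applies with remainder `q = 0`, at every point.
  · have key : ∀ (l : ℕ) (T : DiffOp A (-9 / 4) (-3 / 4) l) (R : DiffOp A (-3 / 4) (-3 / 4) k),
        EqModDirac nabla R O.apply T → R.HasCartanSymbol → R.HasScalarSymbol :=
      fun l T R hE hR i x hx j hj => symbol_eq_zero_of_dirac_comp nabla_smooth hE hR hx O'
        wLe_zero (fun φ hφ => by rw [map_zero, add_zero]; exact hO' φ hφ i x hx) hj
    obtain ⟨l, T, R, hE, hR⟩ := exists_cartan nabla_smooth O
    exact ⟨⟨l, T, R, hE, key l T R hE hR⟩, key⟩
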